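/- Let $\Bbbk$ be an algebraically closed field of characteristic zero and let $q\in\Bbbk^*=\Bbbk\setminus\{0\}$ be not a root of unity. Let $D_q$ be the Heisenberg double of the quantum Euclidean group, i.e. the (unital, associative) $\Bbbk$-algebra generated by $a,a^{-1},b,c,K,K^{-1},E,F$ subject to the defining relations $$ab=qba,\quad ac=qca,\quad bc=cb,\quad aa^{-1}=a^{-1}a=1,$$ $$KE=q^2EK,\quad KF=q^{-2}FK,\quad EF=FE,\quad KK^{-1}=K^{-1}K=1,$$ $$Ka=q^{-1}aK,\quad Kb=qbK,\quad Kc=q^{-1}cK,\quad Ea=aE,\quad Eb=bE,\quad Ec=cE+a^{-1}K,$$ $$Fa=qaF,\quad Fb=q^{-1}bF+a,\quad Fc=qcF.$$ Put $\phi=(1-q^2)Fb+q^2a$ and $\psi=(1-q^{-2})Ec+q^{-2}a^{-1}K$, and write $\mathrm{Aut}\,D_q$ for the group of $\Bbbk$-algebra automorphisms of $D_q$. (1) For all $t=(\lambda,\mu,\gamma,\nu)\in(\Bbbk^*)^4$ and all $M=\begin{pmatrix} i&j\\ m&n\end{pmatrix}\in\mathrm{SL}_2(\mathbb Z)$ there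 is a unique automorphism $\rho_{t,M}=\rho_{\lambda,\mu,\gamma,\nu,i,j,m,n}$ of $D_q$ such that $$K\mapsto\lambda K^ia^j,\qquad a\mapsto\mu K^ma^n,\qquad F\mapsto\gamma K^{-i+2m+1}a^{-j+2n-2}F,$$ $$b\mapsto\mu\gamma^{-1}q^{ij+2mn-3in-2j+3n}K^{i-m-1}a^{j-n+1}b,$$ $$E\mapsto\nu K^{-2m}a^{-2n+2}E,\qquad c\mapsto\lambda\mu^{-1}\nu^{-1}q^{in+3mn-j-n}K^{i+m-1}a^{j+n-1}c.$$ (2) Every $\rho\in\mathrm{Aut}\,D_q$ equals $\rho_{t,M}$ for exactly one pair $(t,M)\in(\Bbbk^*)^4\times\mathrm{SL}_2(\mathbb Z)$. (3) $\mathrm{Aut}\,D_q\cong(\Bbbk^*)^4\rtimes\mathrm{SL}_2(\mathbb Z)$: for some action of $\mathrm{SL}_2(\mathbb Z)$ on $(\Bbbk^*)^4$ by group automorphisms there is a group isomorphism $e:(\Bbbk^*)^4\rtimes\mathrm{SL}_2(\mathbb Z)\to\mathrm{Aut}\,D_q$ such that $e(t,1)=\rho_{t,1}$ for all $t\in(\Bbbk^*)^4$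 and, for each $(t,g)$, $e(t,g)=\rho_{t',g^{\mathsf T}}$ for some $t'\in(\Bbbk^*)^4$. (4) The height one prime ideals of $D_q$ are precisely the two-sided ideals $(\phi)$ and $(\psi)$, and no automorphism $\rho$ of $D_q$ interchanges them, i.e. satisfies both $\rho((\phi))=(\psi)$ and $\rho((\psi))=(\phi)$. -/

import Mathlib

open scoped MatrixGroups

namespace HeisenbergDouble

/-- Names of the generators `a, a⁻¹, b, c, K, K⁻¹, E, F`. -/
inductive Gen : Type
  | a | aInv | b | c | K | KInv | E | F

section Presentation

variable (k : Type*) [Field k] (q : kˣ)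

/-- The generator with name `g` in the free algebra. -/
abbrev gen (g : Gen) : FreeAlgebra k Gen := FreeAlgebra.ι k g

open Gen in
/-- The defining relations of the Heisenberg double of the quantum Euclidean group. -/
inductive Rel : FreeAlgebra k Gen → FreeAlgebra k Gen → Prop
  | a_b : Rel (gen k a * gen k b) ((q : k) • (gen k b * gen k a))
  | a_c : Rel (gen k a * gen k c) ((q : k) • (gen k c * gen k a))
  | b_c : Rel (gen k b * gen k c) (gen k c * gen k b)
  | a_aInv : Rel (gen k a * gen k aInv) 1
  | aInv_a : Rel (gen k aInv * gen k a) 1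
  | K_E : Rel (gen k K * gen k E) ((q : k) ^ 2 • (gen k E * gen k K))
  | K_F : Rel (gen k K * gen k F) ((q : k) ^ (-2 : ℤ) • (gen k F * gen k K))
  | E_F : Rel (gen k E * gen k F) (gen k F * gen k E)
  | K_KInv : Rel (gen k K * gen k KInv) 1
  | KInv_K : Rel (gen k KInv * gen k K) 1
  | K_a : Rel (gen k K * gen k a) ((q : k)⁻¹ • (gen k a * gen k K))
  | K_b : Rel (gen k K * gen k b) ((q : k) • (gen k b * gen k K))
  | K_c : Rel (gen k K * gen k c) ((q : k)⁻¹ • (gen k c * gen k K))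
  | E_a : Rel (gen k E * gen k a) (gen k a * gen k E)
  | E_b : Rel (gen k E * gen k b) (gen k b * gen k E)
  | E_c : Rel (gen k E * gen k c) (gen k c * gen k E + gen k aInv * gen k K)
  | F_a : Rel (gen k F * gen k a) ((q : k) • (gen k a * gen k F))
  | F_b : Rel (gen k F * gen k b) ((q : k)⁻¹ • (gen k b * gen k F) + gen k a)
  | F_c : Rel (gen k F * gen k c) ((q : k) • (gen k c * gen k F))

/-- The Heisenberg double `D_q`: the `k`-algebra given by the generators `Gen` and the
relations `Rel`. -/
abbrev D : Type _ := RingQuot (Rel k q)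

/-- The image in `D_q` of a generator. -/
noncomputable def x (g : Gen) : D k q := RingQuot.mkAlgHom k (Rel k q) (gen k g)

/-- `a` as a unit of `D_q`. -/
noncomputable def aUnit : (D k q)ˣ where
  val := x k q Gen.a
  inv := x k q Gen.aInv
  val_inv := by
    simpa [x] using RingQuot.mkAlgHom_rel k (Rel.a_aInv (k := k) (q := q))
  inv_val := by
    simpa [x] using RingQuot.mkAlgHom_rel k (Rel.aInv_a (k := k) (q := q))

/-- `K` as a unit of `D_q`. -/
noncomputable def KUnit : (D k q)ˣ where
  val := x k q Gen.K
  inv := x k q Gen.KInv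
  val_inv := by
    simpa [x] using RingQuot.mkAlgHom_rel k (Rel.K_KInv (k := k) (q := q))
  inv_val := by
    simpa [x] using RingQuot.mkAlgHom_rel k (Rel.KInv_K (k := k) (q := q))

/-- The element `K^r a^s` of `D_q`, for integers `r` and `s`. -/
noncomputable def KA (r s : ℤ) : D k q := ((KUnit k q ^ r * aUnit k q ^ s : (D k q)ˣ) : D k q)

/-- `φ = (1 - q²) F b + q² a`. -/
noncomputable def phi : D k q :=
  (1 - (q : k) ^ 2) • (x k q Gen.F * x k q Gen.b) + (q : k) ^ 2 • x k q Gen.a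

/-- `ψ = (1 - q⁻²) E c + q⁻² a⁻¹ K`. -/
noncomputable def psi : D k q :=
  (1 - (q : k) ^ (-2 : ℤ)) • (x k q Gen.E * x k q Gen.c) +
    (q : k) ^ (-2 : ℤ) • (x k q Gen.aInv * x k q Gen.K)

/-- The group `(k*)⁴`; its elements are the quadruples `(lam, mu, ga, nu)`. -/
abbrev Torus : Type _ := kˣ × kˣ × kˣ × kˣ

variable {k q}

/-- The algebra automorphism `ρ` is `ρ_{λ,μ,γ,ν,i,j,m,n}`, where `t = (λ, μ, γ, ν)` and
`M = (i j; m n)`. -/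
def IsRho (ρ : D k q ≃ₐ[k] D k q) (t : Torus k) (M : SL(2, ℤ)) : Prop :=
  let lam := t.1
  let mu := t.2.1
  let ga := t.2.2.1
  let nu := t.2.2.2
  let i := M.1 0 0
  let j := M.1 0 1
  let m := M.1 1 0
  let n := M.1 1 1
  ρ (x k q Gen.K) = (lam : k) • KA k q i j ∧
  ρ (x k q Gen.a) = (mu : k) • KA k q m n ∧
  ρ (x k q Gen.F) =
    (ga : k) • (KA k q (-i + 2 * m + 1) (-j + 2 * n - 2) * x k q Gen.F) ∧
  ρ (x k q Gen.b) =
    ((mu * ga⁻¹ * q ^ (i * j + 2 * m * n - 3 * i * n - 2 * j + 3 * n) : kˣ) : k) •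
      (KA k q (i - m - 1) (j - n + 1) * x k q Gen.b) ∧
  ρ (x k q Gen.E) = (nu : k) • (KA k q (-2 * m) (-2 * n + 2) * x k q Gen.E) ∧
  ρ (x k q Gen.c) =
    ((lam * mu⁻¹ * nu⁻¹ * q ^ (i * n + 3 * m * n - j - n) : kˣ) : k) •
      (KA k q (i + m - 1) (j + n - 1) * x k q Gen.c)

end Presentation

section Primes

variable {R : Type*} [Ring R]

/-- Prime (two-sided) ideals of a not necessarily commutative ring, in the elementwise form:
`P` is proper, and `x R y ⊆ P` implies `x ∈ P` or `y ∈ P`. -/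
def IsPrimeIdeal (P : TwoSidedIdeal R) : Prop :=
  P ≠ ⊤ ∧ ∀ x y : R, (∀ r : R, x * r * y ∈ P) → x ∈ P ∨ y ∈ P

variable (R) in
/-- The prime spectrum of `R`, ordered by inclusion. -/
abbrev PrimeSpec : Type _ := {P : TwoSidedIdeal R // IsPrimeIdeal P}

/-- `P` is a prime ideal of height one. -/
def IsHeightOnePrime (P : TwoSidedIdeal R) : Prop :=
  ∃ hP : IsPrimeIdeal P, Order.height (⟨P, hP⟩ : PrimeSpec R) = 1

end Primes

end HeisenbergDouble

/-! Choose `s` with `s ^ 2 = q`. The symmetrized monomials `W s r t` form a quantum torus, and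
multiplying `b`, `c`, `F`, `E` by suitable ones (and `F`, `E` by scalars) gives generators `bD`,
`cD`, `fD`, `eD` that commute with it. The pairs (`bD`, `fD`) and (`cD`, `eD`) satisfy quantum Weyl
relations, and generators from different pairs commute up to a power of `s`; `Datum` records this
presentation. In it the automorphisms are visible: `SL₂(ℤ)` acts on the exponents of the torus
(`slAut`), and `(k*)⁴` acts by scalars (`diagAut`). Up to units, `φ` is `1 - b f` and `ψ` is `1 - c
e`; both are normal.

Since `f = b⁻¹ (1 - φ)` and `e = c⁻¹ (1 - ψ)`, the algebra maps to a quantum torus on `φ, ψ, b, c,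
K, a`. Leading exponents for the lexicographic order show that this map `emb` is injective, and that
setting `φ = 0` or `ψ = 0` has kernel exactly `(φ)` or `(ψ)`; hence `0`, `(φ)`, `(ψ)` are prime.
Conversely a nonzero ideal contains an element that is a monomial in the quantum torus, and skew
commutators with `f` and `e` then remove `b` and `c`, so the ideal contains some `φ ^ n ψ ^ m`
(`exists_phi_pow_mul_psi_pow_mem`). A nonzero prime therefore contains `φ` or `ψ`.

The units are the scalar multiples of the `W s r t` (`exists_eq_smul_W`), so an automorphism induces
an integer matrix on exponents, of determinant 1 because it preserves the commutation of `K` and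
`a`. After dividing by elements of both groups it fixes the torus; it then permutes `φ` and `ψ` up
to scalars (`map_theta`). A swap contradicts the relation of `b` and `c` (`not_swap`); otherwise
weights and leading exponents force `b`, `c`, `e`, `f` to be rescaled (`exists_eq_diagAut`). Thus
every automorphism is uniquely `slAut g * diagAut u`, and `isRho_slAut_mul_diagAut` translates this
into the parameters of `IsRho`. -/

/-- The twisted group algebra of `G` over `k`: basis `e_g`, product
`e_g e_h = s ^ ω(g, h) e_{g+h}`. -/
def TwistedAlg {k G : Type*} [Field k] [AddCommGroup G] (_s : kˣ) (_ω : G →+ G →+ ℤ) : Type _ :=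
  G →₀ k

/-! ### Twisted group algebras: ring structure and coefficients -/

namespace TwistedAlg

variable {k G : Type*} [Field k] [AddCommGroup G] {s : kˣ} {ω : G →+ G →+ ℤ}

noncomputable instance : AddCommGroup (TwistedAlg s ω) := inferInstanceAs (AddCommGroup (G →₀ k))
noncomputable instance : Module k (TwistedAlg s ω) := inferInstanceAs (Module k (G →₀ k))

variable (s ω) in
/-- The basis of the elements `e_g`. -/
noncomputable def basis : Module.Basis G k (TwistedAlg s ω) :=
  Module.Basis.ofRepr (LinearEquiv.refl k (G →₀ k))

/-- The coefficient of `x` at `g`. -/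
noncomputable def coeff (g : G) : TwistedAlg s ω →ₗ[k] k := (basis s ω).coord g

/-- The element `r e_g`. -/
noncomputable def single (g : G) (r : k) : TwistedAlg s ω := r • basis s ω g

/-- The support of `x`. -/
noncomputable def supp (x : TwistedAlg s ω) : Finset G := ((basis s ω).repr x).support

lemma mem_supp {x : TwistedAlg s ω} {g : G} : g ∈ x.supp ↔ coeff g x ≠ 0 :=
  Finsupp.mem_support_iff

@[ext]
lemma ext {x y : TwistedAlg s ω} (h : ∀ g, coeff g x = coeff g y) : x = y :=
  (basis s ω).ext_elem h

lemma smul_single (c : k) (g : G) (r : k) :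
    c • single (s := s) (ω := ω) g r = single g (c * r) := smul_smul _ _ _

lemma single_ne_zero (g : G) : single (s := s) (ω := ω) g 1 ≠ 0 := by
  simpa [single] using (basis s ω).ne_zero g

lemma sum_single (x : TwistedAlg s ω) : ∑ g ∈ x.supp, single g (coeff g x) = x :=
  (basis s ω).linearCombination_repr x

lemma coeff_single [DecidableEq G] (g h : G) (r : k) :
    coeff h (single (s := s) (ω := ω) g r) = if g = h then r else 0 := by
  simp [coeff, single, Finsupp.single_apply]

@[simp]
lemma coeff_single_self (g : G) (r : k) : coeff g (single (s := s) (ω := ω) g r) = r := by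
  classical simp [coeff_single]

lemma coeff_single_of_ne {g h : G} (r : k) (hgh : g ≠ h) :
    coeff h (single (s := s) (ω := ω) g r) = 0 := by
  classical simp [coeff_single, hgh]

lemma eq_single {x : TwistedAlg s ω} {g : G} (h : ∀ h, coeff h x ≠ 0 → h = g) :
    x = single g (coeff g x) := by
  classical
  ext u
  by_cases hu : g = u
  · subst hu; simp
  · rw [coeff_single_of_ne _ hu]
    by_contra hc
    exact hu (h _ hc).symm

lemma induction_single {p : TwistedAlg s ω → Prop} (x : TwistedAlg s ω) (h0 : p 0)
    (hadd : ∀ x y, p x → p y → p (x + y)) (hs : ∀ g r, p (single g r)) : p x := by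
  rw [← sum_single x]
  exact Finset.sum_induction _ p hadd h0 fun g _ ↦ hs g _

/-- The product as a bilinear map. -/
noncomputable def mulLin : TwistedAlg s ω →ₗ[k] TwistedAlg s ω →ₗ[k] TwistedAlg s ω :=
  (basis s ω).constr k fun g ↦ (basis s ω).constr k fun h ↦ ((s : k) ^ ω g h) • basis s ω (g + h)

noncomputable instance : Mul (TwistedAlg s ω) := ⟨fun x y ↦ mulLin x y⟩
noncomputable instance : One (TwistedAlg s ω) := ⟨single 0 1⟩

lemma mul_def (x y : TwistedAlg s ω) : x * y = mulLin x y := rfl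
lemma one_def : (1 : TwistedAlg s ω) = single 0 1 := rfl

lemma single_mul_single (g h : G) (r t : k) :
    single (s := s) (ω := ω) g r * single h t = single (g + h) ((s : k) ^ ω g h * r * t) := by
  simp only [mul_def, single, mulLin, map_smul, LinearMap.smul_apply, Module.Basis.constr_basis,
    smul_smul]
  congr 1
  ring

noncomputable instance : Ring (TwistedAlg s ω) where
  __ := (inferInstance : AddCommGroup (TwistedAlg s ω))
  left_distrib x y z := (mulLin x).map_add y z
  right_distrib x y z := by simp [mul_def]
  zero_mul x := by simp [mul_def]
  mul_zero x := by simp [mul_def]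
  mul_assoc x y z := by
    induction x using induction_single with
    | h0 => simp [mul_def]
    | hadd x x' hx hx' => simp only [mul_def, map_add, LinearMap.add_apply] at hx hx' ⊢; rw [hx, hx']
    | hs g r =>
    induction y using induction_single with
    | h0 => simp [mul_def]
    | hadd x x' hx hx' => simp only [mul_def, map_add, LinearMap.add_apply] at hx hx' ⊢; rw [hx, hx']
    | hs h t =>
    induction z using induction_single with
    | h0 => simp [mul_def]
    | hadd x x' hx hx' => simp only [mul_def, map_add] at hx hx' ⊢; rw [hx, hx']
    | hs l v =>
    simp only [single_mul_single, map_add, AddMonoidHom.add_apply, zpow_add₀ s.ne_zero, add_assoc]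
    congr 1
    ring
  one_mul x := by
    induction x using induction_single with
    | h0 => simp [mul_def]
    | hadd x x' hx hx' => simp only [mul_def, map_add] at hx hx' ⊢; rw [hx, hx']
    | hs g r => simp [one_def, single_mul_single]
  mul_one x := by
    induction x using induction_single with
    | h0 => simp [mul_def]
    | hadd x x' hx hx' => simp only [mul_def, map_add, LinearMap.add_apply] at hx hx' ⊢; rw [hx, hx']
    | hs g r => simp [one_def, single_mul_single]

noncomputable instance : Algebra k (TwistedAlg s ω) :=
  Algebra.ofModule (fun r x y ↦ by simp [mul_def]) (fun r x y ↦ by simp [mul_def])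

instance : Nontrivial (TwistedAlg s ω) := ⟨⟨_, _, single_ne_zero (0 : G)⟩⟩

lemma coeff_mul [DecidableEq G] (x y : TwistedAlg s ω) (u : G) :
    coeff u (x * y) = ∑ g ∈ x.supp, ∑ h ∈ y.supp,
      if g + h = u then (s : k) ^ ω g h * coeff g x * coeff h y else 0 := by
  conv_lhs => rw [← sum_single x, ← sum_single y]
  simp only [Finset.sum_mul, Finset.mul_sum, map_sum, single_mul_single, coeff_single]
  rw [Finset.sum_comm]

lemma exists_of_coeff_mul_ne_zero {x y : TwistedAlg s ω} {u : G} (hu : coeff u (x * y) ≠ 0) :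
    ∃ g h, g + h = u ∧ coeff g x ≠ 0 ∧ coeff h y ≠ 0 := by
  classical
  rw [coeff_mul] at hu
  obtain ⟨g, hg, hu⟩ := Finset.exists_ne_zero_of_sum_ne_zero hu
  obtain ⟨h, hh, hu⟩ := Finset.exists_ne_zero_of_sum_ne_zero hu
  exact ⟨g, h, by simpa using (ite_ne_right_iff.1 hu).1, mem_supp.1 hg, mem_supp.1 hh⟩

/-- The case without cancellation: it covers products with a monomial as well as the largest and the
smallest exponents of a product. -/
lemma coeff_mul_of_unique {x y : TwistedAlg s ω} {g h : G}
    (huniq : ∀ g' h', coeff g' x ≠ 0 → coeff h' y ≠ 0 → g' + h' = g + h → g' = g ∧ h' = h) :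
    coeff (g + h) (x * y) = (s : k) ^ ω g h * coeff g x * coeff h y := by
  classical
  rw [coeff_mul, Finset.sum_eq_single g, Finset.sum_eq_single h, if_pos rfl]
  · intro h' hh' hne
    exact if_neg fun he ↦ hne (add_left_cancel he)
  · intro hh
    simp [not_not.1 (mt mem_supp.2 hh)]
  · intro g' hg' hne
    refine Finset.sum_eq_zero fun h' hh' ↦ if_neg fun he ↦ hne ?_
    exact (huniq g' h' (mem_supp.1 hg') (mem_supp.1 hh') he).1
  · intro hg
    simp [not_not.1 (mt mem_supp.2 hg)]

lemma coeff_single_mul (g h : G) (r : k) (x : TwistedAlg s ω) :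
    coeff (g + h) (single g r * x) = (s : k) ^ ω g h * r * coeff h x := by
  rw [coeff_mul_of_unique, coeff_single_self]
  intro g' h' hg' _ he
  have : g' = g := by
    by_contra hne
    exact hg' (coeff_single_of_ne _ (Ne.symm hne))
  subst this
  exact ⟨rfl, add_left_cancel he⟩

lemma coeff_mul_single (g h : G) (r : k) (x : TwistedAlg s ω) :
    coeff (g + h) (x * single h r) = (s : k) ^ ω g h * coeff g x * r := by
  rw [coeff_mul_of_unique, coeff_single_self]
  intro g' h' _ hh' he
  have : h' = h := by
    by_contra hne
    exact hh' (coeff_single_of_ne _ (Ne.symm hne))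
  subst this
  exact ⟨add_right_cancel he, rfl⟩

/-- The weight of an element that commutes with `e_u` up to a scalar. -/
lemma zpow_eq_of_mul_single_eq {x : TwistedAlg s ω} {u v : G} {c : k}
    (h : x * single u 1 = c • (single u 1 * x)) (hv : coeff v x ≠ 0) :
    (s : k) ^ (ω v u - ω u v) = c := by
  have h1 := congrArg (coeff (v + u)) h
  rw [coeff_mul_single, map_smul, add_comm v u, coeff_single_mul, smul_eq_mul] at h1
  rw [zpow_sub₀ s.ne_zero, div_eq_iff (zpow_ne_zero _ s.ne_zero)]
  apply mul_right_cancel₀ hv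
  linear_combination h1

/-! ### Leading exponents, zero divisors and units -/

section Order

variable [LinearOrder G]

/-- `g` is the largest exponent of `x`. -/
def HasLead (x : TwistedAlg s ω) (g : G) : Prop :=
  coeff g x ≠ 0 ∧ ∀ h, coeff h x ≠ 0 → h ≤ g

lemma HasLead.ne_zero {x : TwistedAlg s ω} {g : G} (h : HasLead x g) : x ≠ 0 := by
  rintro rfl
  simpa using h.1

lemma HasLead.unique {x : TwistedAlg s ω} {g h : G} (hg : HasLead x g) (hh : HasLead x h) :
    g = h :=
  le_antisymm (hh.2 _ hg.1) (hg.2 _ hh.1)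

lemma exists_hasLead {x : TwistedAlg s ω} (hx : x ≠ 0) : ∃ g, HasLead x g := by
  have hne : x.supp.Nonempty := by
    rw [Finset.nonempty_iff_ne_empty]
    intro h
    rw [← sum_single x, h] at hx
    simp at hx
  exact ⟨x.supp.max' hne, mem_supp.1 (x.supp.max'_mem hne),
    fun h hh ↦ x.supp.le_max' h (mem_supp.2 hh)⟩

lemma hasLead_single (g : G) {r : k} (hr : r ≠ 0) : HasLead (single (s := s) (ω := ω) g r) g := by
  refine ⟨by simpa, fun h hh ↦ ?_⟩
  by_contra hlt
  exact hh (coeff_single_of_ne _ fun he ↦ hlt he.ge)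

lemma hasLead_one : HasLead (1 : TwistedAlg s ω) 0 := hasLead_single 0 one_ne_zero

lemma HasLead.of_add_lt {x y : TwistedAlg s ω} {g h : G} (hx : HasLead x g) (hy : HasLead y h)
    (hlt : h < g) : HasLead (x + y) g := by
  have h0 : coeff g y = 0 := by
    by_contra hc
    exact (hy.2 _ hc).not_gt hlt
  refine ⟨by rw [map_add, h0, add_zero]; exact hx.1, fun u hu ↦ ?_⟩
  by_cases hux : coeff u x = 0
  · rw [map_add, hux, zero_add] at hu
    exact (hy.2 _ hu).trans hlt.le
  · exact hx.2 _ hux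

/-- A nontrivial combination of elements with distinct leading exponents has one of them as its
leading exponent. -/
lemma exists_hasLead_linearCombination {ι : Type*} {v : ι → TwistedAlg s ω} {d : ι → G}
    (hd : Function.Injective d) (hv : ∀ i, HasLead (v i) (d i)) {c : ι →₀ k} (hc : c ≠ 0) :
    ∃ i, HasLead (Finsupp.linearCombination k v c) (d i) := by
  obtain ⟨i, hi, hmax⟩ := Finset.exists_max_image c.support d (Finsupp.support_nonempty_iff.2 hc)
  refine ⟨i, ?_, fun h hh ↦ ?_⟩
  · rw [Finsupp.linearCombination_apply, Finsupp.sum, map_sum, Finset.sum_eq_single i]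
    · rw [map_smul, smul_eq_mul]
      exact mul_ne_zero (Finsupp.mem_support_iff.1 hi) (hv i).1
    · intro j hj hji
      rw [map_smul, smul_eq_mul]
      by_contra hne
      have := (hv j).2 _ (right_ne_zero_of_mul hne)
      exact hji (hd (le_antisymm (hmax j hj) this))
    · exact fun h ↦ (h hi).elim
  · rw [Finsupp.linearCombination_apply, Finsupp.sum, map_sum] at hh
    obtain ⟨j, hj, hne⟩ := Finset.exists_ne_zero_of_sum_ne_zero hh
    rw [map_smul, smul_eq_mul] at hne
    exact ((hv j).2 _ (right_ne_zero_of_mul hne)).trans (hmax j hj)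

variable [IsOrderedAddMonoid G]

lemma eq_and_eq_of_add_eq_add_of_le {g g' h h' : G} (hg : g' ≤ g) (hh : h' ≤ h)
    (he : g' + h' = g + h) : g' = g ∧ h' = h := by
  have : g' = g := by
    refine le_antisymm hg (not_lt.1 fun hlt ↦ ?_)
    exact (add_lt_add_of_lt_of_le hlt hh).ne he
  subst this
  exact ⟨rfl, add_left_cancel he⟩

lemma HasLead.coeff_mul {x y : TwistedAlg s ω} {g h : G} (hx : HasLead x g) (hy : HasLead y h) :
    coeff (g + h) (x * y) = (s : k) ^ ω g h * coeff g x * coeff h y :=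
  coeff_mul_of_unique fun _ _ hg' hh' he ↦
    eq_and_eq_of_add_eq_add_of_le (hx.2 _ hg') (hy.2 _ hh') he

/-- In an ordered group the sum of the two largest exponents arises from one pair only, so the
leading term cannot cancel. -/
lemma HasLead.mul {x y : TwistedAlg s ω} {g h : G} (hx : HasLead x g) (hy : HasLead y h) :
    HasLead (x * y) (g + h) := by
  refine ⟨?_, fun u hu ↦ ?_⟩
  · rw [hx.coeff_mul hy]
    exact mul_ne_zero (mul_ne_zero (zpow_ne_zero _ s.ne_zero) hx.1) hy.1
  · obtain ⟨g', h', rfl, hg', hh'⟩ := exists_of_coeff_mul_ne_zero hu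
    exact add_le_add (hx.2 _ hg') (hy.2 _ hh')

lemma HasLead.pow {x : TwistedAlg s ω} {g : G} (hx : HasLead x g) (n : ℕ) :
    HasLead (x ^ n) (n • g) := by
  induction n with
  | zero => simpa using hasLead_one
  | succ n ih => rw [pow_succ, succ_nsmul]; exact ih.mul hx

instance : NoZeroDivisors (TwistedAlg s ω) where
  eq_zero_or_eq_zero_of_mul_eq_zero {x y} hxy := by
    by_contra! h
    obtain ⟨g, hg⟩ := exists_hasLead h.1
    obtain ⟨l, hl⟩ := exists_hasLead h.2
    exact (hg.mul hl).ne_zero hxy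

/-- Units of the twisted group algebra are monomials. -/
lemma exists_eq_single_of_mul_eq_one {x y : TwistedAlg s ω} (hxy : x * y = 1) :
    ∃ g r, x = single g r := by
  have hx : x ≠ 0 := left_ne_zero_of_mul (hxy ▸ one_ne_zero)
  have hy : y ≠ 0 := right_ne_zero_of_mul (hxy ▸ one_ne_zero)
  obtain ⟨g, hg⟩ := exists_hasLead hx
  obtain ⟨h, hh⟩ := exists_hasLead hy
  have hnx : x.supp.Nonempty := ⟨g, mem_supp.2 hg.1⟩
  have hny : y.supp.Nonempty := ⟨h, mem_supp.2 hh.1⟩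
  have hgh : g + h = 0 := (hg.mul hh).unique (hxy ▸ hasLead_one)
  -- The smallest exponents also survive in the product. As 1 has a single exponent, both extreme
  -- sums agree, so the largest and smallest exponents of `x` coincide.
  set g' := x.supp.min' hnx
  set h' := y.supp.min' hny
  have hg' : coeff g' x ≠ 0 := mem_supp.1 (x.supp.min'_mem hnx)
  have hh' : coeff h' y ≠ 0 := mem_supp.1 (y.supp.min'_mem hny)
  have hc : coeff (g' + h') (x * y) ≠ 0 := by
    rw [coeff_mul_of_unique]
    · exact mul_ne_zero (mul_ne_zero (zpow_ne_zero _ s.ne_zero) hg') hh'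
    · intro g₁ h₁ hg₁ hh₁ he
      obtain ⟨h1, h2⟩ := eq_and_eq_of_add_eq_add_of_le (x.supp.min'_le g₁ (mem_supp.2 hg₁))
        (y.supp.min'_le h₁ (mem_supp.2 hh₁)) he.symm
      exact ⟨h1.symm, h2.symm⟩
  have hgh' : g' + h' = g + h := by
    rw [hxy] at hc
    rw [hgh]
    by_contra hne
    exact hc (coeff_single_of_ne _ (Ne.symm hne))
  have hgg : g' = g := (eq_and_eq_of_add_eq_add_of_le (hg.2 _ hg') (hh.2 _ hh') hgh').1
  refine ⟨g, coeff g x, eq_single fun u hu ↦ le_antisymm (hg.2 _ hu) ?_⟩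
  rw [← hgg]
  exact x.supp.min'_le u (mem_supp.2 hu)

end Order

end TwistedAlg

/-! ### The adapted presentation and homomorphisms out of `D_q` -/

namespace HeisenbergDouble

/-- The unit `s` is not a root of unity. -/
class Generic {k : Type*} [Field k] (s : kˣ) : Prop where
  eq_zero_of_zpow_eq_one : ∀ n : ℤ, (s : k) ^ n = 1 → n = 0

lemma Generic.zpow_inj {k : Type*} [Field k] (s : kˣ) [Generic s] {m n : ℤ}
    (h : (s : k) ^ m = (s : k) ^ n) : m = n := by
  have := eq_zero_of_zpow_eq_one (s := s) (m - n) (by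
    rw [zpow_sub₀ s.ne_zero, h, div_self (zpow_ne_zero _ s.ne_zero)])
  omega

section Datum

variable {k : Type*} [Field k] (s : kˣ) (B : Type*) [Ring B] [Algebra k B]

/-- Elements of `B` satisfying the relations of `D_q`, `q = s²`, after the change of generators
that splits off a quantum torus, spanned by the elements `w r t ~ K ^ r a ^ t`. -/
structure Datum where
  w : ℤ → ℤ → B
  b : B
  f : B
  c : B
  e : B
  w_zero : w 0 0 = 1
  w_mul : ∀ r t r' t', w r t * w r' t' = (s : k) ^ (t * r' - r * t') • w (r + r') (t + t')
  b_w : ∀ r t, b * w r t = w r t * b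
  f_w : ∀ r t, f * w r t = w r t * f
  c_w : ∀ r t, c * w r t = w r t * c
  e_w : ∀ r t, e * w r t = w r t * e
  f_b : f * b = (s : k) ^ (-4 : ℤ) • (b * f) + (1 - (s : k) ^ (-4 : ℤ)) • 1
  e_c : e * c = (s : k) ^ (4 : ℤ) • (c * e) + (1 - (s : k) ^ (4 : ℤ)) • 1
  b_c : b * c = (s : k) ^ (4 : ℤ) • (c * b)
  f_c : f * c = (s : k) ^ (-4 : ℤ) • (c * f)
  b_e : b * e = (s : k) ^ (-4 : ℤ) • (e * b)
  f_e : f * e = (s : k) ^ (4 : ℤ) • (e * f)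

namespace Datum

variable {s B} (d : Datum s B)

/-- The scalar with `F = κ w(-1, 2) f`. -/
def kF (s : kˣ) : k := ((s : k) - (s : k) ^ (-3 : ℤ))⁻¹

/-- The scalar with `E = κ w(0, -2) e`. -/
def kE (s : kˣ) : k := ((s : k) ^ (-1 : ℤ) - (s : k) ^ (3 : ℤ))⁻¹

/-- The images of the generators. -/
def genImage : Gen → B
  | .a => d.w 0 1
  | .aInv => d.w 0 (-1)
  | .b => d.w 1 (-1) * d.b
  | .c => d.w 1 1 * d.c
  | .K => d.w 1 0
  | .KInv => d.w (-1) 0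
  | .E => kE s • (d.w 0 (-2) * d.e)
  | .F => kF s • (d.w (-1) 2 * d.f)

/-- This and the next two lemmas collect torus elements on the left, so that products of generator
images reach a common normal form. -/
lemma mul_mul_w (r t r' t' : ℤ) {x : B} (hx : ∀ r t, x * d.w r t = d.w r t * x) (y : B) :
    (d.w r t * x) * (d.w r' t' * y) =
      (s : k) ^ (t * r' - r * t') • (d.w (r + r') (t + t') * (x * y)) := by
  rw [mul_assoc, ← mul_assoc x, hx, mul_assoc, ← mul_assoc, d.w_mul, smul_mul_assoc]

lemma w_mul_mul (r t r' t' : ℤ) (y : B) :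
    d.w r t * (d.w r' t' * y) =
      (s : k) ^ (t * r' - r * t') • (d.w (r + r') (t + t') * y) := by
  rw [← mul_assoc, d.w_mul, smul_mul_assoc]

lemma mul_w_mul (r t r' t' : ℤ) {x : B} (hx : ∀ r t, x * d.w r t = d.w r t * x) :
    (d.w r t * x) * d.w r' t' =
      (s : k) ^ (t * r' - r * t') • (d.w (r + r') (t + t') * x) := by
  rw [mul_assoc, hx, ← mul_assoc, d.w_mul, smul_mul_assoc]

lemma hF (s : kˣ) [Generic s] : (s : k) - (s : k) ^ (-3 : ℤ) ≠ 0 := by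
  intro h
  have : (s : k) ^ (1 : ℤ) = (s : k) ^ (-3 : ℤ) := by rw [zpow_one]; exact sub_eq_zero.1 h
  exact absurd (Generic.zpow_inj s this) (by norm_num)

lemma hE (s : kˣ) [Generic s] : (s : k) ^ (-1 : ℤ) - (s : k) ^ (3 : ℤ) ≠ 0 := by
  intro h
  exact absurd (Generic.zpow_inj s (sub_eq_zero.1 h)) (by norm_num)

/-- In normal form a homogeneous relation is an equality of powers of `s`. Only `E_c` and `F_b` have
an inhomogeneous term; `kE` and `kF` are the scalars that give it coefficient 1. -/
lemma rel_genImage [Generic s] {x y : FreeAlgebra k Gen}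
    (h : Rel k (s ^ 2) x y) :
    FreeAlgebra.lift k d.genImage x = FreeAlgebra.lift k d.genImage y := by
  have hs := s.ne_zero
  have hkF : kF s * ((s : k) - (s : k) ^ (-3 : ℤ)) = 1 := inv_mul_cancel₀ (hF s)
  have hkE : kE s * ((s : k) ^ (-1 : ℤ) - (s : k) ^ (3 : ℤ)) = 1 := inv_mul_cancel₀ (hE s)
  norm_num at hkF hkE
  field_simp at hkF hkE
  induction h <;>
  simp only [gen, map_mul, map_smul, map_add, map_one, FreeAlgebra.lift_ι_apply, genImage,
    smul_mul_assoc, mul_smul_comm, smul_smul, d.mul_mul_w _ _ _ _ d.b_w,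
    d.mul_mul_w _ _ _ _ d.c_w, d.mul_mul_w _ _ _ _ d.e_w, d.mul_mul_w _ _ _ _ d.f_w,
    d.w_mul_mul, d.mul_w_mul _ _ _ _ d.b_w, d.mul_w_mul _ _ _ _ d.c_w,
    d.mul_w_mul _ _ _ _ d.e_w, d.mul_w_mul _ _ _ _ d.f_w, d.w_mul, d.f_b, d.e_c, d.b_c, d.f_c,
    d.b_e, d.f_e, mul_add, mul_one, smul_add] <;> norm_num [d.w_zero]
  case E_c =>
    match_scalars
    · field_simp
    · field_simp
      linear_combination hkE
  case F_b =>
    match_scalars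
    · field_simp
    · field_simp
      linear_combination hkF
  all_goals
    congr 1
    field_simp

/-- The homomorphism from `D_q` given by a datum. -/
noncomputable def lift [Generic s] : D k (s ^ 2) →ₐ[k] B :=
  RingQuot.liftAlgHom k ⟨FreeAlgebra.lift k d.genImage, fun _ _ h ↦ d.rel_genImage h⟩

lemma lift_x [Generic s] (g : Gen) :
    d.lift (x k (s ^ 2) g) = d.genImage g := by
  simp [lift, x, gen]

end Datum
end Datum

section

variable {k : Type*} [Field k] {B : Type*} [Ring B] [Algebra k B]

lemma mul_zpow_eq_smul (c : kˣ) (u : Bˣ) (y : B) (h : y * u = (c : k) • (u * y)) (n : ℤ) :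
    y * (u ^ n : Bˣ) = ((c : k) ^ n) • ((u ^ n : Bˣ) * y) := by
  -- With the scalar as a unit `C`, the hypothesis says that `y` semiconjugates `u` to `C * u`,
  -- which covers negative powers as well.
  set C : Bˣ := Units.map (algebraMap k B : k →* B) c with hC
  have hcomm : Commute C u := Units.ext (by simpa [hC] using Algebra.commutes (c : k) (u : B))
  have h1 : SemiconjBy y (u : B) ((C * u : Bˣ) : B) := by
    rw [SemiconjBy, h, Units.val_mul, hC, Units.coe_map, mul_assoc]
    simp [Algebra.smul_def]
  have h2 := h1.units_zpow_right n
  rw [SemiconjBy, hcomm.mul_zpow, Units.val_mul, hC, ← map_zpow, Units.coe_map, mul_assoc] at h2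
  rw [h2]
  simp [Algebra.smul_def]

end

/-! ### The adapted generators inside `D_q` -/

section Torus

variable {k : Type*} [Field k] (s : kˣ)

local notation "𝔻" => D k (s ^ 2)
local notation "X" => x k (s ^ 2)

lemma x_rel {y z : FreeAlgebra k Gen} (h : Rel k (s ^ 2) y z) :
    RingQuot.mkAlgHom k (Rel k (s ^ 2)) y = RingQuot.mkAlgHom k (Rel k (s ^ 2)) z :=
  RingQuot.mkAlgHom_rel k h

lemma KA_mul (r t r' t' : ℤ) : KA k (s ^ 2) r t * KA k (s ^ 2) r' t' =
    (s : k) ^ (2 * t * r') • KA k (s ^ 2) (r + r') (t + t') := by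
  have h0 : (X .a) * (KUnit k (s ^ 2) : 𝔻) = ((s ^ 2 : kˣ) : k) • ((KUnit k (s ^ 2) : 𝔻) * X .a) := by
    have := x_rel s (Rel.K_a (k := k) (q := s ^ 2))
    simp only [map_mul, map_smul] at this
    change X .a * X .K = _ • (X .K * X .a)
    simp only [x, gen] at this ⊢
    rw [this, smul_smul, mul_inv_cancel₀ (Units.ne_zero _), one_smul]
  have h1 := mul_zpow_eq_smul (s ^ 2) (KUnit k (s ^ 2)) (X .a) h0 r'
  have h2 : ((KUnit k (s ^ 2) ^ r' : (𝔻)ˣ) : 𝔻) * (aUnit k (s ^ 2) : 𝔻) =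
      (((s ^ 2) ^ (-r') : kˣ) : k) • ((aUnit k (s ^ 2) : 𝔻) * ((KUnit k (s ^ 2) ^ r' : (𝔻)ˣ) : 𝔻)) := by
    change _ * X .a = _ • (X .a * _)
    rw [h1, smul_smul, ← Units.val_zpow_eq_zpow_val, ← Units.val_mul, ← zpow_add, neg_add_cancel]
    simp
  have h3 := mul_zpow_eq_smul ((s ^ 2) ^ (-r')) (aUnit k (s ^ 2)) _ h2 t
  have h4 : ((aUnit k (s ^ 2) ^ t : (𝔻)ˣ) : 𝔻) * ((KUnit k (s ^ 2) ^ r' : (𝔻)ˣ) : 𝔻) =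
      (s : k) ^ (2 * t * r') •
        (((KUnit k (s ^ 2) ^ r' : (𝔻)ˣ) : 𝔻) * ((aUnit k (s ^ 2) ^ t : (𝔻)ˣ) : 𝔻)) := by
    have hc : (s : k) ^ (2 * t * r') * (((s ^ 2) ^ (-r') : kˣ) : k) ^ t = 1 := by
      rw [Units.val_zpow_eq_zpow_val, Units.val_pow_eq_pow_val, ← zpow_natCast, ← zpow_mul,
        ← zpow_mul, ← zpow_add₀ s.ne_zero]
      have : 2 * t * r' + ((2 : ℕ) : ℤ) * (-r' * t) = 0 := by push_cast; ring
      rw [this, zpow_zero]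
    rw [h3, smul_smul, hc, one_smul]
  simp only [KA, Units.val_mul, zpow_add]
  rw [mul_assoc, ← mul_assoc _ _ ((aUnit k (s ^ 2) ^ t' : (𝔻)ˣ) : 𝔻), h4]
  simp only [smul_mul_assoc, mul_smul_comm, mul_assoc]

/-- The symmetrized monomial `s ^ (r t) K ^ r a ^ t`. -/
noncomputable def W (r t : ℤ) : 𝔻 := (s : k) ^ (r * t) • KA k (s ^ 2) r t

/-- The factor `s ^ (r t)` in `W` makes the cocycle antisymmetric, hence invariant under `SL₂(ℤ)`.
-/
lemma W_mul (r t r' t' : ℤ) : W s r t * W s r' t' =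
    (s : k) ^ (t * r' - r * t') • W s (r + r') (t + t') := by
  simp only [W, smul_mul_assoc, mul_smul_comm, KA_mul, smul_smul, ← zpow_add₀ s.ne_zero]
  congr 2
  ring

lemma W_zero : W s 0 0 = 1 := by simp [W, KA]
lemma x_a : X .a = W s 0 1 := by simp [W, KA, aUnit]
lemma x_aInv : X .aInv = W s 0 (-1) := by simp [W, KA, aUnit]
lemma x_K : X .K = W s 1 0 := by simp [W, KA, KUnit]
lemma x_KInv : X .KInv = W s (-1) 0 := by simp [W, KA, KUnit]

lemma mul_W_of (y : 𝔻) (m n : ℤ) (hK : y * X .K = (s : k) ^ m • (X .K * y))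
    (ha : y * X .a = (s : k) ^ n • (X .a * y)) (r t : ℤ) :
    y * W s r t = (s : k) ^ (m * r + n * t) • (W s r t * y) := by
  have hK' := mul_zpow_eq_smul (s ^ m) (KUnit k (s ^ 2)) y
    (by rw [Units.val_zpow_eq_zpow_val]; exact hK) r
  have ha' := mul_zpow_eq_smul (s ^ n) (aUnit k (s ^ 2)) y
    (by rw [Units.val_zpow_eq_zpow_val]; exact ha) t
  simp only [W, KA, Units.val_mul, mul_smul_comm, smul_mul_assoc]
  rw [← mul_assoc, hK', smul_mul_assoc, mul_assoc, ha', zpow_add₀ s.ne_zero]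
  simp only [mul_smul_comm, smul_smul, mul_assoc, Units.val_zpow_eq_zpow_val, zpow_mul]
  congr 1
  ring

lemma x_a_b : X .a * X .b = (s : k) ^ (2 : ℤ) • (X .b * X .a) := by
  have h := x_rel s (Rel.a_b (k := k) (q := s ^ 2))
  simpa [x, gen, ← pow_mul] using h

lemma x_a_c : X .a * X .c = (s : k) ^ (2 : ℤ) • (X .c * X .a) := by
  have h := x_rel s (Rel.a_c (k := k) (q := s ^ 2))
  simpa [x, gen, ← pow_mul] using h

lemma x_b_c : X .b * X .c = X .c * X .b := by
  have h := x_rel s (Rel.b_c (k := k) (q := s ^ 2))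
  simpa [x, gen, ← pow_mul] using h

lemma x_K_E : X .K * X .E = (s : k) ^ (4 : ℤ) • (X .E * X .K) := by
  have h := x_rel s (Rel.K_E (k := k) (q := s ^ 2))
  simpa [x, gen, ← pow_mul] using h

lemma x_K_F : X .K * X .F = (s : k) ^ (-4 : ℤ) • (X .F * X .K) := by
  have h := x_rel s (Rel.K_F (k := k) (q := s ^ 2))
  simpa [x, gen, ← pow_mul] using h

lemma x_E_F : X .E * X .F = X .F * X .E := by
  have h := x_rel s (Rel.E_F (k := k) (q := s ^ 2))
  simpa [x, gen, ← pow_mul] using h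

lemma x_K_b : X .K * X .b = (s : k) ^ (2 : ℤ) • (X .b * X .K) := by
  have h := x_rel s (Rel.K_b (k := k) (q := s ^ 2))
  simpa [x, gen, ← pow_mul] using h

lemma x_K_c : X .K * X .c = (s : k) ^ (-2 : ℤ) • (X .c * X .K) := by
  have h := x_rel s (Rel.K_c (k := k) (q := s ^ 2))
  simpa [x, gen, ← pow_mul] using h

lemma x_E_a : X .E * X .a = X .a * X .E := by
  have h := x_rel s (Rel.E_a (k := k) (q := s ^ 2))
  simpa [x, gen, ← pow_mul] using h

lemma x_E_b : X .E * X .b = X .b * X .E := by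
  have h := x_rel s (Rel.E_b (k := k) (q := s ^ 2))
  simpa [x, gen, ← pow_mul] using h

lemma x_E_c : X .E * X .c = X .c * X .E + X .aInv * X .K := by
  have h := x_rel s (Rel.E_c (k := k) (q := s ^ 2))
  simpa [x, gen, ← pow_mul] using h

lemma x_F_a : X .F * X .a = (s : k) ^ (2 : ℤ) • (X .a * X .F) := by
  have h := x_rel s (Rel.F_a (k := k) (q := s ^ 2))
  simpa [x, gen, ← pow_mul] using h

lemma x_F_b : X .F * X .b = (s : k) ^ (-2 : ℤ) • (X .b * X .F) + X .a := by
  have h := x_rel s (Rel.F_b (k := k) (q := s ^ 2))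
  simpa [x, gen, ← pow_mul] using h

lemma x_F_c : X .F * X .c = (s : k) ^ (2 : ℤ) • (X .c * X .F) := by
  have h := x_rel s (Rel.F_c (k := k) (q := s ^ 2))
  simpa [x, gen, ← pow_mul] using h

lemma eq_smul_of_eq_smul {y z : 𝔻} {m n : ℤ} (hmn : m + n = 0) (h : z * y = (s : k) ^ m • (y * z)) :
    y * z = (s : k) ^ n • (z * y) := by
  rw [h, smul_smul, ← zpow_add₀ s.ne_zero, add_comm, hmn, zpow_zero, one_smul]

lemma x_b_mul_W (r t : ℤ) : X .b * W s r t = (s : k) ^ (-2 * r + -2 * t) • (W s r t * X .b) :=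
  mul_W_of s _ _ _ (eq_smul_of_eq_smul s rfl (x_K_b s)) (eq_smul_of_eq_smul s rfl (x_a_b s)) r t

lemma x_c_mul_W (r t : ℤ) : X .c * W s r t = (s : k) ^ (2 * r + -2 * t) • (W s r t * X .c) :=
  mul_W_of s _ _ _ (eq_smul_of_eq_smul s rfl (x_K_c s)) (eq_smul_of_eq_smul s rfl (x_a_c s)) r t

lemma x_F_mul_W (r t : ℤ) : X .F * W s r t = (s : k) ^ (4 * r + 2 * t) • (W s r t * X .F) :=
  mul_W_of s _ _ _ (eq_smul_of_eq_smul s rfl (x_K_F s)) (x_F_a s) r t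

lemma x_E_mul_W (r t : ℤ) : X .E * W s r t = (s : k) ^ (-4 * r + 0 * t) • (W s r t * X .E) :=
  mul_W_of s _ _ _ (eq_smul_of_eq_smul s rfl (x_K_E s)) (by simpa using x_E_a s) r t

/-- The generator `b` corrected by a torus element. -/
noncomputable def bD : 𝔻 := W s (-1) 1 * X .b
/-- The generator `c` corrected by a torus element. -/
noncomputable def cD : 𝔻 := W s (-1) (-1) * X .c
/-- The generator `F` corrected by a torus element and a scalar. -/
noncomputable def fD : 𝔻 := (Datum.kF s)⁻¹ • (W s 1 (-2) * X .F)
/-- The generator `E` corrected by a torus element and a scalar. -/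
noncomputable def eD : 𝔻 := (Datum.kE s)⁻¹ • (W s 0 2 * X .E)

/-- The two torus elements commute up to `s ^ (2 (r i - p j))`, and `hm`, `hn` say that this cancels
the scalar from `y`. These equations determine the prefactors in `bD`, `cD`, `fD`, `eD`. -/
lemma W_mul_comm_W {y : 𝔻} {m n p r : ℤ}
    (hy : ∀ i j, y * W s i j = (s : k) ^ (m * i + n * j) • (W s i j * y)) (hm : m = -2 * r)
    (hn : n = 2 * p) (i j : ℤ) : W s p r * y * W s i j = W s i j * (W s p r * y) := by
  rw [mul_assoc, hy, mul_smul_comm, ← mul_assoc, ← mul_assoc, W_mul, W_mul, smul_mul_assoc,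
    smul_mul_assoc, smul_smul, ← zpow_add₀ s.ne_zero, add_comm p, add_comm r]
  congr 2
  subst hm hn
  ring

lemma W_mul_mul_W_mul {y : 𝔻} {m n p r : ℤ}
    (hy : ∀ i j, y * W s i j = (s : k) ^ (m * i + n * j) • (W s i j * y)) (i j : ℤ) (z : 𝔻) :
    W s p r * y * (W s i j * z) =
      (s : k) ^ (m * i + n * j + (r * i - p * j)) • (W s (p + i) (r + j) * (y * z)) := by
  rw [mul_assoc, ← mul_assoc y, hy, smul_mul_assoc, mul_smul_comm, ← mul_assoc, ← mul_assoc, W_mul,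
    smul_mul_assoc, smul_mul_assoc, smul_smul, ← zpow_add₀ s.ne_zero, mul_assoc]

/-- The generators of `D_q` adapted to the torus. -/
noncomputable def datumD : Datum s 𝔻 where
  w := W s
  b := bD s
  f := fD s
  c := cD s
  e := eD s
  w_zero := W_zero s
  w_mul := W_mul s
  b_w := W_mul_comm_W s (x_b_mul_W s) (by norm_num) (by norm_num)
  c_w := W_mul_comm_W s (x_c_mul_W s) (by norm_num) (by norm_num)
  f_w i j := by
    rw [fD, smul_mul_assoc, mul_smul_comm,
      W_mul_comm_W s (x_F_mul_W s) (by norm_num) (by norm_num)]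
  e_w i j := by
    rw [eD, smul_mul_assoc, mul_smul_comm,
      W_mul_comm_W s (x_E_mul_W s) (by norm_num) (by norm_num)]
  f_b := by
    simp only [fD, bD, smul_mul_assoc, mul_smul_comm, W_mul_mul_W_mul s (x_F_mul_W s),
      W_mul_mul_W_mul s (x_b_mul_W s), x_F_b, mul_add, x_a, W_mul]
    norm_num [W_zero, Datum.kF]
    have hs := s.ne_zero
    match_scalars
    · field_simp
    · field_simp
  e_c := by
    simp only [eD, cD, smul_mul_assoc, mul_smul_comm, W_mul_mul_W_mul s (x_E_mul_W s),
      W_mul_mul_W_mul s (x_c_mul_W s), x_E_c, mul_add, x_aInv, x_K, W_mul]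
    norm_num [W_zero, Datum.kE]
    have hs := s.ne_zero
    match_scalars
    · field_simp
    · field_simp
  b_c := by
    simp only [bD, cD, W_mul_mul_W_mul s (x_b_mul_W s),
      W_mul_mul_W_mul s (x_c_mul_W s), x_b_c, smul_smul, ← zpow_add₀ s.ne_zero]
    norm_num
  f_c := by
    simp only [fD, cD, smul_mul_assoc, mul_smul_comm, W_mul_mul_W_mul s (x_F_mul_W s),
      W_mul_mul_W_mul s (x_c_mul_W s), x_F_c, smul_smul, ← zpow_add₀ s.ne_zero]
    rw [mul_left_comm, ← zpow_add₀ s.ne_zero]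
    norm_num
  b_e := by
    simp only [bD, eD, smul_mul_assoc, mul_smul_comm, W_mul_mul_W_mul s (x_b_mul_W s),
      W_mul_mul_W_mul s (x_E_mul_W s), x_E_b, smul_smul]
    rw [mul_left_comm, ← zpow_add₀ s.ne_zero]
    norm_num
  f_e := by
    simp only [fD, eD, smul_mul_assoc, mul_smul_comm, W_mul_mul_W_mul s (x_F_mul_W s),
      W_mul_mul_W_mul s (x_E_mul_W s), x_E_F, smul_smul]
    rw [mul_left_comm, mul_left_comm ((s : k) ^ (4 : ℤ)), mul_left_comm ((s : k) ^ (4 : ℤ)),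
      ← zpow_add₀ s.ne_zero]
    norm_num

end Torus

/-! ### The normal elements `φ` and `ψ` and their commutation rules -/

namespace Datum

variable {k : Type*} [Field k] {s : kˣ} {B : Type*} [Ring B] [Algebra k B] (d : Datum s B)

lemma w_mul_w_neg (r t : ℤ) : d.w r t * d.w (-r) (-t) = 1 := by
  rw [d.w_mul]
  simp [d.w_zero, mul_comm]

/-- The torus elements as units. -/
def wUnit (r t : ℤ) : Bˣ where
  val := d.w r t
  inv := d.w (-r) (-t)
  val_inv := d.w_mul_w_neg r t
  inv_val := by simpa using d.w_mul_w_neg (-r) (-t)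

lemma coe_wUnit (r t : ℤ) : (d.wUnit r t : B) = d.w r t := rfl

lemma wUnit_zpow (r t n : ℤ) : ((d.wUnit r t ^ n : Bˣ) : B) = d.w (n * r) (n * t) := by
  have h : ∀ m : ℕ, ((d.wUnit r t ^ m : Bˣ) : B) = d.w (m * r) (m * t) := fun m ↦ by
    induction m with
    | zero => simp [d.w_zero]
    | succ m ih =>
      rw [pow_succ, Units.val_mul, ih, coe_wUnit, d.w_mul, mul_right_comm,
        sub_self, zpow_zero, one_smul]
      push_cast
      rw [add_mul, add_mul, one_mul, one_mul]
  obtain ⟨m, rfl | rfl⟩ := n.eq_nat_or_neg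
  · simpa using h m
  · rw [zpow_neg, zpow_natCast, Units.inv_eq_of_mul_eq_one_right (a := d.w (-m * r) (-m * t))]
    rw [h, neg_mul, neg_mul, w_mul_w_neg]

/-- The normal element `1 - b f`. -/
def phi : B := 1 - d.b * d.f

/-- The normal element `1 - c e`. -/
def psi : B := 1 - d.c * d.e

lemma bf : d.b * d.f = 1 - d.phi := by simp [phi]
lemma ce : d.c * d.e = 1 - d.psi := by simp [psi]

/-- The factor `s ^ (-4)`, absent from `bf`, is the reason why `φ` is rescaled when it moves past
`b` or `f`. -/
lemma fb : d.f * d.b = 1 - (s : k) ^ (-4 : ℤ) • d.phi := by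
  rw [d.f_b, bf]
  module

lemma ec : d.e * d.c = 1 - (s : k) ^ (4 : ℤ) • d.psi := by
  rw [d.e_c, ce]
  module

lemma phi_w (r t : ℤ) : d.phi * d.w r t = d.w r t * d.phi := by
  rw [phi, sub_mul, mul_sub, one_mul, mul_one, mul_assoc, d.f_w, ← mul_assoc, d.b_w, mul_assoc]

lemma psi_w (r t : ℤ) : d.psi * d.w r t = d.w r t * d.psi := by
  rw [psi, sub_mul, mul_sub, one_mul, mul_one, mul_assoc, d.e_w, ← mul_assoc, d.c_w, mul_assoc]

/-- Compare both bracketings of `b f b`, using `bf` and `fb`. The next three rules arise in the same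
way. -/
lemma b_phi : d.b * d.phi = (s : k) ^ (4 : ℤ) • (d.phi * d.b) := by
  have h1 : d.phi * d.b = d.b - d.b * (d.f * d.b) := by simp [phi, sub_mul, mul_assoc]
  have hs := s.ne_zero
  rw [h1, fb]
  simp only [mul_sub, mul_one, mul_smul_comm, sub_sub_cancel, smul_smul, ← zpow_add₀ hs]
  simp

lemma f_phi : d.f * d.phi = (s : k) ^ (-4 : ℤ) • (d.phi * d.f) := by
  have h1 : d.f * d.phi = d.f - (d.f * d.b) * d.f := by simp [phi, mul_sub, mul_assoc]
  rw [h1, fb]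
  simp [sub_mul]

lemma c_psi : d.c * d.psi = (s : k) ^ (-4 : ℤ) • (d.psi * d.c) := by
  have h1 : d.psi * d.c = d.c - d.c * (d.e * d.c) := by simp [psi, sub_mul, mul_assoc]
  have hs := s.ne_zero
  rw [h1, ec]
  simp only [mul_sub, mul_one, mul_smul_comm, sub_sub_cancel, smul_smul, ← zpow_add₀ hs]
  simp

lemma e_psi : d.e * d.psi = (s : k) ^ (4 : ℤ) • (d.psi * d.e) := by
  have h1 : d.e * d.psi = d.e - (d.e * d.c) * d.e := by simp [psi, mul_sub, mul_assoc]
  rw [h1, ec]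
  simp [sub_mul]

/-- The scalars from moving `c` past `b` and past `f` are inverse, so `c` commutes with `b f`. The
same cancellation gives the next three rules. -/
lemma c_phi : d.c * d.phi = d.phi * d.c := by
  have hs := s.ne_zero
  simp only [phi, mul_sub, sub_mul, mul_one, one_mul, mul_assoc, d.f_c, mul_smul_comm]
  rw [← mul_assoc d.b, d.b_c, smul_mul_assoc, smul_smul, ← zpow_add₀ hs]
  simp [mul_assoc]

lemma e_phi : d.e * d.phi = d.phi * d.e := by
  have hs := s.ne_zero
  simp only [phi, mul_sub, sub_mul, mul_one, one_mul, mul_assoc, d.f_e, mul_smul_comm]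
  rw [← mul_assoc d.b, d.b_e, smul_mul_assoc, smul_smul, ← zpow_add₀ hs]
  simp [mul_assoc]

lemma b_psi : d.b * d.psi = d.psi * d.b := by
  have hs := s.ne_zero
  simp only [psi, mul_sub, sub_mul, mul_one, one_mul]
  rw [← mul_assoc, d.b_c, smul_mul_assoc, mul_assoc, d.b_e, mul_smul_comm, smul_smul,
    ← zpow_add₀ hs]
  simp [mul_assoc]

lemma f_psi : d.f * d.psi = d.psi * d.f := by
  have hs := s.ne_zero
  simp only [psi, mul_sub, sub_mul, mul_one, one_mul]
  rw [← mul_assoc, d.f_c, smul_mul_assoc, mul_assoc, d.f_e, mul_smul_comm, smul_smul,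
    ← zpow_add₀ hs]
  simp [mul_assoc]

/-- The relation for moving `y` past a power of `x`, for `y x = z x y + (1 - z)`. -/
lemma mul_pow_succ_of_mul_eq {x y : B} {z : k} (h : y * x = z • (x * y) + (1 - z) • 1) (n : ℕ) :
    y * x ^ (n + 1) = z ^ (n + 1) • (x ^ (n + 1) * y) + (1 - z ^ (n + 1)) • x ^ n := by
  induction n with
  | zero => simpa using h
  | succ n ih =>
    rw [pow_succ, ← mul_assoc, ih, add_mul, smul_mul_assoc, smul_mul_assoc, mul_assoc, h]
    simp only [mul_add, mul_smul_comm, smul_add, smul_smul, mul_one, ← mul_assoc, ← pow_succ]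
    match_scalars <;> ring

lemma mul_pow_of_mul_eq {x y : B} {z : k} (h : y * x = z • (x * y)) (n : ℕ) :
    y * x ^ n = z ^ n • (x ^ n * y) := by
  induction n with
  | zero => simp
  | succ n ih =>
    rw [pow_succ, ← mul_assoc, ih, smul_mul_assoc, mul_assoc, h]
    simp only [mul_smul_comm, smul_smul, ← mul_assoc, ← pow_succ]

end Datum

/-! ### Passing between the two sets of generators -/

section Generators

variable {k : Type*} [Field k] (s : kˣ)

local notation "𝔻" => D k (s ^ 2)
local notation "X" => x k (s ^ 2)

lemma x_b : X .b = W s 1 (-1) * bD s := by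
  rw [bD, ← mul_assoc, W_mul]; norm_num [W_zero]

lemma x_c : X .c = W s 1 1 * cD s := by
  rw [cD, ← mul_assoc, W_mul]; norm_num [W_zero]

lemma x_F [Generic s] : X .F = Datum.kF s • (W s (-1) 2 * fD s) := by
  have : Datum.kF s ≠ 0 := inv_ne_zero (Datum.hF s)
  rw [fD, mul_smul_comm, ← mul_assoc, W_mul, smul_smul, mul_inv_cancel₀ this]
  norm_num [W_zero]

lemma x_E [Generic s] : X .E = Datum.kE s • (W s 0 (-2) * eD s) := by
  have : Datum.kE s ≠ 0 := inv_ne_zero (Datum.hE s)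
  rw [eD, mul_smul_comm, ← mul_assoc, W_mul, smul_smul, mul_inv_cancel₀ this]
  norm_num [W_zero]

variable {s}

lemma adjoin_range_x : Algebra.adjoin k (Set.range (X)) = ⊤ := by
  have h := congrArg (Subalgebra.map (RingQuot.mkAlgHom k (Rel k (s ^ 2))))
    (FreeAlgebra.adjoin_range_ι k Gen)
  rw [AlgHom.map_adjoin, Algebra.map_top, ← Set.range_comp,
    (AlgHom.range_eq_top _).2 (RingQuot.mkAlgHom_surjective k (Rel k (s ^ 2)))] at h
  exact h

/-- A subalgebra of `D_q` that contains the adapted generators is everything. -/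
lemma eq_top_of_mem [Generic s] (A : Subalgebra k 𝔻) (hW : ∀ r t, W s r t ∈ A) (hb : bD s ∈ A)
    (hf : fD s ∈ A) (hc : cD s ∈ A) (he : eD s ∈ A) : A = ⊤ := by
  rw [eq_top_iff, ← adjoin_range_x, Algebra.adjoin_le_iff]
  rintro _ ⟨g, rfl⟩
  cases g
  · rw [x_a]; exact hW _ _
  · rw [x_aInv]; exact hW _ _
  · rw [x_b]; exact A.mul_mem (hW _ _) hb
  · rw [x_c]; exact A.mul_mem (hW _ _) hc
  · rw [x_K]; exact hW _ _
  · rw [x_KInv]; exact hW _ _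
  · rw [x_E]; exact A.smul_mem (A.mul_mem (hW _ _) he) _
  · rw [x_F]; exact A.smul_mem (A.mul_mem (hW _ _) hf) _

/-- A subspace of `D_q` that contains `1` and absorbs the adapted generators is everything. -/
lemma mem_of_absorbs [Generic s] (S : Submodule k 𝔻) (h1 : (1 : 𝔻) ∈ S)
    (hW : ∀ r t, ∀ y ∈ S, W s r t * y ∈ S) (hb : ∀ y ∈ S, bD s * y ∈ S)
    (hf : ∀ y ∈ S, fD s * y ∈ S) (hc : ∀ y ∈ S, cD s * y ∈ S) (he : ∀ y ∈ S, eD s * y ∈ S)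
    (z : 𝔻) : z ∈ S := by
  let A : Subalgebra k 𝔻 :=
    { carrier := {x | ∀ y ∈ S, x * y ∈ S}
      mul_mem' := fun {a b} ha hb y hy ↦ by rw [mul_assoc]; exact ha _ (hb _ hy)
      add_mem' := fun {a b} ha hb y hy ↦ by rw [add_mul]; exact S.add_mem (ha _ hy) (hb _ hy)
      algebraMap_mem' := fun r y hy ↦ by rw [← Algebra.smul_def]; exact S.smul_mem r hy }
  have hA : A = ⊤ := eq_top_of_mem A hW hb hf hc he
  have hz : z ∈ A := hA ▸ Algebra.mem_top
  simpa using hz 1 h1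

/-- Homomorphisms out of `D_q` are determined by their values on the adapted generators. -/
lemma algHom_ext' [Generic s] {B : Type*} [Ring B] [Algebra k B] {f g : 𝔻 →ₐ[k] B}
    (hW : ∀ r t, f (W s r t) = g (W s r t)) (hb : f (bD s) = g (bD s)) (hf : f (fD s) = g (fD s))
    (hc : f (cD s) = g (cD s)) (he : f (eD s) = g (eD s)) : f = g := by
  have := eq_top_of_mem (AlgHom.equalizer f g) hW hb hf hc he
  exact AlgHom.ext fun z ↦ (this ▸ Algebra.mem_top : z ∈ AlgHom.equalizer f g)

/-- `K` and `a` are units and `W s r t` is a scaled product of their powers, so two values decide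
all. -/
lemma map_W {B : Type*} [Ring B] [Algebra k B] (d : Datum s B) (f : 𝔻 →ₐ[k] B)
    (hK : f (W s 1 0) = d.w 1 0) (ha : f (W s 0 1) = d.w 0 1) (r t : ℤ) :
    f (W s r t) = d.w r t := by
  have h1 : Units.map (f : 𝔻 →* B) (KUnit k (s ^ 2)) = d.wUnit 1 0 :=
    Units.ext (by rw [Datum.coe_wUnit, ← hK, ← x_K]; rfl)
  have h2 : Units.map (f : 𝔻 →* B) (aUnit k (s ^ 2)) = d.wUnit 0 1 :=
    Units.ext (by rw [Datum.coe_wUnit, ← ha, ← x_a]; rfl)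
  have h3 : f (KA k (s ^ 2) r t) = d.w r 0 * d.w 0 t := by
    change ((Units.map (f : 𝔻 →* B) (KUnit k (s ^ 2) ^ r * aUnit k (s ^ 2) ^ t) : Bˣ) : B) = _
    rw [map_mul, map_zpow, map_zpow, h1, h2, Units.val_mul, d.wUnit_zpow, d.wUnit_zpow]
    simp
  rw [W, map_smul, h3, d.w_mul, smul_smul, ← zpow_add₀ s.ne_zero]
  simp

namespace Datum

variable [Generic s] {B : Type*} [Ring B] [Algebra k B] (d : Datum s B)

@[simp]
lemma lift_W (r t : ℤ) : d.lift (W s r t) = d.w r t := by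
  refine map_W d d.lift ?_ ?_ r t
  · rw [← x_K, lift_x]; rfl
  · rw [← x_a, lift_x]; rfl

@[simp]
lemma lift_bD : d.lift (bD s) = d.b := by
  rw [bD, map_mul, lift_W, lift_x, genImage, ← mul_assoc, d.w_mul]
  simp [d.w_zero]

@[simp]
lemma lift_cD : d.lift (cD s) = d.c := by
  rw [cD, map_mul, lift_W, lift_x, genImage, ← mul_assoc, d.w_mul]
  simp [d.w_zero]

@[simp]
lemma lift_fD : d.lift (fD s) = d.f := by
  have : kF s ≠ 0 := inv_ne_zero (hF s)
  rw [fD, map_smul, map_mul, lift_W, lift_x, genImage, mul_smul_comm, smul_smul,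
    inv_mul_cancel₀ this, one_smul, ← mul_assoc, d.w_mul]
  simp [d.w_zero]

@[simp]
lemma lift_eD : d.lift (eD s) = d.e := by
  have : kE s ≠ 0 := inv_ne_zero (hE s)
  rw [eD, map_smul, map_mul, lift_W, lift_x, genImage, mul_smul_comm, smul_smul,
    inv_mul_cancel₀ this, one_smul, ← mul_assoc, d.w_mul]
  simp [d.w_zero]

end Datum

variable (s) in
/-- The normal element `1 - b f` of `D_q`. -/
noncomputable def phiD : 𝔻 := (datumD s).phi

variable (s) in
/-- The normal element `1 - c e` of `D_q`. -/
noncomputable def psiD : 𝔻 := (datumD s).psi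

lemma Datum.lift_phiD [Generic s] {B : Type*} [Ring B] [Algebra k B] (d : Datum s B) :
    d.lift (phiD s) = d.phi := by
  change d.lift (1 - bD s * fD s) = 1 - d.b * d.f
  simp

lemma Datum.lift_psiD [Generic s] {B : Type*} [Ring B] [Algebra k B] (d : Datum s B) :
    d.lift (psiD s) = d.psi := by
  change d.lift (1 - cD s * eD s) = 1 - d.c * d.e
  simp

/-- `φ` and `phiD` differ by a unit, so they generate the same ideal; `psi_eq` does the same for
`ψ`. -/
lemma phi_eq [Generic s] : HeisenbergDouble.phi k (s ^ 2) = W s 0 1 * phiD s := by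
  have hs := s.ne_zero
  have h1 : fD s * bD s = 1 - (s : k) ^ (-4 : ℤ) • phiD s := (datumD s).fb
  have hk : Datum.kF s * ((s : k) - (s : k) ^ (-3 : ℤ)) = 1 := inv_mul_cancel₀ (Datum.hF s)
  norm_num at hk
  field_simp at hk
  rw [HeisenbergDouble.phi, x_F, x_b, x_a, smul_mul_assoc]
  have h2 : W s (-1) 2 * fD s * (W s 1 (-1) * bD s) =
      (s : k) ^ (2 * 1 - -1 * -1 : ℤ) • (W s (-1 + 1) (2 + -1) * (fD s * bD s)) :=
    (datumD s).mul_mul_w (-1) 2 1 (-1) (datumD s).f_w (bD s)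
  rw [h2, h1]
  norm_num [mul_sub]
  match_scalars
  · field_simp
    linear_combination (-(s : k)) * hk
  · field_simp
    linear_combination hk

lemma psi_eq [Generic s] :
    HeisenbergDouble.psi k (s ^ 2) = (s : k) ^ (-1 : ℤ) • (W s 1 (-1) * psiD s) := by
  have hs := s.ne_zero
  have h1 : eD s * cD s = 1 - (s : k) ^ (4 : ℤ) • psiD s := (datumD s).ec
  have hk : Datum.kE s * ((s : k) ^ (-1 : ℤ) - (s : k) ^ (3 : ℤ)) = 1 := inv_mul_cancel₀ (Datum.hE s)
  norm_num at hk
  field_simp at hk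
  rw [HeisenbergDouble.psi, x_E, x_c, x_aInv, x_K, smul_mul_assoc]
  have h2 : W s 0 (-2) * eD s * (W s 1 1 * cD s) =
      (s : k) ^ (-2 * 1 - 0 * 1 : ℤ) • (W s (0 + 1) (-2 + 1) * (eD s * cD s)) :=
    (datumD s).mul_mul_w 0 (-2) 1 1 (datumD s).e_w (cD s)
  rw [h2, h1, W_mul]
  norm_num [mul_sub]
  match_scalars
  · field_simp
    linear_combination -hk
  · field_simp
    linear_combination hk

end Generators

/-! ### The quantum torus on `φ, ψ, b, c, K, a` and the maps of `D_q` into it -/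

open TwistedAlg

/-- The lattice of exponents of `φ, ψ, b, c, K, a`, in this order, ordered lexicographically. -/
abbrev Lat : Type := Lex (Fin 6 → ℤ)

/-- The vector of the exponents of `φ, ψ, b, c, K, a`. -/
def vec (n m i l r t : ℤ) : Lat := toLex ![n, m, i, l, r, t]

lemma vec_add (n m i l r t n' m' i' l' r' t' : ℤ) :
    vec n m i l r t + vec n' m' i' l' r' t' =
      vec (n + n') (m + m') (i + i') (l + l') (r + r') (t + t') := by
  apply ofLex.injective
  ext j
  fin_cases j <;> rfl

lemma vec_zero : vec 0 0 0 0 0 0 = 0 := by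
  apply ofLex.injective
  ext j
  fin_cases j <;> rfl

lemma nsmul_vec (j : ℕ) (n m i l r t : ℤ) :
    j • vec n m i l r t = vec (j * n) (j * m) (j * i) (j * l) (j * r) (j * t) := by
  induction j with
  | zero => simp [vec_zero]
  | succ j ih => rw [succ_nsmul, ih, vec_add]; push_cast; simp only [add_mul, one_mul]

lemma vec_inj {n m i l r t n' m' i' l' r' t' : ℤ}
    (h : vec n m i l r t = vec n' m' i' l' r' t') :
    n = n' ∧ m = m' ∧ i = i' ∧ l = l' ∧ r = r' ∧ t = t' := by
  have h' := congrArg ofLex h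
  exact ⟨congrFun h' 0, congrFun h' 1, congrFun h' 2, congrFun h' 3, congrFun h' 4, congrFun h' 5⟩

lemma exists_vec (v : Lat) : ∃ n m i l r t, v = vec n m i l r t := by
  refine ⟨v 0, v 1, v 2, v 3, v 4, v 5, ?_⟩
  apply ofLex.injective
  ext j
  fin_cases j <;> rfl

lemma vec_lt_of_lt {n m i l r t n' m' i' l' r' t' : ℤ} (h : n < n') :
    vec n m i l r t < vec n' m' i' l' r' t' :=
  ⟨0, fun j hj ↦ absurd hj (by omega), h⟩

lemma vec_lt_of_lt' {n m i l r t m' i' l' r' t' : ℤ} (h : m < m') :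
    vec n m i l r t < vec n m' i' l' r' t' :=
  ⟨1, fun j hj ↦ by
    obtain rfl : j = 0 := by omega
    rfl, h⟩

/-- The commutation form of `φ, ψ, b, c, K, a`. -/
def omega : Lat →+ Lat →+ ℤ :=
  -- By antisymmetry two monomials commute up to `s ^ (2 ω)`, so each rule with scalar `s ^ 4`
  -- contributes a coefficient 2: `b` with `c`, `b` with `φ`, `ψ` with `c`.
  AddMonoidHom.mk' (fun v ↦ AddMonoidHom.mk' (fun w ↦ v 5 * w 4 - v 4 * w 5 +
    2 * (v 2 * w 3 - v 3 * w 2) + 2 * (v 2 * w 0 - v 0 * w 2) + 2 * (v 1 * w 3 - v 3 * w 1))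
    (fun w w' ↦ by simp only [show ∀ j, (w + w') j = w j + w' j from fun _ ↦ rfl]; ring))
    (fun v v' ↦ by
      ext w
      simp only [AddMonoidHom.mk'_apply, AddMonoidHom.add_apply,
        show ∀ j, (v + v') j = v j + v' j from fun _ ↦ rfl]
      ring)

lemma omega_vec (n m i l r t n' m' i' l' r' t' : ℤ) :
    omega (vec n m i l r t) (vec n' m' i' l' r' t') = t * r' - r * t' +
      2 * (i * l' - l * i') + 2 * (i * n' - n * i') + 2 * (m * l' - l * m') := rfl

section

variable {k : Type*} [Field k] (s : kˣ)

/-- The quantum torus generated by `φ, ψ, b, c, K, a`. -/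
abbrev QT : Type _ := TwistedAlg s omega

/-- The monomial with a given exponent vector. -/
noncomputable def mono (n m i l r t : ℤ) : QT s := single (vec n m i l r t) 1

lemma mono_mul (n m i l r t n' m' i' l' r' t' : ℤ) :
    mono s n m i l r t * mono s n' m' i' l' r' t' = (s : k) ^ (t * r' - r * t' +
      2 * (i * l' - l * i') + 2 * (i * n' - n * i') + 2 * (m * l' - l * m')) •
      mono s (n + n') (m + m') (i + i') (l + l') (r + r') (t + t') := by
  rw [mono, mono, mono, single_mul_single, omega_vec, vec_add, smul_single]
  simp

lemma mono_zero : mono s 0 0 0 0 0 0 = 1 := by rw [mono, vec_zero]; rfl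

/-- The specializations `φ ↦ x φ`, `ψ ↦ y ψ` of `D_q` in the quantum torus. -/
noncomputable def datumQ (x y : k) : Datum s (QT s) where
  w r t := mono s 0 0 0 0 r t
  b := mono s 0 0 1 0 0 0
  -- This is `b⁻¹ (1 - x φ)`, with `s ^ (-2)` from merging `b⁻¹ φ` into one monomial. The values
  -- `(1, 1)`, `(0, 1)`, `(1, 0)` of `(x, y)` give the embedding and the quotients by `φ` and `ψ`.
  f := mono s 0 0 (-1) 0 0 0 - (x * (s : k) ^ (-2 : ℤ)) • mono s 1 0 (-1) 0 0 0
  c := mono s 0 0 0 1 0 0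
  e := mono s 0 0 0 (-1) 0 0 - (y * (s : k) ^ (2 : ℤ)) • mono s 0 1 0 (-1) 0 0
  w_zero := mono_zero s
  w_mul r t r' t' := by simp [mono_mul]
  b_w r t := by simp [mono_mul]
  f_w r t := by simp [mono_mul, mul_sub, sub_mul]
  c_w r t := by simp [mono_mul]
  e_w r t := by simp [mono_mul, mul_sub, sub_mul]
  f_b := by
    have hs := s.ne_zero
    norm_num [mono_mul, mul_sub, sub_mul, mono_zero]
    match_scalars <;> field_simp
    ring
  e_c := by
    have hs := s.ne_zero
    norm_num [mono_mul, mul_sub, sub_mul, mono_zero]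
    match_scalars <;> field_simp
    ring
  b_c := by
    have hs := s.ne_zero
    norm_num [mono_mul, mul_sub, sub_mul, mono_zero]
    match_scalars
    field_simp
  f_c := by
    have hs := s.ne_zero
    norm_num [mono_mul, mul_sub, sub_mul, mono_zero]
    match_scalars <;> field_simp
  b_e := by
    have hs := s.ne_zero
    norm_num [mono_mul, mul_sub, sub_mul, mono_zero]
    match_scalars <;> field_simp
  f_e := by
    have hs := s.ne_zero
    norm_num [mono_mul, mul_sub, sub_mul, mono_zero]
    match_scalars <;> field_simp

lemma datumQ_phi (x y : k) : (datumQ s x y).phi = x • mono s 1 0 0 0 0 0 := by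
  have hs := s.ne_zero
  norm_num [Datum.phi, datumQ, mono_mul, mul_sub, mono_zero]
  match_scalars
  field_simp

lemma datumQ_psi (x y : k) : (datumQ s x y).psi = y • mono s 0 1 0 0 0 0 := by
  have hs := s.ne_zero
  norm_num [Datum.psi, datumQ, mono_mul, mul_sub, mono_zero]
  match_scalars
  field_simp

end

/-! ### Standard monomials span `D_q` -/

section Span

variable {k : Type*} [Field k] (s : kˣ)

local notation "𝔻" => D k (s ^ 2)

/-- The standard monomials of `D_q`. -/
noncomputable def std (u : (ℤ × ℤ) × (ℕ × ℕ) × (ℕ × ℕ)) : 𝔻 :=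
  W s u.1.1 u.1.2 * ((bD s ^ u.2.1.1 * fD s ^ u.2.1.2) * (cD s ^ u.2.2.1 * eD s ^ u.2.2.2))

lemma mul_pow_mul_pow_of_mul_eq {B : Type*} [Ring B] [Algebra k B] {x y g : B} {z z' : k}
    (hx : g * x = z • (x * g)) (hy : g * y = z' • (y * g)) (i j : ℕ) :
    g * (x ^ i * y ^ j) = (z ^ i * z' ^ j) • (x ^ i * y ^ j * g) := by
  rw [← mul_assoc, Datum.mul_pow_of_mul_eq hx, smul_mul_assoc, mul_assoc,
    Datum.mul_pow_of_mul_eq hy, mul_smul_comm, smul_smul, mul_assoc]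

lemma mul_mem_span_of {A ι : Type*} [Ring A] [Algebra k A] {v : ι → A} {g : A}
    (h : ∀ i, g * v i ∈ Submodule.span k (Set.range v)) :
    ∀ y ∈ Submodule.span k (Set.range v), g * y ∈ Submodule.span k (Set.range v) := by
  intro y hy
  have : Submodule.span k (Set.range v) ≤
      (Submodule.span k (Set.range v)).comap (LinearMap.mulLeft k g) := by
    rw [Submodule.span_le]
    rintro _ ⟨i, rfl⟩
    exact h i
  exact this hy

lemma mul_pow_mem_span {B : Type*} [Ring B] [Algebra k B] {x y : B} {z : k}
    (h : y * x = z • (x * y) + (1 - z) • 1) (i j : ℕ) :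
    y * (x ^ i * y ^ j) ∈ Submodule.span k (Set.range fun u : ℕ × ℕ ↦ x ^ u.1 * y ^ u.2) := by
  cases i with
  | zero => exact Submodule.subset_span ⟨(0, j + 1), by simp [pow_succ']⟩
  | succ i =>
    rw [← mul_assoc, Datum.mul_pow_succ_of_mul_eq h, add_mul, smul_mul_assoc, smul_mul_assoc,
      mul_assoc, ← pow_succ']
    exact Submodule.add_mem _ (Submodule.smul_mem _ _ (Submodule.subset_span ⟨(i + 1, j + 1), rfl⟩))
      (Submodule.smul_mem _ _ (Submodule.subset_span ⟨(i, j), rfl⟩))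

/-- The span contains 1 and absorbs the adapted generators from the left. Only `f` meeting powers of
`b` and `e` meeting powers of `c` produce more than one monomial. -/
lemma span_std [Generic s] (z : 𝔻) : z ∈ Submodule.span k (Set.range (std s)) := by
  have hcb : cD s * bD s = (s : k) ^ (-4 : ℤ) • (bD s * cD s) :=
    eq_smul_of_eq_smul s rfl (datumD s).b_c
  have hcf : cD s * fD s = (s : k) ^ (4 : ℤ) • (fD s * cD s) :=
    eq_smul_of_eq_smul s rfl (datumD s).f_c
  have heb : eD s * bD s = (s : k) ^ (4 : ℤ) • (bD s * eD s) :=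
    eq_smul_of_eq_smul s rfl (datumD s).b_e
  have hef : eD s * fD s = (s : k) ^ (-4 : ℤ) • (fD s * eD s) :=
    eq_smul_of_eq_smul s rfl (datumD s).f_e
  have hbW : ∀ r t, bD s * W s r t = W s r t * bD s := (datumD s).b_w
  have hfW : ∀ r t, fD s * W s r t = W s r t * fD s := (datumD s).f_w
  have hcW : ∀ r t, cD s * W s r t = W s r t * cD s := (datumD s).c_w
  have heW : ∀ r t, eD s * W s r t = W s r t * eD s := (datumD s).e_w
  have hmap : ∀ {S : Submodule k 𝔻} {y : 𝔻} (L : 𝔻 →ₗ[k] 𝔻), y ∈ S →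
      S ≤ (Submodule.span k (Set.range (std s))).comap L →
      L y ∈ Submodule.span k (Set.range (std s)) := fun L hy h ↦ h hy
  refine mem_of_absorbs _ ?_ (fun r t ↦ mul_mem_span_of ?_) (mul_mem_span_of ?_)
    (mul_mem_span_of ?_) (mul_mem_span_of ?_) (mul_mem_span_of ?_) z
  · exact Submodule.subset_span ⟨0, by simp [std, W_zero]⟩
  · rintro ⟨⟨r', t'⟩, ⟨i, j⟩, ⟨l, m⟩⟩
    simp only [std]
    rw [← mul_assoc, W_mul, smul_mul_assoc]
    exact Submodule.smul_mem _ _ (Submodule.subset_span ⟨⟨⟨_, _⟩, ⟨i, j⟩, ⟨l, m⟩⟩, rfl⟩)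
  · rintro ⟨⟨r', t'⟩, ⟨i, j⟩, ⟨l, m⟩⟩
    refine Submodule.subset_span ⟨⟨⟨r', t'⟩, ⟨i + 1, j⟩, ⟨l, m⟩⟩, ?_⟩
    simp only [std]
    rw [← mul_assoc (bD s), hbW, pow_succ' (bD s)]
    simp only [mul_assoc]
  · rintro ⟨⟨r', t'⟩, ⟨i, j⟩, ⟨l, m⟩⟩
    simp only [std]
    rw [← mul_assoc (fD s), hfW, mul_assoc, ← mul_assoc (fD s)]
    refine hmap (LinearMap.mulLeft k (W s r' t') ∘ₗ LinearMap.mulRight k (cD s ^ l * eD s ^ m))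
      (mul_pow_mem_span (datumD s).f_b i j) ?_
    rw [Submodule.span_le]
    rintro _ ⟨⟨i', j'⟩, rfl⟩
    exact Submodule.subset_span ⟨⟨⟨r', t'⟩, ⟨i', j'⟩, ⟨l, m⟩⟩, rfl⟩
  · rintro ⟨⟨r', t'⟩, ⟨i, j⟩, ⟨l, m⟩⟩
    simp only [std]
    rw [← mul_assoc (cD s), hcW, mul_assoc, ← mul_assoc (cD s),
      mul_pow_mul_pow_of_mul_eq hcb hcf, smul_mul_assoc, mul_smul_comm]
    refine Submodule.smul_mem _ _ (Submodule.subset_span ⟨⟨⟨r', t'⟩, ⟨i, j⟩, ⟨l + 1, m⟩⟩, ?_⟩)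
    simp only [std, pow_succ', mul_assoc]
  · rintro ⟨⟨r', t'⟩, ⟨i, j⟩, ⟨l, m⟩⟩
    simp only [std]
    rw [← mul_assoc (eD s), heW, mul_assoc, ← mul_assoc (eD s),
      mul_pow_mul_pow_of_mul_eq heb hef, smul_mul_assoc, mul_smul_comm, mul_assoc _ (eD s)]
    refine Submodule.smul_mem _ _ ?_
    refine hmap (LinearMap.mulLeft k (W s r' t') ∘ₗ LinearMap.mulLeft k (bD s ^ i * fD s ^ j))
      (mul_pow_mem_span (datumD s).e_c l m) ?_
    rw [Submodule.span_le]
    rintro _ ⟨⟨l', m'⟩, rfl⟩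
    exact Submodule.subset_span ⟨⟨⟨r', t'⟩, ⟨i, j⟩, ⟨l', m'⟩⟩, rfl⟩

end Span

open TwistedAlg

/-! ### Injectivity of the embedding; the kernels of the two specializations -/

section

variable {k : Type*} [Field k] (s : kˣ)

local notation "𝔻" => D k (s ^ 2)

lemma hasLead_mono (n m i l r t : ℤ) : HasLead (mono s n m i l r t) (vec n m i l r t) :=
  hasLead_single _ one_ne_zero

lemma HasLead.smul {x : QT s} {g : Lat} (h : HasLead x g) {r : k} (hr : r ≠ 0) :
    HasLead (r • x) g := by
  refine ⟨?_, fun u hu ↦ h.2 u ?_⟩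
  · rw [map_smul]; exact mul_ne_zero hr h.1
  · rw [map_smul] at hu; exact right_ne_zero_of_mul hu

lemma hasLead_f {x : k} (hx : x ≠ 0) (y : k) :
    HasLead (datumQ s x y).f (vec 1 0 (-1) 0 0 0) := by
  have hr : -(x * (s : k) ^ (-2 : ℤ)) ≠ 0 :=
    neg_ne_zero.2 (mul_ne_zero hx (zpow_ne_zero _ s.ne_zero))
  have h := (HasLead.smul s (hasLead_mono s 1 0 (-1) 0 0 0) hr).of_add_lt
    (hasLead_mono s 0 0 (-1) 0 0 0) (vec_lt_of_lt one_pos)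
  rwa [neg_smul, neg_add_eq_sub] at h

lemma hasLead_e (x : k) {y : k} (hy : y ≠ 0) :
    HasLead (datumQ s x y).e (vec 0 1 0 (-1) 0 0) := by
  have hr : -(y * (s : k) ^ (2 : ℤ)) ≠ 0 :=
    neg_ne_zero.2 (mul_ne_zero hy (zpow_ne_zero _ s.ne_zero))
  have h := (HasLead.smul s (hasLead_mono s 0 1 0 (-1) 0 0) hr).of_add_lt
    (hasLead_mono s 0 0 0 (-1) 0 0) (vec_lt_of_lt' one_pos)
  rwa [neg_smul, neg_add_eq_sub] at h

lemma hasLead_f_zero (y : k) : HasLead (datumQ s 0 y).f (vec 0 0 (-1) 0 0 0) := by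
  simpa [datumQ] using hasLead_mono s 0 0 (-1) 0 0 0

lemma hasLead_e_zero (x : k) : HasLead (datumQ s x 0).e (vec 0 0 0 (-1) 0 0) := by
  simpa [datumQ] using hasLead_mono s 0 0 0 (-1) 0 0

/-- Modulo `I` the product `x y` is 1, so inner factors cancel until, by truncated subtraction, at
most one of the two powers remains. -/
lemma pow_mul_pow_sub_mem {A : Type*} [Ring A] {x y : A} {I : TwoSidedIdeal A}
    (h : 1 - x * y ∈ I) (i j : ℕ) : x ^ i * y ^ j - x ^ (i - j) * y ^ (j - i) ∈ I := by
  induction i generalizing j with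
  | zero => simp
  | succ i ih =>
    cases j with
    | zero => simp
    | succ j =>
      rw [Nat.succ_sub_succ, Nat.succ_sub_succ]
      have h1 : x ^ (i + 1) * y ^ (j + 1) - x ^ (i - j) * y ^ (j - i) =
          (x ^ i * y ^ j - x ^ (i - j) * y ^ (j - i)) - x ^ i * (1 - x * y) * y ^ j := by
        rw [pow_succ, pow_succ']
        noncomm_ring
      rw [h1]
      exact I.sub_mem (ih j) (I.mul_mem_right _ _ (I.mul_mem_left _ _ h))

/-- A two-sided ideal of an algebra, as a subspace. -/
def idealSubmodule (k : Type*) [Field k] {A : Type*} [Ring A] [Algebra k A] (I : TwoSidedIdeal A) :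
    Submodule k A where
  carrier := {x | x ∈ I}
  add_mem' := I.add_mem
  zero_mem' := I.zero_mem
  smul_mem' r x hx := by
    rw [Algebra.smul_def]
    exact I.mul_mem_left _ _ hx

variable [Generic s]

/-- The parameters `n` and `n'` are 1 or 0 according to whether `φ` or `ψ` survives, so one
computation serves all three specializations. -/
lemma hasLead_lift_std {x y : k} {n n' : ℤ} (hf : HasLead (datumQ s x y).f (vec n 0 (-1) 0 0 0))
    (he : HasLead (datumQ s x y).e (vec 0 n' 0 (-1) 0 0)) (u : (ℤ × ℤ) × (ℕ × ℕ) × (ℕ × ℕ)) :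
    HasLead ((datumQ s x y).lift (std s u)) (vec (u.2.1.2 * n) (u.2.2.2 * n')
      (u.2.1.1 - u.2.1.2) (u.2.2.1 - u.2.2.2) u.1.1 u.1.2) := by
  obtain ⟨⟨r, t⟩, ⟨i, j⟩, ⟨l, m⟩⟩ := u
  simp only [std, map_mul, map_pow, Datum.lift_W, Datum.lift_bD, Datum.lift_fD, Datum.lift_cD,
    Datum.lift_eD]
  have h := (hasLead_mono s 0 0 0 0 r t).mul
    ((((hasLead_mono s 0 0 1 0 0 0).pow i).mul (hf.pow j)).mul
    (((hasLead_mono s 0 0 0 1 0 0).pow l).mul (he.pow m)))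
  simp only [nsmul_vec, vec_add] at h
  change HasLead (mono s 0 0 0 0 r t * (mono s 0 0 1 0 0 0 ^ i * _ *
    (mono s 0 0 0 1 0 0 ^ l * _))) _
  convert h using 2 <;> ring

/-- The embedding of `D_q` in the quantum torus. -/
noncomputable def emb : 𝔻 →ₐ[k] QT s := (datumQ s 1 1).lift

/-- The leading exponents of the elements of `D_q`. -/
lemma exists_hasLead_emb {y : 𝔻} (hy : y ≠ 0) : ∃ (r t : ℤ) (i j l m : ℕ),
    HasLead (emb s y) (vec j m (i - j) (l - m) r t) := by
  obtain ⟨c, rfl⟩ := (Finsupp.mem_span_range_iff_exists_finsupp).1 (span_std s y)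
  have hc : c ≠ 0 := by rintro rfl; simp at hy
  have hl := hasLead_lift_std s (hasLead_f s one_ne_zero 1) (hasLead_e s 1 one_ne_zero)
  -- The exponents of `φ` and `ψ` give `j` and `m`; the differences `i - j` and `l - m` then give
  -- `i` and `l`.
  have hinj : Function.Injective fun u : (ℤ × ℤ) × (ℕ × ℕ) × (ℕ × ℕ) ↦
      vec (u.2.1.2 * 1) (u.2.2.2 * 1) (u.2.1.1 - u.2.1.2) (u.2.2.1 - u.2.2.2) u.1.1 u.1.2 := by
    rintro ⟨⟨r, t⟩, ⟨i, j⟩, ⟨l, m⟩⟩ ⟨⟨r', t'⟩, ⟨i', j'⟩, ⟨l', m'⟩⟩ h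
    obtain ⟨h1, h2, h3, h4, h5, h6⟩ := vec_inj h
    simp only [Prod.mk.injEq]
    simp only [mul_one] at h1 h2 h3 h4 h5 h6
    omega
  obtain ⟨u, hu⟩ := exists_hasLead_linearCombination hinj hl hc
  obtain ⟨⟨r, t⟩, ⟨i, j⟩, ⟨l, m⟩⟩ := u
  refine ⟨r, t, i, j, l, m, ?_⟩
  simp only [mul_one] at hu
  convert hu using 1
  rw [Finsupp.linearCombination_apply, Finsupp.sum, Finsupp.sum, map_sum]
  simp only [map_smul, emb]

lemma emb_injective : Function.Injective (emb s) := by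
  rw [injective_iff_map_eq_zero]
  intro y hy
  by_contra hne
  obtain ⟨r, t, i, j, l, m, h⟩ := exists_hasLead_emb s hne
  exact h.ne_zero hy

/-- Modulo `I` every element is a combination of the `v i`, whose images have distinct leading
exponents and so are independent. Hence the kernel is no larger than `I`. -/
lemma mem_of_lift_eq_zero {ι : Type*} {x y : k} {I : TwoSidedIdeal 𝔻} {v : ι → 𝔻} {d : ι → Lat}
    (hI : ∀ z ∈ I, (datumQ s x y).lift z = 0) (hd : Function.Injective d)
    (hv : ∀ i, HasLead ((datumQ s x y).lift (v i)) (d i))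
    (hstd : ∀ u, ∃ i, std s u - v i ∈ I) {z : 𝔻} (hz : (datumQ s x y).lift z = 0) : z ∈ I := by
  have hle : Submodule.span k (Set.range (std s)) ≤
      Submodule.span k (Set.range v) ⊔ idealSubmodule k I := by
    rw [Submodule.span_le]
    rintro _ ⟨u, rfl⟩
    obtain ⟨i, hi⟩ := hstd u
    exact Submodule.mem_sup.2 ⟨v i, Submodule.subset_span ⟨i, rfl⟩, _, hi, add_sub_cancel _ _⟩
  obtain ⟨p, hp, z', hz', rfl⟩ := Submodule.mem_sup.1 (hle (span_std s z))
  obtain ⟨c, rfl⟩ := (Finsupp.mem_span_range_iff_exists_finsupp).1 hp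
  rw [map_add, hI z' hz', add_zero] at hz
  by_cases hc : c = 0
  · subst hc
    rw [Finsupp.sum_zero_index, zero_add]
    exact hz'
  · obtain ⟨i, hi⟩ := exists_hasLead_linearCombination hd hv hc
    refine absurd ?_ hi.ne_zero
    rw [← hz, Finsupp.linearCombination_apply, Finsupp.sum, Finsupp.sum, map_sum]
    simp only [map_smul]

lemma lift_eq_zero_iff_phi (z : 𝔻) :
    (datumQ s 0 1).lift z = 0 ↔ z ∈ TwoSidedIdeal.span {phiD s} := by
  have hI : ∀ z ∈ TwoSidedIdeal.span {phiD s}, (datumQ s 0 1).lift z = 0 := by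
    intro z hz
    have : TwoSidedIdeal.span {phiD s} ≤ TwoSidedIdeal.ker (datumQ s 0 1).lift := by
      rw [TwoSidedIdeal.span_le, Set.singleton_subset_iff, SetLike.mem_coe, TwoSidedIdeal.mem_ker,
        Datum.lift_phiD, datumQ_phi, zero_smul]
    exact (TwoSidedIdeal.mem_ker _).1 (this hz)
  have hmem : 1 - bD s * fD s ∈ TwoSidedIdeal.span {phiD s} := TwoSidedIdeal.subset_span rfl
  refine ⟨mem_of_lift_eq_zero s (ι := (ℤ × ℤ) × ℤ × (ℕ × ℕ)) hI
    -- Modulo `φ` the elements `b` and `f` are mutually inverse. An integer exponent encodes a power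
    -- of one of them, since `toNat` of it or of its negative is 0.
    (v := fun u ↦ std s (u.1, (u.2.1.toNat, (-u.2.1).toNat), u.2.2))
    (d := fun u ↦ vec 0 u.2.2.2 u.2.1 (u.2.2.1 - u.2.2.2) u.1.1 u.1.2) ?_ ?_ ?_, hI z⟩
  · rintro ⟨⟨r, t⟩, i, ⟨l, m⟩⟩ ⟨⟨r', t'⟩, i', ⟨l', m'⟩⟩ h
    obtain ⟨h1, h2, h3, h4, h5, h6⟩ := vec_inj h
    simp only [Prod.mk.injEq]
    simp only at h1 h2 h3 h4 h5 h6
    omega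
  · rintro ⟨⟨r, t⟩, i, ⟨l, m⟩⟩
    have := hasLead_lift_std s (hasLead_f_zero s 1) (hasLead_e s 0 one_ne_zero)
      ((r, t), (i.toNat, (-i).toNat), (l, m))
    convert this using 2
    · simp
    · simp
    · simp only; omega
  · rintro ⟨⟨r, t⟩, ⟨i, j⟩, ⟨l, m⟩⟩
    refine ⟨((r, t), (i : ℤ) - j, (l, m)), ?_⟩
    have h1 : ((i : ℤ) - j).toNat = i - j := by omega
    have h2 : (-((i : ℤ) - j)).toNat = j - i := by omega
    simp only [std, h1, h2]
    rw [← mul_sub, ← sub_mul]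
    exact TwoSidedIdeal.mul_mem_left _ _ _
      (TwoSidedIdeal.mul_mem_right _ _ _ (pow_mul_pow_sub_mem hmem i j))

lemma lift_eq_zero_iff_psi (z : 𝔻) :
    (datumQ s 1 0).lift z = 0 ↔ z ∈ TwoSidedIdeal.span {psiD s} := by
  have hI : ∀ z ∈ TwoSidedIdeal.span {psiD s}, (datumQ s 1 0).lift z = 0 := by
    intro z hz
    have : TwoSidedIdeal.span {psiD s} ≤ TwoSidedIdeal.ker (datumQ s 1 0).lift := by
      rw [TwoSidedIdeal.span_le, Set.singleton_subset_iff, SetLike.mem_coe, TwoSidedIdeal.mem_ker,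
        Datum.lift_psiD, datumQ_psi, zero_smul]
    exact (TwoSidedIdeal.mem_ker _).1 (this hz)
  have hmem : 1 - cD s * eD s ∈ TwoSidedIdeal.span {psiD s} := TwoSidedIdeal.subset_span rfl
  refine ⟨mem_of_lift_eq_zero s (ι := (ℤ × ℤ) × (ℕ × ℕ) × ℤ) hI
    (v := fun u ↦ std s (u.1, u.2.1, (u.2.2.toNat, (-u.2.2).toNat)))
    (d := fun u ↦ vec u.2.1.2 0 (u.2.1.1 - u.2.1.2) u.2.2 u.1.1 u.1.2) ?_ ?_ ?_, hI z⟩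
  · rintro ⟨⟨r, t⟩, ⟨i, j⟩, l⟩ ⟨⟨r', t'⟩, ⟨i', j'⟩, l'⟩ h
    obtain ⟨h1, h2, h3, h4, h5, h6⟩ := vec_inj h
    simp only [Prod.mk.injEq]
    simp only at h1 h2 h3 h4 h5 h6
    omega
  · rintro ⟨⟨r, t⟩, ⟨i, j⟩, l⟩
    have := hasLead_lift_std s (hasLead_f s one_ne_zero 0) (hasLead_e_zero s 1)
      ((r, t), (i, j), (l.toNat, (-l).toNat))
    convert this using 2
    · simp
    · simp
    · simp only; omega
  · rintro ⟨⟨r, t⟩, ⟨i, j⟩, ⟨l, m⟩⟩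
    refine ⟨((r, t), (i, j), (l : ℤ) - m), ?_⟩
    have h1 : ((l : ℤ) - m).toNat = l - m := by omega
    have h2 : (-((l : ℤ) - m)).toNat = m - l := by omega
    simp only [std, h1, h2]
    rw [← mul_sub, ← mul_sub]
    exact TwoSidedIdeal.mul_mem_left _ _ _
      (TwoSidedIdeal.mul_mem_left _ _ _ (pow_mul_pow_sub_mem hmem l m))

end

open TwistedAlg

/-! ### Prime ideals and height one -/

section Height

variable {R : Type*} [Ring R]

/-- Two incomparable nonzero primes such that each nonzero prime contains one of them are
precisely the primes of height one. -/
lemma isHeightOnePrime_iff {I J : TwoSidedIdeal R} (hbot : IsPrimeIdeal (⊥ : TwoSidedIdeal R))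
    (hI : IsPrimeIdeal I) (hJ : IsPrimeIdeal J) (hI0 : I ≠ ⊥) (hJ0 : J ≠ ⊥) (hIJ : ¬ I ≤ J)
    (hJI : ¬ J ≤ I) (h : ∀ P : TwoSidedIdeal R, IsPrimeIdeal P → P ≠ ⊥ → I ≤ P ∨ J ≤ P)
    (P : TwoSidedIdeal R) : IsHeightOnePrime P ↔ P = I ∨ P = J := by
  have key : ∀ {I J : TwoSidedIdeal R} (hI : IsPrimeIdeal I), I ≠ ⊥ → ¬ J ≤ I →
      (∀ P : TwoSidedIdeal R, IsPrimeIdeal P → P ≠ ⊥ → I ≤ P ∨ J ≤ P) →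
      Order.height (⟨I, hI⟩ : PrimeSpec R) = 1 := by
    intro I J hI hI0 hJI h
    apply le_antisymm
    · refine (Order.height_le_coe_iff (n := 1)).2 fun Q hQ ↦ ?_
      have hQ0 : Q.1 = ⊥ := by
        by_contra hne
        rcases h Q.1 Q.2 hne with h1 | h1
        · exact hQ.not_ge h1
        · exact hJI (h1.trans hQ.le)
      have hmin : IsMin Q := fun Q' _ ↦ by
        change Q.1 ≤ Q'.1
        rw [hQ0]
        exact bot_le
      rw [Order.height_eq_zero.2 hmin]
      exact zero_lt_one
    · have hlt : (⟨⊥, hbot⟩ : PrimeSpec R) < ⟨I, hI⟩ := bot_lt_iff_ne_bot.2 hI0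
      exact le_trans le_add_self (Order.height_add_one_le hlt)
  -- A prime strictly above `I` would have height at least 2, by the chain from `⊥` through `I`.
  have key' : ∀ {I : TwoSidedIdeal R}, IsPrimeIdeal I → I ≠ ⊥ → IsHeightOnePrime P → I ≤ P →
      P = I := by
    rintro I hI hI0 ⟨hP, hPh⟩ hle
    by_contra hne
    have h1 : (⟨⊥, hbot⟩ : PrimeSpec R) < ⟨I, hI⟩ := bot_lt_iff_ne_bot.2 hI0
    have h2 : (⟨I, hI⟩ : PrimeSpec R) < ⟨P, hP⟩ := lt_of_le_of_ne hle fun h ↦ hne (congrArg Subtype.val h).symm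
    have h3 := Order.height_add_one_le h1
    have h4 := Order.height_add_one_le h2
    rw [hPh] at h4
    have h5 : (1 : ℕ∞) + 1 ≤ 1 := le_trans (add_le_add_left (le_trans le_add_self h3) 1) h4
    exact absurd h5 (by decide)
  constructor
  · intro hP
    have hP0 : P ≠ ⊥ := by
      rintro rfl
      obtain ⟨hP, hPh⟩ := hP
      have hmin : IsMin (⟨⊥, hP⟩ : PrimeSpec R) := fun Q _ ↦ (bot_le : ⊥ ≤ Q.1)
      rw [Order.height_eq_zero.2 hmin] at hPh
      exact zero_ne_one hPh
    rcases h P hP.1 hP0 with hle | hle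
    · exact Or.inl (key' hI hI0 hP hle)
    · exact Or.inr (key' hJ hJ0 hP hle)
  · rintro (rfl | rfl)
    · exact ⟨hI, key hI hI0 hJI h⟩
    · exact ⟨hJ, key hJ hJ0 hIJ fun P hP hP0 ↦ (h P hP hP0).symm⟩

/-- The kernel of a homomorphism to a domain is prime. -/
lemma isPrimeIdeal_of_map_eq_zero_iff {S : Type*} [Ring S] [Nontrivial S] [NoZeroDivisors S]
    (f : R →+* S) {I : TwoSidedIdeal R} (h : ∀ x, f x = 0 ↔ x ∈ I) : IsPrimeIdeal I := by
  constructor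
  · rintro rfl
    have := (h 1).2 trivial
    simp at this
  · intro x y hxy
    have h1 := (h _).2 (hxy 1)
    rw [mul_one, map_mul] at h1
    rw [← h, ← h]
    exact mul_eq_zero.1 h1

/-- Normality lets the first factor `x` move past an arbitrary `r`, so that `x r x ^ n z` is a left
multiple of `x ^ (n + 1) z`. -/
lemma mem_or_mem_of_pow_mul_mem {P : TwoSidedIdeal R} (hP : IsPrimeIdeal P) {x : R}
    (hx : ∀ r, ∃ r', x * r = r' * x) {z : R} {n : ℕ} (h : x ^ n * z ∈ P) : x ∈ P ∨ z ∈ P := by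
  induction n with
  | zero => right; simpa using h
  | succ n ih =>
    rcases hP.2 x (x ^ n * z) fun r ↦ by
      obtain ⟨r', hr⟩ := hx r
      rw [hr, mul_assoc, ← mul_assoc x, ← pow_succ']
      exact P.mul_mem_left _ _ h with h1 | h1
    · exact Or.inl h1
    · exact ih h1

end Height

/-! ### Lowering powers inside an ideal -/

section Lower

variable {k A : Type*} [Field k] [Ring A] [Algebra k A]

lemma smul_mem_iff {I : TwoSidedIdeal A} {c : k} (hc : c ≠ 0) {x : A} : c • x ∈ I ↔ x ∈ I :=
  (idealSubmodule k I).smul_mem_iff hc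

/-- The skew commutator with `y` acts like a `z`-derivative: it sends `x ^ (n + 1) Z` to `(1 - z ^
(n + 1)) x ^ n Z`, and the scalar is nonzero. -/
lemma mem_of_pow_mul_mem {I : TwoSidedIdeal A} {x y Z : A} {z t : k}
    (h : y * x = z • (x * y) + (1 - z) • 1) (hz : ∀ n : ℕ, z ^ (n + 1) ≠ 1) (ht : t ≠ 0)
    (hZ : Z * y = t • (y * Z)) {n : ℕ} (hI : x ^ n * Z ∈ I) : Z ∈ I := by
  induction n with
  | zero => simpa using hI
  | succ n ih =>
    apply ih
    have h1 : (1 - z ^ (n + 1)) • (x ^ n * Z) =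
        y * (x ^ (n + 1) * Z) - (z ^ (n + 1) * t⁻¹) • (x ^ (n + 1) * Z * y) := by
      rw [← mul_assoc y, Datum.mul_pow_succ_of_mul_eq h, mul_assoc _ Z, hZ, mul_smul_comm, smul_smul,
        mul_assoc _ t⁻¹, inv_mul_cancel₀ ht, mul_one, add_mul, smul_mul_assoc, smul_mul_assoc,
        mul_assoc, add_sub_cancel_left]
    rw [← smul_mem_iff (sub_ne_zero.2 (hz n).symm), h1]
    exact I.sub_mem (I.mul_mem_left _ _ hI)
      ((idealSubmodule k I).smul_mem _ (I.mul_mem_right _ _ hI))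

end Lower

/-! ### Units, nonzero ideals and height one primes of `D_q` -/

section

variable {k : Type*} [Field k] (s : kˣ)

local notation "𝔻" => D k (s ^ 2)

/-- `x` is a nonzero multiple of the monomial with exponent `v`. -/
def IsMono (x : QT s) (v : Lat) : Prop := ∃ c : k, c ≠ 0 ∧ x = single v c

variable {s} in
lemma IsMono.mul {x y : QT s} {v w : Lat} (hx : IsMono s x v) (hy : IsMono s y w) :
    IsMono s (x * y) (v + w) := by
  obtain ⟨c, hc, rfl⟩ := hx
  obtain ⟨d, hd, rfl⟩ := hy
  exact ⟨_, mul_ne_zero (mul_ne_zero (zpow_ne_zero _ s.ne_zero) hc) hd, single_mul_single v w c d⟩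

variable {s} in
lemma IsMono.pow {x : QT s} {v : Lat} (hx : IsMono s x v) (n : ℕ) : IsMono s (x ^ n) (n • v) := by
  induction n with
  | zero => exact ⟨1, one_ne_zero, by rw [pow_zero, zero_nsmul]; rfl⟩
  | succ n ih => rw [pow_succ, succ_nsmul]; exact ih.mul hx

variable {s} in
lemma IsMono.exists_smul_eq {x y : QT s} {v : Lat} (hx : IsMono s x v) (hy : IsMono s y v) :
    ∃ c : k, c ≠ 0 ∧ x = c • y := by
  obtain ⟨c, hc, rfl⟩ := hx
  obtain ⟨d, hd, rfl⟩ := hy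
  exact ⟨c * d⁻¹, mul_ne_zero hc (inv_ne_zero hd), by
    rw [smul_single, mul_assoc, inv_mul_cancel₀ hd, mul_one]⟩

lemma isMono_mono (n m i l r t : ℤ) : IsMono s (mono s n m i l r t) (vec n m i l r t) :=
  ⟨1, one_ne_zero, rfl⟩

/-- `y` commutes with `x` up to a nonzero scalar. -/
def SkewComm {A : Type*} (k : Type*) [Field k] [Ring A] [Algebra k A] (y x : A) : Prop :=
  ∃ t : k, t ≠ 0 ∧ x * y = t • (y * x)

lemma SkewComm.mul {A : Type*} [Ring A] [Algebra k A] {y x x' : A} (h : SkewComm k y x)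
    (h' : SkewComm k y x') : SkewComm k y (x * x') := by
  obtain ⟨t, ht, h⟩ := h
  obtain ⟨t', ht', h'⟩ := h'
  refine ⟨t * t', mul_ne_zero ht ht', ?_⟩
  rw [mul_assoc, h', mul_smul_comm, ← mul_assoc, h, smul_mul_assoc, smul_smul, mul_comm t',
    mul_assoc]

lemma SkewComm.pow {A : Type*} [Ring A] [Algebra k A] {y x : A} (h : SkewComm k y x) (n : ℕ) :
    SkewComm k y (x ^ n) := by
  induction n with
  | zero => exact ⟨1, one_ne_zero, by simp⟩
  | succ n ih => rw [pow_succ]; exact ih.mul h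

lemma skewComm_of_eq {y x : 𝔻} {m : ℤ} (h : y * x = (s : k) ^ m • (x * y)) : SkewComm k y x :=
  ⟨(s : k) ^ (-m), zpow_ne_zero _ s.ne_zero, eq_smul_of_eq_smul s (add_neg_cancel m) h⟩

/-- The elements `r` with `x r ∈ A x`. -/
def normalizing {A : Type*} (k : Type*) [Field k] [Ring A] [Algebra k A] (x : A) :
    Subalgebra k A where
  carrier := {r | ∃ r', x * r = r' * x}
  mul_mem' := by
    rintro r r₁ ⟨r', h⟩ ⟨r₁', h₁⟩
    exact ⟨r' * r₁', by rw [← mul_assoc, h, mul_assoc, h₁, mul_assoc]⟩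
  add_mem' := by
    rintro r r₁ ⟨r', h⟩ ⟨r₁', h₁⟩
    exact ⟨r' + r₁', by rw [mul_add, h, h₁, add_mul]⟩
  algebraMap_mem' c := ⟨algebraMap k A c, (Algebra.commutes c x).symm⟩

lemma mem_normalizing_of_eq {y x : 𝔻} {m : ℤ} (h : y * x = (s : k) ^ m • (x * y)) :
    y ∈ normalizing k x :=
  ⟨(s : k) ^ (-m) • y, by
    rw [smul_mul_assoc]
    exact eq_smul_of_eq_smul s (add_neg_cancel m) h⟩

lemma span_smul_W_mul {c : k} (hc : c ≠ 0) (r t : ℤ) (z : 𝔻) :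
    TwoSidedIdeal.span {c • (W s r t * z)} = TwoSidedIdeal.span {z} := by
  apply le_antisymm <;> rw [TwoSidedIdeal.span_le, Set.singleton_subset_iff, SetLike.mem_coe]
  · exact (smul_mem_iff hc).2 (TwoSidedIdeal.mul_mem_left _ _ _ (TwoSidedIdeal.subset_span rfl))
  · have h1 : W s r t * z ∈ TwoSidedIdeal.span {c • (W s r t * z)} :=
      (smul_mem_iff hc).1 (TwoSidedIdeal.subset_span rfl)
    have h2 : W s (-r) (-t) * (W s r t * z) = z := by
      have h3 : W s (- -r) (- -t) = W s r t := by rw [neg_neg, neg_neg]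
      have h4 : W s (-r) (-t) * W s (- -r) (- -t) = 1 := (datumD s).w_mul_w_neg (-r) (-t)
      rw [← mul_assoc, ← h3, h4, one_mul]
    rw [← h2]
    exact TwoSidedIdeal.mul_mem_left _ _ _ (h2.symm ▸ h1)

variable [Generic s]

lemma emb_W (r t : ℤ) : emb s (W s r t) = mono s 0 0 0 0 r t := Datum.lift_W _ _ _
lemma emb_bD : emb s (bD s) = mono s 0 0 1 0 0 0 := Datum.lift_bD _
lemma emb_cD : emb s (cD s) = mono s 0 0 0 1 0 0 := Datum.lift_cD _
lemma emb_phiD : emb s (phiD s) = mono s 1 0 0 0 0 0 := by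
  rw [emb, Datum.lift_phiD, datumQ_phi, one_smul]
lemma emb_psiD : emb s (psiD s) = mono s 0 1 0 0 0 0 := by
  rw [emb, Datum.lift_psiD, datumQ_psi, one_smul]

lemma noZeroDivisors_D : NoZeroDivisors 𝔻 :=
  (emb_injective s).noZeroDivisors (emb s) (map_zero _) (map_mul _)

/-- The units of `D_q` are the scalar multiples of the torus elements. -/
lemma exists_eq_smul_W {u v : 𝔻} (huv : u * v = 1) :
    ∃ (c : k) (r t : ℤ), c ≠ 0 ∧ u = c • W s r t := by
  have huv' : emb s u * emb s v = 1 := by rw [← map_mul, huv, map_one]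
  have hu : u ≠ 0 := by
    rintro rfl
    simp at huv'
  have hv : v ≠ 0 := by
    rintro rfl
    simp at huv'
  obtain ⟨r, t, i, j, l, m, h⟩ := exists_hasLead_emb s hu
  obtain ⟨r', t', i', j', l', m', h'⟩ := exists_hasLead_emb s hv
  -- The leading exponents of `u` and `v` add up to 0. The natural numbers `j`, `m` vanish first,
  -- then `i` and `l`, so only the torus part is left.
  have h0 := (h.mul h').unique (huv' ▸ hasLead_one)
  rw [vec_add, ← vec_zero] at h0
  obtain ⟨h1, h2, h3, h4, -, -⟩ := vec_inj h0
  obtain ⟨g, c, hg⟩ := exists_eq_single_of_mul_eq_one huv'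
  have hgl : g = vec 0 0 0 0 r t := by
    have hc : c ≠ 0 := by
      rintro rfl
      apply h.ne_zero
      rw [hg, single, zero_smul]
    have := (hasLead_single g hc).unique (hg ▸ h)
    rw [this]
    congr 1 <;> omega
  refine ⟨c, r, t, ?_, emb_injective s ?_⟩
  · rintro rfl
    apply h.ne_zero
    rw [hg, single, zero_smul]
  · rw [map_smul, emb_W, hg, hgl, mono, smul_single, mul_one]

/-- Elements of `D_q` have no negative powers of `φ` and `ψ`. -/
lemma nonneg_of_coeff_emb_ne_zero (y : 𝔻) {n m i l r t : ℤ}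
    (h : coeff (vec n m i l r t) (emb s y) ≠ 0) : 0 ≤ n ∧ 0 ≤ m := by
  let A : Subalgebra k (QT s) :=
    { carrier := {x | ∀ v : Lat, coeff v x ≠ 0 → 0 ≤ v 0 ∧ 0 ≤ v 1}
      mul_mem' := fun {a b} ha hb v hv ↦ by
        obtain ⟨g, h, rfl, hg, hh⟩ := exists_of_coeff_mul_ne_zero hv
        exact ⟨add_nonneg (ha g hg).1 (hb h hh).1, add_nonneg (ha g hg).2 (hb h hh).2⟩
      add_mem' := fun {a b} ha hb v hv ↦ by
        by_cases hav : coeff v a = 0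
        · rw [map_add, hav, zero_add] at hv
          exact hb v hv
        · exact ha v hav
      algebraMap_mem' := fun c v hv ↦ by
        have hv' : v = 0 := by
          by_contra hne
          apply hv
          rw [Algebra.algebraMap_eq_smul_one, map_smul, one_def,
            coeff_single_of_ne _ (Ne.symm hne), smul_zero]
        subst hv'
        exact ⟨le_rfl, le_rfl⟩ }
  have hmono : ∀ {n m i l r t : ℤ}, 0 ≤ n → 0 ≤ m → mono s n m i l r t ∈ A := by
    intro n m i l r t hn hm v hv
    have : vec n m i l r t = v := by
      by_contra hne
      exact hv (coeff_single_of_ne _ hne)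
    subst this
    exact ⟨hn, hm⟩
  have hA : A.comap (emb s) = ⊤ := by
    refine eq_top_of_mem _ (fun r t ↦ ?_) ?_ ?_ ?_ ?_
    · rw [Subalgebra.mem_comap, emb_W]; exact hmono le_rfl le_rfl
    · rw [Subalgebra.mem_comap, emb_bD]; exact hmono le_rfl le_rfl
    · rw [Subalgebra.mem_comap, emb, Datum.lift_fD]
      exact A.sub_mem (hmono le_rfl le_rfl) (A.smul_mem (hmono zero_le_one le_rfl) _)
    · rw [Subalgebra.mem_comap, emb_cD]; exact hmono le_rfl le_rfl
    · rw [Subalgebra.mem_comap, emb, Datum.lift_eD]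
      exact A.sub_mem (hmono le_rfl le_rfl) (A.smul_mem (hmono le_rfl zero_le_one) _)
  have hy : y ∈ A.comap (emb s) := hA ▸ Algebra.mem_top
  exact hy _ h

/-- The elements of `D_q` that are monomials in the quantum torus separate exponents. -/
lemma exists_separating {v v' : Lat} (hne : v ≠ v') : ∃ (g : 𝔻) (u : Lat),
    emb s g = single u 1 ∧ omega v u - omega u v ≠ omega v' u - omega u v' := by
  obtain ⟨n, m, i, l, r, t, rfl⟩ := exists_vec v
  obtain ⟨n', m', i', l', r', t', rfl⟩ := exists_vec v'
  by_contra! h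
  -- Nondegeneracy of the form: pairing with `K` and `a` recovers `t` and `r`, with `φ` and `ψ`
  -- recovers `i` and `l`, and then with `b` and `c` recovers `n` and `m`.
  have h1 := h _ _ (emb_W s 1 0)
  have h2 := h _ _ (emb_W s 0 1)
  have h3 := h _ _ (emb_bD s)
  have h4 := h _ _ (emb_cD s)
  have h5 := h _ _ (emb_phiD s)
  have h6 := h _ _ (emb_psiD s)
  simp only [omega_vec] at h1 h2 h3 h4 h5 h6
  apply hne
  congr 1 <;> omega

/-- A nonzero ideal contains an element that is a monomial in the quantum torus. -/
lemma exists_monomial_mem {I : TwoSidedIdeal 𝔻} (N : ℕ) : ∀ y ∈ I, y ≠ 0 →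
    (emb s y).supp.card ≤ N → ∃ z ∈ I, ∃ g, IsMono s (emb s z) g := by
  induction N with
  | zero =>
    intro y _ hy0 hcard
    have hy0' : emb s y ≠ 0 := fun h ↦ hy0 (emb_injective s (by rw [h, map_zero]))
    rw [Nat.le_zero, Finset.card_eq_zero] at hcard
    rw [← sum_single (emb s y), hcard] at hy0'
    simp at hy0'
  | succ N ih =>
    intro y hy hy0 hcard
    have hy0' : emb s y ≠ 0 := fun h ↦ hy0 (emb_injective s (by rw [h, map_zero]))
    obtain ⟨v, hv⟩ := exists_hasLead hy0'
    by_cases hall : ∀ v', coeff v' (emb s y) ≠ 0 → v' = v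
    · exact ⟨y, hy, v, _, hv.1, eq_single hall⟩
    push Not at hall
    obtain ⟨v', hv', hne⟩ := hall
    obtain ⟨g, u, hg, hu⟩ := exists_separating s hne
    -- This skew commutator kills the coefficient at `v` and keeps the one at `v'`. It is nonzero,
    -- lies in `I`, and has smaller support.
    set z : 𝔻 := y * g - ((s : k) ^ (omega v u - omega u v)) • (g * y) with hz
    have hzI : z ∈ I := I.sub_mem (I.mul_mem_right _ _ hy)
      ((idealSubmodule k I).smul_mem _ (I.mul_mem_left _ _ hy))
    have hcoeff : ∀ w, coeff (w + u) (emb s z) = ((s : k) ^ omega w u -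
        (s : k) ^ (omega v u - omega u v + omega u w)) * coeff w (emb s y) := by
      intro w
      rw [hz, map_sub, map_smul, map_mul, map_mul, hg, map_sub, map_smul, coeff_mul_single,
        add_comm w u, coeff_single_mul, smul_eq_mul, zpow_add₀ s.ne_zero]
      ring
    have hz0 : z ≠ 0 := by
      intro h0
      have h1 := hcoeff v'
      rw [h0, map_zero, map_zero, zero_eq_mul, sub_eq_zero] at h1
      rcases h1 with h1 | h1
      · have := Generic.zpow_inj s h1
        omega
      · exact hv' h1
    refine ih z hzI hz0 ?_
    have hsub : (emb s z).supp ⊆ ((emb s y).supp.erase v).map (addRightEmbedding u) := by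
      intro w hw
      rw [mem_supp] at hw
      obtain ⟨w', rfl⟩ : ∃ w', w = w' + u := ⟨w - u, by abel⟩
      rw [hcoeff] at hw
      refine Finset.mem_map.2 ⟨w', Finset.mem_erase.2 ⟨?_, mem_supp.2 (right_ne_zero_of_mul hw)⟩, rfl⟩
      rintro rfl
      apply left_ne_zero_of_mul hw
      rw [sub_add_cancel, sub_self]
    have := Finset.card_le_card hsub
    rw [Finset.card_map, Finset.card_erase_of_mem (mem_supp.2 hv.1)] at this
    omega

lemma isMono_emb (n m i l : ℕ) :
    IsMono s (emb s (bD s ^ i * (cD s ^ l * (phiD s ^ n * psiD s ^ m)))) (vec n m i l 0 0) := by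
  have h := ((isMono_mono s 0 0 1 0 0 0).pow i).mul (((isMono_mono s 0 0 0 1 0 0).pow l).mul
    (((isMono_mono s 1 0 0 0 0 0).pow n).mul ((isMono_mono s 0 1 0 0 0 0).pow m)))
  simpa only [map_mul, map_pow, emb_bD, emb_cD, emb_phiD, emb_psiD, nsmul_vec, vec_add, mul_zero,
    mul_one, zero_add, add_zero] using h

/-- Right multiplication by a torus element clears the exponents of `K` and `a`, and right
multiplication by `b`, `c`, `φ`, `ψ` to the absolute values of their exponents makes the remaining
exponents nonnegative. -/
lemma exists_monomial_mem_of_ne_bot {I : TwoSidedIdeal 𝔻} (hI : I ≠ ⊥) : ∃ n m i l : ℕ,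
    bD s ^ i * (cD s ^ l * (phiD s ^ n * psiD s ^ m)) ∈ I := by
  obtain ⟨y, hy, hy0⟩ : ∃ y ∈ I, y ≠ 0 := by
    by_contra! h
    exact hI (eq_bot_iff.2 fun y hy ↦ (TwoSidedIdeal.mem_bot _).2 (h y hy))
  obtain ⟨z, hz, g, hzg⟩ := exists_monomial_mem s _ y hy hy0 le_rfl
  obtain ⟨n, m, i, l, r, t, rfl⟩ := exists_vec g
  have h₁ := hzg.mul ((isMono_mono s 0 0 0 0 (-r) (-t)).mul
    (isMono_emb s n.natAbs m.natAbs i.natAbs l.natAbs))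
  have h₂ := isMono_emb s (n + n.natAbs).toNat (m + m.natAbs).toNat
    (i + i.natAbs).toNat (l + l.natAbs).toNat
  rw [← emb_W, ← map_mul, ← map_mul, vec_add, vec_add] at h₁
  have hv : vec (n + (0 + n.natAbs)) (m + (0 + m.natAbs)) (i + (0 + i.natAbs))
      (l + (0 + l.natAbs)) (r + (-r + 0)) (t + (-t + 0)) =
      vec ((n + n.natAbs).toNat : ℤ) ((m + m.natAbs).toNat : ℤ) ((i + i.natAbs).toNat : ℤ)
        ((l + l.natAbs).toNat : ℤ) 0 0 := by
    congr 1 <;> omega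
  rw [hv] at h₁
  obtain ⟨d, hd, h⟩ := h₁.exists_smul_eq h₂
  rw [← map_smul] at h
  have h' := emb_injective s h
  refine ⟨_, _, _, _, (smul_mem_iff hd).1 (h' ▸ I.mul_mem_right _ _ hz)⟩

/-- A nonzero ideal of `D_q` contains some `φ ^ n ψ ^ m`. -/
lemma exists_phi_pow_mul_psi_pow_mem {I : TwoSidedIdeal 𝔻} (hI : I ≠ ⊥) :
    ∃ n m : ℕ, phiD s ^ n * psiD s ^ m ∈ I := by
  obtain ⟨n, m, i, l, h⟩ := exists_monomial_mem_of_ne_bot s hI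
  have hp : ∀ a : ℤ, a ≠ 0 → ∀ n : ℕ, ((s : k) ^ a) ^ (n + 1) ≠ 1 := by
    intro a ha n hn
    rw [← zpow_natCast, ← zpow_mul] at hn
    have := Generic.eq_zero_of_zpow_eq_one (s := s) _ hn
    push_cast at this
    rcases mul_eq_zero.1 this with h | h
    · exact ha h
    · omega
  have h0 : ∀ {y x : 𝔻}, y * x = x * y → SkewComm k y x := fun h ↦
    ⟨1, one_ne_zero, by rw [one_smul, h]⟩
  have hf : SkewComm k (fD s) (cD s ^ l * (phiD s ^ n * psiD s ^ m)) :=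
    ((skewComm_of_eq s (datumD s).f_c).pow l).mul (((skewComm_of_eq s (datumD s).f_phi).pow n).mul
      ((h0 (datumD s).f_psi).pow m))
  have he : SkewComm k (eD s) (phiD s ^ n * psiD s ^ m) :=
    ((h0 (datumD s).e_phi).pow n).mul ((skewComm_of_eq s (datumD s).e_psi).pow m)
  obtain ⟨t, ht, hf⟩ := hf
  obtain ⟨t', ht', he⟩ := he
  -- The inner application strips the powers of `b` by means of `f`, the outer one those of `c` by
  -- means of `e`.
  exact ⟨n, m, mem_of_pow_mul_mem (datumD s).e_c (hp 4 (by norm_num)) ht' he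
    (mem_of_pow_mul_mem (datumD s).f_b (hp (-4) (by norm_num)) ht hf h)⟩

lemma phiD_normal (r : 𝔻) : ∃ r', phiD s * r = r' * phiD s := by
  have h : normalizing k (phiD s) = ⊤ :=
    eq_top_of_mem _ (fun r t ↦ ⟨_, (datumD s).phi_w r t⟩)
      (mem_normalizing_of_eq s (datumD s).b_phi) (mem_normalizing_of_eq s (datumD s).f_phi)
      ⟨_, (datumD s).c_phi.symm⟩ ⟨_, (datumD s).e_phi.symm⟩
  exact (h ▸ Algebra.mem_top : r ∈ normalizing k (phiD s))

lemma psiD_normal (r : 𝔻) : ∃ r', psiD s * r = r' * psiD s := by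
  have h : normalizing k (psiD s) = ⊤ :=
    eq_top_of_mem _ (fun r t ↦ ⟨_, (datumD s).psi_w r t⟩)
      ⟨_, (datumD s).b_psi.symm⟩ ⟨_, (datumD s).f_psi.symm⟩
      (mem_normalizing_of_eq s (datumD s).c_psi) (mem_normalizing_of_eq s (datumD s).e_psi)
  exact (h ▸ Algebra.mem_top : r ∈ normalizing k (psiD s))

lemma span_le_of_isPrimeIdeal (P : TwoSidedIdeal 𝔻) (hP : IsPrimeIdeal P) (hP0 : P ≠ ⊥) :
    TwoSidedIdeal.span {phiD s} ≤ P ∨ TwoSidedIdeal.span {psiD s} ≤ P := by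
  obtain ⟨n, m, h⟩ := exists_phi_pow_mul_psi_pow_mem s hP0
  simp only [TwoSidedIdeal.span_le, Set.singleton_subset_iff, SetLike.mem_coe]
  rcases mem_or_mem_of_pow_mul_mem hP (phiD_normal s) h with h | h
  · exact Or.inl h
  · rw [← mul_one (psiD s ^ m)] at h
    rcases mem_or_mem_of_pow_mul_mem hP (psiD_normal s) h with h | h
    · exact Or.inr h
    · exact (hP.1 ((TwoSidedIdeal.one_mem_iff P).1 h)).elim

lemma isPrimeIdeal_bot : IsPrimeIdeal (⊥ : TwoSidedIdeal 𝔻) :=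
  isPrimeIdeal_of_map_eq_zero_iff (emb s : 𝔻 →+* QT s) fun x ↦ by
    rw [TwoSidedIdeal.mem_bot]
    exact map_eq_zero_iff (emb s) (emb_injective s)

lemma isPrimeIdeal_phi : IsPrimeIdeal (TwoSidedIdeal.span {phiD s}) :=
  isPrimeIdeal_of_map_eq_zero_iff ((datumQ s 0 1).lift : 𝔻 →+* QT s) (lift_eq_zero_iff_phi s)

lemma isPrimeIdeal_psi : IsPrimeIdeal (TwoSidedIdeal.span {psiD s}) :=
  isPrimeIdeal_of_map_eq_zero_iff ((datumQ s 1 0).lift : 𝔻 →+* QT s) (lift_eq_zero_iff_psi s)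

lemma psiD_notMem : psiD s ∉ TwoSidedIdeal.span {phiD s} := by
  rw [← lift_eq_zero_iff_phi, Datum.lift_psiD, datumQ_psi, one_smul]
  exact single_ne_zero _

lemma phiD_notMem : phiD s ∉ TwoSidedIdeal.span {psiD s} := by
  rw [← lift_eq_zero_iff_psi, Datum.lift_phiD, datumQ_phi, one_smul]
  exact single_ne_zero _

lemma span_phiD_ne_bot : TwoSidedIdeal.span {phiD s} ≠ ⊥ := fun h ↦ by
  have h1 : phiD s ∈ TwoSidedIdeal.span {phiD s} := TwoSidedIdeal.subset_span rfl
  rw [h, TwoSidedIdeal.mem_bot] at h1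
  exact phiD_notMem s (h1 ▸ TwoSidedIdeal.zero_mem _)

lemma span_psiD_ne_bot : TwoSidedIdeal.span {psiD s} ≠ ⊥ := fun h ↦ by
  have h1 : psiD s ∈ TwoSidedIdeal.span {psiD s} := TwoSidedIdeal.subset_span rfl
  rw [h, TwoSidedIdeal.mem_bot] at h1
  exact psiD_notMem s (h1 ▸ TwoSidedIdeal.zero_mem _)

lemma span_phi : TwoSidedIdeal.span {phi k (s ^ 2)} = TwoSidedIdeal.span {phiD s} := by
  rw [phi_eq, ← one_smul k (W s 0 1 * phiD s), span_smul_W_mul s one_ne_zero]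

lemma span_psi : TwoSidedIdeal.span {psi k (s ^ 2)} = TwoSidedIdeal.span {psiD s} := by
  rw [psi_eq, span_smul_W_mul s (zpow_ne_zero _ s.ne_zero)]

/-- The height one primes of `D_q`. -/
theorem isHeightOnePrime_iff_eq_span (P : TwoSidedIdeal 𝔻) : IsHeightOnePrime P ↔
    P = TwoSidedIdeal.span {phi k (s ^ 2)} ∨ P = TwoSidedIdeal.span {psi k (s ^ 2)} := by
  rw [span_phi, span_psi]
  exact isHeightOnePrime_iff (isPrimeIdeal_bot s) (isPrimeIdeal_phi s) (isPrimeIdeal_psi s)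
    (span_phiD_ne_bot s) (span_psiD_ne_bot s)
    (fun h ↦ phiD_notMem s (h (TwoSidedIdeal.subset_span rfl)))
    (fun h ↦ psiD_notMem s (h (TwoSidedIdeal.subset_span rfl))) (span_le_of_isPrimeIdeal s) P

end

open TwistedAlg

/-! ### The actions of `SL₂(ℤ)` and `(k*)⁴` -/

section

variable {k : Type*} [Field k] (s : kˣ)

local notation "𝔻" => D k (s ^ 2)

/-- The action of `SL₂(ℤ)` on the torus part of `D_q`. -/
noncomputable def slDatum (g : SL(2, ℤ)) : Datum s 𝔻 where
  __ := datumD s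
  w r t := W s (g.1 0 0 * r + g.1 0 1 * t) (g.1 1 0 * r + g.1 1 1 * t)
  w_zero := by simp [W_zero]
  w_mul r t r' t' := by
    -- Determinant 1 is what preserves the alternating form in the cocycle of `W`.
    have hdet := g.2
    rw [Matrix.det_fin_two] at hdet
    rw [W_mul]
    congr 1
    · congr 1
      linear_combination (t * r' - r * t') * hdet
    · congr 1 <;> ring
  b_w _ _ := (datumD s).b_w _ _
  f_w _ _ := (datumD s).f_w _ _
  c_w _ _ := (datumD s).c_w _ _
  e_w _ _ := (datumD s).e_w _ _

/-- The diagonal action of the torus `(k*)⁴` on `D_q`. -/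
noncomputable def diagDatum (u : Torus k) : Datum s 𝔻 where
  w r t := ((u.1 ^ r * u.2.1 ^ t : kˣ) : k) • W s r t
  -- The scalars on `b` and `f` are inverse, so `φ` is fixed, and they are chosen so that the
  -- original `F` is multiplied by exactly the third coordinate. Similarly `c`, `e` are normalized
  -- so that `E` is multiplied by the fourth.
  b := ((u.1⁻¹ * u.2.1 ^ 2 * u.2.2.1⁻¹ : kˣ) : k) • bD s
  f := ((u.1⁻¹ * u.2.1 ^ 2 * u.2.2.1⁻¹ : kˣ) : k)⁻¹ • fD s
  c := (((u.2.1 ^ 2)⁻¹ * u.2.2.2⁻¹ : kˣ) : k) • cD s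
  e := (((u.2.1 ^ 2)⁻¹ * u.2.2.2⁻¹ : kˣ) : k)⁻¹ • eD s
  w_zero := by simp [W_zero]
  w_mul r t r' t' := by
    rw [smul_mul_smul_comm, W_mul, smul_comm, ← Units.val_mul, mul_mul_mul_comm, ← zpow_add,
      ← zpow_add]
  b_w r t := by
    rw [smul_mul_smul_comm, smul_mul_smul_comm, mul_comm (Units.val _)]
    exact congrArg _ ((datumD s).b_w r t)
  f_w r t := by
    rw [smul_mul_smul_comm, smul_mul_smul_comm, mul_comm (_⁻¹)]
    exact congrArg _ ((datumD s).f_w r t)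
  c_w r t := by
    rw [smul_mul_smul_comm, smul_mul_smul_comm, mul_comm (Units.val _)]
    exact congrArg _ ((datumD s).c_w r t)
  e_w r t := by
    rw [smul_mul_smul_comm, smul_mul_smul_comm, mul_comm (_⁻¹)]
    exact congrArg _ ((datumD s).e_w r t)
  f_b := by
    rw [smul_mul_smul_comm, smul_mul_smul_comm, inv_mul_cancel₀ (Units.ne_zero _),
      mul_inv_cancel₀ (Units.ne_zero _), one_smul, one_smul]
    exact (datumD s).f_b
  e_c := by
    rw [smul_mul_smul_comm, smul_mul_smul_comm, inv_mul_cancel₀ (Units.ne_zero _),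
      mul_inv_cancel₀ (Units.ne_zero _), one_smul, one_smul]
    exact (datumD s).e_c
  b_c := by
    rw [smul_mul_smul_comm, smul_mul_smul_comm, smul_comm, mul_comm (Units.val _)]
    exact congrArg _ (datumD s).b_c
  f_c := by
    rw [smul_mul_smul_comm, smul_mul_smul_comm, smul_comm, mul_comm (_⁻¹)]
    exact congrArg _ (datumD s).f_c
  b_e := by
    rw [smul_mul_smul_comm, smul_mul_smul_comm, smul_comm, mul_comm (Units.val _)]
    exact congrArg _ (datumD s).b_e
  f_e := by
    rw [smul_mul_smul_comm, smul_mul_smul_comm, smul_comm, mul_comm (_⁻¹)]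
    exact congrArg _ (datumD s).f_e

variable [Generic s]

/-- The action of `SL₂(ℤ)` by endomorphisms. -/
noncomputable def slHom : SL(2, ℤ) →* (𝔻 →ₐ[k] 𝔻) where
  toFun g := (slDatum s g).lift
  map_one' := by
    refine algHom_ext' (fun r t ↦ ?_) ?_ ?_ ?_ ?_ <;> simp [slDatum, datumD]
  map_mul' g h := by
    refine algHom_ext' (fun r t ↦ ?_) ?_ ?_ ?_ ?_
    · rw [AlgHom.mul_apply, Datum.lift_W, Datum.lift_W]
      simp only [slDatum, Datum.lift_W, Matrix.SpecialLinearGroup.coe_mul, Matrix.mul_apply,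
        Fin.sum_univ_two]
      congr 1 <;> ring
    all_goals simp [slDatum, datumD]

/-- The action of `(k*)⁴` by endomorphisms. -/
noncomputable def diagHom : Torus k →* (𝔻 →ₐ[k] 𝔻) where
  toFun u := (diagDatum s u).lift
  map_one' := by
    refine algHom_ext' (fun r t ↦ ?_) ?_ ?_ ?_ ?_ <;> simp [diagDatum]
  map_mul' u v := by
    refine algHom_ext' (fun r t ↦ ?_) ?_ ?_ ?_ ?_
    all_goals
      simp only [AlgHom.mul_apply, Datum.lift_W, Datum.lift_bD, Datum.lift_fD, Datum.lift_cD,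
        Datum.lift_eD, diagDatum, map_smul, smul_smul, ← Units.val_mul, ← Units.val_inv_eq_inv_val,
        Prod.fst_mul, Prod.snd_mul, mul_zpow, mul_pow, mul_inv]
      congr 2
      ac_rfl

/-- The action of `SL₂(ℤ)` by automorphisms. -/
noncomputable def slAut : SL(2, ℤ) →* (𝔻 ≃ₐ[k] 𝔻) :=
  -- The source is a group, so the endomorphisms are invertible.
  (AlgEquiv.algHomUnitsEquiv k 𝔻).toMonoidHom.comp (slHom s).toHomUnits

/-- The action of `(k*)⁴` by automorphisms. -/
noncomputable def diagAut : Torus k →* (𝔻 ≃ₐ[k] 𝔻) :=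
  (AlgEquiv.algHomUnitsEquiv k 𝔻).toMonoidHom.comp (diagHom s).toHomUnits

lemma slAut_W (g : SL(2, ℤ)) (r t : ℤ) : slAut s g (W s r t) =
    W s (g.1 0 0 * r + g.1 0 1 * t) (g.1 1 0 * r + g.1 1 1 * t) := Datum.lift_W _ _ _
lemma slAut_bD (g : SL(2, ℤ)) : slAut s g (bD s) = bD s := Datum.lift_bD _
lemma slAut_fD (g : SL(2, ℤ)) : slAut s g (fD s) = fD s := Datum.lift_fD _
lemma slAut_cD (g : SL(2, ℤ)) : slAut s g (cD s) = cD s := Datum.lift_cD _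
lemma slAut_eD (g : SL(2, ℤ)) : slAut s g (eD s) = eD s := Datum.lift_eD _
lemma diagAut_W (u : Torus k) (r t : ℤ) : diagAut s u (W s r t) =
    ((u.1 ^ r * u.2.1 ^ t : kˣ) : k) • W s r t := Datum.lift_W _ _ _
lemma diagAut_bD (u : Torus k) : diagAut s u (bD s) =
    ((u.1⁻¹ * u.2.1 ^ 2 * u.2.2.1⁻¹ : kˣ) : k) • bD s := Datum.lift_bD _
lemma diagAut_fD (u : Torus k) : diagAut s u (fD s) =
    ((u.1⁻¹ * u.2.1 ^ 2 * u.2.2.1⁻¹ : kˣ) : k)⁻¹ • fD s := Datum.lift_fD _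
lemma diagAut_cD (u : Torus k) : diagAut s u (cD s) =
    (((u.2.1 ^ 2)⁻¹ * u.2.2.2⁻¹ : kˣ) : k) • cD s := Datum.lift_cD _
lemma diagAut_eD (u : Torus k) : diagAut s u (eD s) =
    (((u.2.1 ^ 2)⁻¹ * u.2.2.2⁻¹ : kˣ) : k)⁻¹ • eD s := Datum.lift_eD _

/-- Once all automorphisms are known to have this form, `φ` is fixed by every one of them; this
rules out an interchange with `ψ`. -/
lemma slAut_mul_diagAut_phiD (g : SL(2, ℤ)) (u : Torus k) :
    (slAut s g * diagAut s u) (phiD s) = phiD s := by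
  change (slAut s g * diagAut s u) (1 - bD s * fD s) = 1 - bD s * fD s
  rw [map_sub, map_one, map_mul]
  simp only [AlgEquiv.mul_apply, diagAut_bD, diagAut_fD, map_smul, slAut_bD, slAut_fD]
  rw [smul_mul_smul_comm, mul_inv_cancel₀ (Units.ne_zero _), one_smul]

/-- Automorphisms of `D_q` are determined by their values on the adapted generators. -/
lemma algEquiv_ext' {f g : 𝔻 ≃ₐ[k] 𝔻} (hW : ∀ r t, f (W s r t) = g (W s r t))
    (hb : f (bD s) = g (bD s)) (hf : f (fD s) = g (fD s)) (hc : f (cD s) = g (cD s))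
    (he : f (eD s) = g (eD s)) : f = g := by
  have : (f : 𝔻 →ₐ[k] 𝔻) = g := algHom_ext' hW hb hf hc he
  exact AlgEquiv.ext fun y ↦ DFunLike.congr_fun this y

/-- The torus is normalized by `SL₂(ℤ)`. -/
lemma exists_slAut_conj (g : SL(2, ℤ)) (u : Torus k) :
    ∃ v, slAut s g * diagAut s u = diagAut s v * slAut s g := by
  have hdet := g.2
  rw [Matrix.det_fin_two] at hdet
  set i := g.1 0 0
  set m := g.1 0 1
  set j := g.1 1 0
  set n := g.1 1 1
  -- `a` and `b` are the values at `K` and `a` of the character of `u` composed with `g⁻¹`.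
  set a := u.1 ^ n * u.2.1 ^ (-j) with ha
  set b := u.1 ^ (-m) * u.2.1 ^ i with hb
  have hxy : ∀ x y : kˣ, x * (x * y⁻¹)⁻¹ = y := fun x y ↦ by
    rw [mul_inv_rev, inv_inv, mul_comm, mul_assoc, inv_mul_cancel, mul_one]
  -- The last two coordinates are solved from the condition that `bD` and `cD` be scaled as they are
  -- by `u`.
  refine ⟨(a, b, a⁻¹ * b ^ 2 * (u.1⁻¹ * u.2.1 ^ 2 * u.2.2.1⁻¹)⁻¹,
    (b ^ 2)⁻¹ * ((u.2.1 ^ 2)⁻¹ * u.2.2.2⁻¹)⁻¹), ?_⟩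
  refine algEquiv_ext' s (fun r t ↦ ?_) ?_ ?_ ?_ ?_
  · simp only [AlgEquiv.mul_apply, diagAut_W, map_smul, slAut_W]
    congr 2
    simp only [ha, hb, mul_zpow, ← zpow_mul]
    rw [mul_mul_mul_comm, ← zpow_add, ← zpow_add]
    congr 2
    · linear_combination (-r) * hdet
    · linear_combination (-t) * hdet
  all_goals
    simp only [AlgEquiv.mul_apply, diagAut_bD, diagAut_fD, diagAut_cD, diagAut_eD, map_smul,
      slAut_bD, slAut_fD, slAut_cD, slAut_eD]
    rw [hxy]

end

open TwistedAlg

/-! ### Images of `φ` and `ψ`; weights -/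

section

variable {k : Type*} [Field k] (s : kˣ)

local notation "𝔻" => D k (s ^ 2)

/-- The normal elements `φ` and `ψ`. -/
noncomputable def theta : Bool → 𝔻
  | false => phiD s
  | true => psiD s

lemma theta_W (i : Bool) (r t : ℤ) : theta s i * W s r t = W s r t * theta s i := by
  cases i
  · exact (datumD s).phi_w r t
  · exact (datumD s).psi_w r t

variable [Generic s]

lemma smul_W_inj {c c' : k} (hc : c ≠ 0) {r t r' t' : ℤ} (h : c • W s r t = c' • W s r' t') :
    c = c' ∧ r = r' ∧ t = t' := by
  have h1 := congrArg (emb s) h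
  rw [map_smul, map_smul, emb_W, emb_W] at h1
  have hl := HasLead.smul s (hasLead_mono s 0 0 0 0 r t) hc
  have hc' : c' ≠ 0 := by
    rintro rfl
    rw [zero_smul] at h1
    exact hl.ne_zero h1
  obtain ⟨-, -, -, -, hr, ht⟩ :=
    vec_inj (hl.unique (h1 ▸ HasLead.smul s (hasLead_mono s 0 0 0 0 r' t') hc'))
  subst hr ht
  have h2 := congrArg (coeff (vec 0 0 0 0 r t)) h1
  simp only [map_smul, mono, coeff_single_self, smul_eq_mul, mul_one] at h2
  exact ⟨h2, rfl, rfl⟩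

lemma bD_ne_zero : bD s ≠ 0 := fun h ↦ by
  have := emb_bD s
  rw [h, map_zero] at this
  exact (hasLead_mono s 0 0 1 0 0 0).ne_zero this.symm

lemma cD_ne_zero : cD s ≠ 0 := fun h ↦ by
  have := emb_cD s
  rw [h, map_zero] at this
  exact (hasLead_mono s 0 0 0 1 0 0).ne_zero this.symm

lemma phiD_ne_zero : phiD s ≠ 0 := fun h ↦
  phiD_notMem s (h ▸ TwoSidedIdeal.zero_mem _)

lemma psiD_ne_zero : psiD s ≠ 0 := fun h ↦
  psiD_notMem s (h ▸ TwoSidedIdeal.zero_mem _)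

lemma bD_not_unit (y : 𝔻) : bD s * y ≠ 1 := fun h ↦ by
  obtain ⟨c, r, t, hc, h⟩ := exists_eq_smul_W s h
  have h1 := congrArg (emb s) h
  rw [emb_bD, map_smul, emb_W] at h1
  have := (hasLead_mono s 0 0 1 0 0 0).unique
    (h1 ▸ HasLead.smul s (hasLead_mono s 0 0 0 0 r t) hc)
  exact one_ne_zero (vec_inj this).2.2.1

lemma cD_not_unit (y : 𝔻) : cD s * y ≠ 1 := fun h ↦ by
  obtain ⟨c, r, t, hc, h⟩ := exists_eq_smul_W s h
  have h1 := congrArg (emb s) h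
  rw [emb_cD, map_smul, emb_W] at h1
  have := (hasLead_mono s 0 0 0 1 0 0).unique
    (h1 ▸ HasLead.smul s (hasLead_mono s 0 0 0 0 r t) hc)
  exact one_ne_zero (vec_inj this).2.2.2.1

/-- The ideal generated by a normal element consists of its multiples. -/
lemma exists_eq_mul_of_mem_span {A : Type*} [Ring A] {x : A} (hx : ∀ r, ∃ r', x * r = r' * x)
    {y : A} (hy : y ∈ TwoSidedIdeal.span {x}) : ∃ u, y = u * x := by
  induction hy using TwoSidedIdeal.span_induction with
  | mem y hy => exact ⟨1, by rw [Set.mem_singleton_iff.1 hy, one_mul]⟩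
  | zero => exact ⟨0, by simp⟩
  | add y z _ _ hy hz =>
    obtain ⟨u, rfl⟩ := hy
    obtain ⟨v, rfl⟩ := hz
    exact ⟨u + v, (add_mul _ _ _).symm⟩
  | neg y _ hy =>
    obtain ⟨u, rfl⟩ := hy
    exact ⟨-u, (neg_mul _ _).symm⟩
  | left_absorb a y _ hy =>
    obtain ⟨u, rfl⟩ := hy
    exact ⟨a * u, (mul_assoc _ _ _).symm⟩
  | right_absorb b y _ hy =>
    obtain ⟨u, rfl⟩ := hy
    obtain ⟨b', hb⟩ := hx b
    exact ⟨u * b', by rw [mul_assoc, hb, mul_assoc]⟩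

lemma theta_normal (i : Bool) (r : 𝔻) : ∃ r', theta s i * r = r' * theta s i := by
  cases i
  · exact phiD_normal s r
  · exact psiD_normal s r

lemma theta_ne_zero (i : Bool) : theta s i ≠ 0 := by
  cases i
  · exact phiD_ne_zero s
  · exact psiD_ne_zero s

lemma theta_not_notMem (i : Bool) : theta s (!i) ∉ TwoSidedIdeal.span {theta s i} := by
  cases i
  · exact psiD_notMem s
  · exact phiD_notMem s

lemma isPrimeIdeal_theta (i : Bool) : IsPrimeIdeal (TwoSidedIdeal.span {theta s i}) := by
  cases i
  · exact isPrimeIdeal_phi s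
  · exact isPrimeIdeal_psi s

/-- The preimage of a nonzero prime under `ρ` is again a nonzero prime, hence contains `φ` or `ψ`.
-/
lemma map_theta_mem_or (ρ : 𝔻 ≃ₐ[k] 𝔻) (i j : Bool) :
    ρ (theta s j) ∈ TwoSidedIdeal.span {theta s i} ∨
      ρ (theta s (!j)) ∈ TwoSidedIdeal.span {theta s i} := by
  set P := (TwoSidedIdeal.span {theta s i}).comap ρ
  have hP : IsPrimeIdeal P := by
    obtain ⟨h1, h2⟩ := isPrimeIdeal_theta s i
    constructor
    · intro h
      apply h1
      rw [← TwoSidedIdeal.one_mem_iff] at h ⊢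
      simpa [P, TwoSidedIdeal.mem_comap] using h
    · intro x y hxy
      simp only [P, TwoSidedIdeal.mem_comap] at hxy ⊢
      refine h2 _ _ fun r ↦ ?_
      have := hxy (ρ.symm r)
      rwa [map_mul, map_mul, AlgEquiv.apply_symm_apply] at this
  have hP0 : P ≠ ⊥ := by
    intro h
    have h1 : ρ.symm (theta s i) ∈ P := by
      rw [TwoSidedIdeal.mem_comap, AlgEquiv.apply_symm_apply]
      exact TwoSidedIdeal.subset_span rfl
    rw [h, TwoSidedIdeal.mem_bot] at h1
    exact theta_ne_zero s i ((map_eq_zero_iff _ ρ.symm.injective).1 h1)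
  have h := span_le_of_isPrimeIdeal s P hP hP0
  simp only [TwoSidedIdeal.span_le, Set.singleton_subset_iff, SetLike.mem_coe, P,
    TwoSidedIdeal.mem_comap] at h
  cases j
  · exact h
  · exact h.symm

/-- If an automorphism maps `θ_j` into `(θ_i)`, it maps `θ_j` to a unit multiple of `θ_i`. -/
lemma exists_unit_of_map_theta_mem (ρ : 𝔻 ≃ₐ[k] 𝔻) {i j : Bool}
    (h : ρ (theta s j) ∈ TwoSidedIdeal.span {theta s i}) :
    ∃ (c : k) (r t : ℤ), c ≠ 0 ∧ ρ (theta s j) = c • (W s r t * theta s i) := by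
  have := noZeroDivisors_D s
  obtain ⟨u, hu⟩ := exists_eq_mul_of_mem_span (theta_normal s i) h
  -- Apply the dichotomy to `ρ.symm`. Either `θ_i` returns to `(θ_j)`, which inverts `u`, or the
  -- other normal element would lie in `(θ_i)`.
  obtain ⟨v, hv⟩ : ∃ v, v * u = 1 := by
    rcases map_theta_mem_or s ρ.symm j i with h1 | h1
    · obtain ⟨v, hv⟩ := exists_eq_mul_of_mem_span (theta_normal s j) h1
      refine ⟨ρ v, ?_⟩
      have h2 := congrArg ρ hv
      rw [AlgEquiv.apply_symm_apply, map_mul, hu, ← mul_assoc] at h2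
      exact mul_right_cancel₀ (theta_ne_zero s i) (by rw [one_mul]; exact h2.symm)
    · obtain ⟨v, hv⟩ := exists_eq_mul_of_mem_span (theta_normal s j) h1
      have h2 := congrArg ρ hv
      rw [AlgEquiv.apply_symm_apply, map_mul, hu, ← mul_assoc] at h2
      exact (theta_not_notMem s i (h2 ▸ TwoSidedIdeal.mul_mem_left _ _ _
        (TwoSidedIdeal.subset_span rfl))).elim
  have hv' : u * v = 1 := by
    have hu0 : u ≠ 0 := by
      rintro rfl
      rw [mul_zero] at hv
      have := congrArg (emb s) hv
      simp at this
    exact mul_right_cancel₀ hu0 (by rw [mul_assoc, hv, mul_one, one_mul])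
  obtain ⟨c, r, t, hc, rfl⟩ := exists_eq_smul_W s hv'
  exact ⟨c, r, t, hc, by rw [hu, smul_mul_assoc]⟩

/-- Both `θ_i` and the image of `θ_j` commute with the torus, so the unit between them is central in
the torus. As `s` is not a root of unity, it is a scalar. -/
lemma exists_smul_of_map_theta_mem {ρ : 𝔻 ≃ₐ[k] 𝔻} (hρ : ∀ r t, ρ (W s r t) = W s r t) {i j : Bool}
    (h : ρ (theta s j) ∈ TwoSidedIdeal.span {theta s i}) :
    ∃ c : k, c ≠ 0 ∧ ρ (theta s j) = c • theta s i := by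
  have := noZeroDivisors_D s
  obtain ⟨c, r, t, hc, h⟩ := exists_unit_of_map_theta_mem s ρ h
  have hcomm : ∀ r' t', W s r t * W s r' t' = W s r' t' * W s r t := by
    intro r' t'
    have h1 := congrArg ρ (theta_W s j r' t')
    rw [map_mul, map_mul, hρ, h, smul_mul_assoc, mul_smul_comm] at h1
    have h2 := smul_right_injective 𝔻 hc h1
    rw [mul_assoc, theta_W, ← mul_assoc, ← mul_assoc] at h2
    exact mul_right_cancel₀ (theta_ne_zero s i) h2
  have hpow : ∀ r' t', t * r' - r * t' = t' * r - r' * t := by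
    intro r' t'
    have h1 := hcomm r' t'
    rw [W_mul, W_mul, add_comm r', add_comm t'] at h1
    exact Generic.zpow_inj s (smul_W_inj s (zpow_ne_zero _ s.ne_zero) h1).1
  have h1 := hpow 1 0
  have h2 := hpow 0 1
  obtain rfl : r = 0 := by omega
  obtain rfl : t = 0 := by omega
  exact ⟨c, hc, by rw [h, W_zero, one_mul]⟩

lemma map_theta {ρ : 𝔻 ≃ₐ[k] 𝔻} (hρ : ∀ r t, ρ (W s r t) = W s r t) :
    ∃ (i : Bool) (c c' : k), c ≠ 0 ∧ c' ≠ 0 ∧ ρ (phiD s) = c • theta s i ∧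
    ρ (psiD s) = c' • theta s (!i) := by
  -- The two images cannot lie in the same ideal, since a scalar multiple of one normal element is
  -- not in the ideal of the other.
  have key : ∀ (i j : Bool), ρ (theta s j) ∈ TwoSidedIdeal.span {theta s i} →
      ρ (theta s (!j)) ∈ TwoSidedIdeal.span {theta s (!i)} := by
    intro i j h
    rcases map_theta_mem_or s ρ (!i) j with h1 | h1
    · obtain ⟨c, hc, h2⟩ := exists_smul_of_map_theta_mem s hρ h
      rw [h2, smul_mem_iff hc] at h1
      have := theta_not_notMem s (!i)
      rw [Bool.not_not] at this
      exact (this h1).elim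
    · exact h1
  obtain ⟨i, hi⟩ : ∃ i, ρ (theta s false) ∈ TwoSidedIdeal.span {theta s i} := by
    rcases map_theta_mem_or s ρ false false with h | h
    · exact ⟨_, h⟩
    · exact ⟨_, key _ _ h⟩
  obtain ⟨c, hc, h⟩ := exists_smul_of_map_theta_mem s hρ hi
  obtain ⟨c', hc', h'⟩ := exists_smul_of_map_theta_mem s hρ (key _ _ hi)
  exact ⟨i, c, c', hc, hc', h, h'⟩

/-- The exponents of an element that commutes with the torus and has given weights. -/
lemma eq_of_weights {y : 𝔻} {p p' : ℤ} (hW : ∀ r t, y * W s r t = W s r t * y)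
    (hφ : y * phiD s = (s : k) ^ (4 * p) • (phiD s * y))
    (hψ : y * psiD s = (s : k) ^ (4 * p') • (psiD s * y)) {n m i l r t : ℤ}
    (h : coeff (vec n m i l r t) (emb s y) ≠ 0) : i = p ∧ l = -p' ∧ r = 0 ∧ t = 0 := by
  have key : ∀ (g : 𝔻) (n' m' i' l' r' t' c : ℤ), emb s g = mono s n' m' i' l' r' t' →
      y * g = (s : k) ^ c • (g * y) →
      omega (vec n m i l r t) (vec n' m' i' l' r' t') -
        omega (vec n' m' i' l' r' t') (vec n m i l r t) = c := by
    intro g n' m' i' l' r' t' c hg hyg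
    have h1 := congrArg (emb s) hyg
    rw [map_mul, map_smul, map_mul, hg] at h1
    exact Generic.zpow_inj s (zpow_eq_of_mul_single_eq h1 h)
  have h1 := key _ _ _ _ _ _ _ _ (emb_phiD s) hφ
  have h2 := key _ _ _ _ _ _ _ _ (emb_psiD s) hψ
  have h3 := key _ _ _ _ _ _ _ 0 (emb_W s 1 0) (by rw [zpow_zero, one_smul, hW])
  have h4 := key _ _ _ _ _ _ _ 0 (emb_W s 0 1) (by rw [zpow_zero, one_smul, hW])
  simp only [omega_vec] at h1 h2 h3 h4
  omega

/-- The leading exponent of an element that commutes with the torus and has given weights. -/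
lemma exists_hasLead_of_weights {y : 𝔻} (hy : y ≠ 0) {p p' : ℤ}
    (hW : ∀ r t, y * W s r t = W s r t * y)
    (hφ : y * phiD s = (s : k) ^ (4 * p) • (phiD s * y))
    (hψ : y * psiD s = (s : k) ^ (4 * p') • (psiD s * y)) : ∃ n m : ℤ, 0 ≤ n ∧ 0 ≤ m ∧
      0 ≤ n + p ∧ 0 ≤ m - p' ∧ HasLead (emb s y) (vec n m p (-p') 0 0) := by
  obtain ⟨r, t, i, j, l, m, h⟩ := exists_hasLead_emb s hy
  obtain ⟨h1, h2, rfl, rfl⟩ := eq_of_weights s hW hφ hψ h.1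
  refine ⟨j, m, by omega, by omega, by omega, by omega, ?_⟩
  rw [← h1, ← h2]
  exact h

lemma hasLead_one_sub_phi {c : k} (hc : c ≠ 0) :
    HasLead (emb s (1 - c • phiD s)) (vec 1 0 0 0 0 0) := by
  have h := (HasLead.smul s (hasLead_mono s 1 0 0 0 0 0) (neg_ne_zero.2 hc)).of_add_lt
    (hasLead_mono s 0 0 0 0 0 0) (vec_lt_of_lt one_pos)
  rwa [neg_smul, neg_add_eq_sub, mono_zero, ← emb_phiD, ← map_smul, ← map_one (emb s),
    ← map_sub] at h

lemma hasLead_one_sub_psi {c : k} (hc : c ≠ 0) :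
    HasLead (emb s (1 - c • psiD s)) (vec 0 1 0 0 0 0) := by
  have h := (HasLead.smul s (hasLead_mono s 0 1 0 0 0 0) (neg_ne_zero.2 hc)).of_add_lt
    (hasLead_mono s 0 0 0 0 0 0) (vec_lt_of_lt' one_pos)
  rwa [neg_smul, neg_add_eq_sub, mono_zero, ← emb_psiD, ← map_smul, ← map_one (emb s),
    ← map_sub] at h

end

open TwistedAlg

/-! ### Classification of the automorphisms -/

section

variable {k : Type*} [Field k] (s : kˣ)

local notation "𝔻" => D k (s ^ 2)

/-- Weights are transported by automorphisms. -/
lemma map_weight {ρ : 𝔻 ≃ₐ[k] 𝔻} {y z z' : 𝔻} {c a : k} (hc : c ≠ 0) (hz : ρ z = c • z')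
    (h : y * z = a • (z * y)) : ρ y * z' = a • (z' * ρ y) := by
  have h1 := congrArg ρ h
  rw [map_mul, map_smul, map_mul, hz, mul_smul_comm, smul_mul_assoc, smul_comm] at h1
  exact smul_right_injective 𝔻 hc h1

lemma weight_zero {y z : 𝔻} (h : y * z = z * y) : y * z = (s : k) ^ (4 * 0 : ℤ) • (z * y) := by
  rw [mul_zero, zpow_zero, one_smul, h]

variable [Generic s]

/-- An automorphism that fixes the torus and `φ`, `ψ` up to scalars rescales `b`. -/
lemma exists_map_bD_eq_smul {ρ : 𝔻 ≃ₐ[k] 𝔻} (hρ : ∀ r t, ρ (W s r t) = W s r t) {c c' : k}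
    (hc : c ≠ 0) (hc' : c' ≠ 0) (hφ : ρ (phiD s) = c • phiD s) (hψ : ρ (psiD s) = c' • psiD s) :
    ∃ a : kˣ, ρ (bD s) = (a : k) • bD s ∧ ρ (fD s) = (a : k)⁻¹ • fD s := by
  have := noZeroDivisors_D s
  have hbf : bD s * fD s = 1 - phiD s := (datumD s).bf
  have hmul : ρ (bD s) * ρ (fD s) = 1 - c • phiD s := by
    rw [← map_mul, hbf, map_sub, map_one, hφ]
  have hlead := hasLead_one_sub_phi s hc
  rw [← hmul] at hlead
  have hb0 : ρ (bD s) ≠ 0 := fun h ↦ hlead.ne_zero (by rw [h, zero_mul, map_zero])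
  have hf0 : ρ (fD s) ≠ 0 := fun h ↦ hlead.ne_zero (by rw [h, mul_zero, map_zero])
  have hbW : ∀ r t, ρ (bD s) * W s r t = W s r t * ρ (bD s) := fun r t ↦ by
    rw [← hρ r t, ← map_mul, ← map_mul]; exact congrArg ρ ((datumD s).b_w r t)
  have hfW : ∀ r t, ρ (fD s) * W s r t = W s r t * ρ (fD s) := fun r t ↦ by
    rw [← hρ r t, ← map_mul, ← map_mul]; exact congrArg ρ ((datumD s).f_w r t)
  have hbφ : ρ (bD s) * phiD s = (s : k) ^ (4 * 1 : ℤ) • (phiD s * ρ (bD s)) :=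
    map_weight s hc hφ (datumD s).b_phi
  have hbψ : ρ (bD s) * psiD s = (s : k) ^ (4 * 0 : ℤ) • (psiD s * ρ (bD s)) :=
    map_weight s hc' hψ (weight_zero s (datumD s).b_psi)
  have hfφ : ρ (fD s) * phiD s = (s : k) ^ (4 * -1 : ℤ) • (phiD s * ρ (fD s)) :=
    map_weight s hc hφ (datumD s).f_phi
  have hfψ : ρ (fD s) * psiD s = (s : k) ^ (4 * 0 : ℤ) • (psiD s * ρ (fD s)) :=
    map_weight s hc' hψ (weight_zero s (datumD s).f_psi)
  obtain ⟨n, m, hn, hm, -, -, hl⟩ := exists_hasLead_of_weights s hb0 hbW hbφ hbψ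
  obtain ⟨n', m', hn', hm', hnp, -, hl'⟩ := exists_hasLead_of_weights s hf0 hfW hfφ hfψ
  have hsum := (map_mul (emb s) (ρ (bD s)) (ρ (fD s)) ▸ hlead).unique (hl.mul hl')
  rw [vec_add] at hsum
  obtain ⟨e1, e2, -⟩ := vec_inj hsum
  -- The weight of the image of `f` forces `φ`-exponent at least 1 in its leading term. The product
  -- `1 - c φ` has only one `φ`, so none is left for the image of `b`.
  obtain rfl : n = 0 := by omega
  obtain rfl : m = 0 := by omega
  have hmono : emb s (ρ (bD s)) =
      single (vec 0 0 1 (-0) 0 0) (coeff (vec 0 0 1 (-0) 0 0) (emb s (ρ (bD s)))) := by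
    -- Weights fix every exponent except those of `φ` and `ψ`. These are nonnegative and bounded by
    -- the leading ones, which are 0.
    refine eq_single fun v hv ↦ ?_
    obtain ⟨n, m, i, l, r, t, rfl⟩ := exists_vec v
    obtain ⟨hn, hm⟩ := nonneg_of_coeff_emb_ne_zero s _ hv
    obtain ⟨rfl, rfl, rfl, rfl⟩ := eq_of_weights s hbW hbφ hbψ hv
    have hle := hl.2 _ hv
    obtain rfl : n = 0 := by
      by_contra hne
      exact hle.not_gt (vec_lt_of_lt (lt_of_le_of_ne hn (Ne.symm hne)))
    obtain rfl : m = 0 := by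
      by_contra hne
      exact hle.not_gt (vec_lt_of_lt' (lt_of_le_of_ne hm (Ne.symm hne)))
    rfl
  have hb : ρ (bD s) = coeff (vec 0 0 1 (-0) 0 0) (emb s (ρ (bD s))) • bD s := by
    apply emb_injective s
    rw [map_smul, emb_bD, mono, smul_single, mul_one]
    exact hmono
  set a := coeff (vec 0 0 1 (-0) 0 0) (emb s (ρ (bD s)))
  have ha : a ≠ 0 := hl.1
  have hdiff : bD s * (a • ρ (fD s) - fD s) = (1 - c) • phiD s := by
    rw [mul_sub, mul_smul_comm, ← smul_mul_assoc, ← hb, hmul, hbf]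
    module
  -- Otherwise `φ` would be a right multiple `b y`, and `1 = b f + φ` would make `b` a unit.
  have hc1 : c = 1 := by
    by_contra hne
    have h1 : 1 - c ≠ 0 := sub_ne_zero.2 (Ne.symm hne)
    apply bD_not_unit s (fD s + (1 - c)⁻¹ • (a • ρ (fD s) - fD s))
    rw [mul_add, mul_smul_comm, hdiff, smul_smul, inv_mul_cancel₀ h1, one_smul, hbf,
      sub_add_cancel]
  rw [hc1, sub_self, zero_smul] at hdiff
  have h0 := (mul_eq_zero.1 hdiff).resolve_left (bD_ne_zero s)
  refine ⟨Units.mk0 a ha, hb, ?_⟩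
  rw [eq_inv_smul_iff₀ (Units.ne_zero _)]
  exact sub_eq_zero.1 h0

/-- An automorphism that fixes the torus and `φ`, `ψ` up to scalars rescales `c`. -/
lemma exists_map_cD_eq_smul {ρ : 𝔻 ≃ₐ[k] 𝔻} (hρ : ∀ r t, ρ (W s r t) = W s r t) {c c' : k}
    (hc : c ≠ 0) (hc' : c' ≠ 0) (hφ : ρ (phiD s) = c • phiD s) (hψ : ρ (psiD s) = c' • psiD s) :
    ∃ a : kˣ, ρ (cD s) = (a : k) • cD s ∧ ρ (eD s) = (a : k)⁻¹ • eD s := by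
  have := noZeroDivisors_D s
  have hce : cD s * eD s = 1 - psiD s := (datumD s).ce
  have hmul : ρ (cD s) * ρ (eD s) = 1 - c' • psiD s := by
    rw [← map_mul, hce, map_sub, map_one, hψ]
  have hlead := hasLead_one_sub_psi s hc'
  rw [← hmul] at hlead
  have hc0 : ρ (cD s) ≠ 0 := fun h ↦ hlead.ne_zero (by rw [h, zero_mul, map_zero])
  have he0 : ρ (eD s) ≠ 0 := fun h ↦ hlead.ne_zero (by rw [h, mul_zero, map_zero])
  have hcW : ∀ r t, ρ (cD s) * W s r t = W s r t * ρ (cD s) := fun r t ↦ by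
    rw [← hρ r t, ← map_mul, ← map_mul]; exact congrArg ρ ((datumD s).c_w r t)
  have heW : ∀ r t, ρ (eD s) * W s r t = W s r t * ρ (eD s) := fun r t ↦ by
    rw [← hρ r t, ← map_mul, ← map_mul]; exact congrArg ρ ((datumD s).e_w r t)
  have hcφ : ρ (cD s) * phiD s = (s : k) ^ (4 * 0 : ℤ) • (phiD s * ρ (cD s)) :=
    map_weight s hc hφ (weight_zero s (datumD s).c_phi)
  have hcψ : ρ (cD s) * psiD s = (s : k) ^ (4 * -1 : ℤ) • (psiD s * ρ (cD s)) :=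
    map_weight s hc' hψ (datumD s).c_psi
  have heφ : ρ (eD s) * phiD s = (s : k) ^ (4 * 0 : ℤ) • (phiD s * ρ (eD s)) :=
    map_weight s hc hφ (weight_zero s (datumD s).e_phi)
  have heψ : ρ (eD s) * psiD s = (s : k) ^ (4 * 1 : ℤ) • (psiD s * ρ (eD s)) :=
    map_weight s hc' hψ (datumD s).e_psi
  obtain ⟨n, m, hn, hm, -, -, hl⟩ := exists_hasLead_of_weights s hc0 hcW hcφ hcψ
  obtain ⟨n', m', hn', hm', -, hmp, hl'⟩ := exists_hasLead_of_weights s he0 heW heφ heψ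
  have hsum := (map_mul (emb s) (ρ (cD s)) (ρ (eD s)) ▸ hlead).unique (hl.mul hl')
  rw [vec_add] at hsum
  obtain ⟨e1, e2, -⟩ := vec_inj hsum
  obtain rfl : n = 0 := by omega
  obtain rfl : m = 0 := by omega
  have hmono : emb s (ρ (cD s)) =
      single (vec 0 0 0 (- -1) 0 0) (coeff (vec 0 0 0 (- -1) 0 0) (emb s (ρ (cD s)))) := by
    refine eq_single fun v hv ↦ ?_
    obtain ⟨n, m, i, l, r, t, rfl⟩ := exists_vec v
    obtain ⟨hn, hm⟩ := nonneg_of_coeff_emb_ne_zero s _ hv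
    obtain ⟨rfl, rfl, rfl, rfl⟩ := eq_of_weights s hcW hcφ hcψ hv
    have hle := hl.2 _ hv
    obtain rfl : n = 0 := by
      by_contra hne
      exact hle.not_gt (vec_lt_of_lt (lt_of_le_of_ne hn (Ne.symm hne)))
    obtain rfl : m = 0 := by
      by_contra hne
      exact hle.not_gt (vec_lt_of_lt' (lt_of_le_of_ne hm (Ne.symm hne)))
    rfl
  have hb : ρ (cD s) = coeff (vec 0 0 0 (- -1) 0 0) (emb s (ρ (cD s))) • cD s := by
    apply emb_injective s
    rw [map_smul, emb_cD, mono, smul_single, mul_one]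
    exact hmono
  set a := coeff (vec 0 0 0 (- -1) 0 0) (emb s (ρ (cD s)))
  have ha : a ≠ 0 := hl.1
  have hdiff : cD s * (a • ρ (eD s) - eD s) = (1 - c') • psiD s := by
    rw [mul_sub, mul_smul_comm, ← smul_mul_assoc, ← hb, hmul, hce]
    module
  have hc1 : c' = 1 := by
    by_contra hne
    have h1 : 1 - c' ≠ 0 := sub_ne_zero.2 (Ne.symm hne)
    apply cD_not_unit s (eD s + (1 - c')⁻¹ • (a • ρ (eD s) - eD s))
    rw [mul_add, mul_smul_comm, hdiff, smul_smul, inv_mul_cancel₀ h1, one_smul, hce,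
      sub_add_cancel]
  rw [hc1, sub_self, zero_smul] at hdiff
  have h0 := (mul_eq_zero.1 hdiff).resolve_left (cD_ne_zero s)
  refine ⟨Units.mk0 a ha, hb, ?_⟩
  rw [eq_inv_smul_iff₀ (Units.ne_zero _)]
  exact sub_eq_zero.1 h0

/-- No automorphism that fixes the torus interchanges `φ` and `ψ` up to scalars. -/
lemma not_swap {ρ : 𝔻 ≃ₐ[k] 𝔻} (hρ : ∀ r t, ρ (W s r t) = W s r t) {c c' : k}
    (hc : c ≠ 0) (hc' : c' ≠ 0) (hφ : ρ (phiD s) = c • psiD s) (hψ : ρ (psiD s) = c' • phiD s) :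
    False := by
  have hbf : bD s * fD s = 1 - phiD s := (datumD s).bf
  have hce : cD s * eD s = 1 - psiD s := (datumD s).ce
  have hlead := hasLead_one_sub_psi s hc
  have hlead' := hasLead_one_sub_phi s hc'
  have hmul : ρ (bD s) * ρ (fD s) = 1 - c • psiD s := by
    rw [← map_mul, hbf, map_sub, map_one, hφ]
  have hmul' : ρ (cD s) * ρ (eD s) = 1 - c' • phiD s := by
    rw [← map_mul, hce, map_sub, map_one, hψ]
  rw [← hmul] at hlead
  rw [← hmul'] at hlead'
  have hb0 : ρ (bD s) ≠ 0 := fun h ↦ hlead.ne_zero (by rw [h, zero_mul, map_zero])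
  have hf0 : ρ (fD s) ≠ 0 := fun h ↦ hlead.ne_zero (by rw [h, mul_zero, map_zero])
  have hc0 : ρ (cD s) ≠ 0 := fun h ↦ hlead'.ne_zero (by rw [h, zero_mul, map_zero])
  have he0 : ρ (eD s) ≠ 0 := fun h ↦ hlead'.ne_zero (by rw [h, mul_zero, map_zero])
  have hW : ∀ {y : 𝔻}, (∀ r t, y * W s r t = W s r t * y) →
      ∀ r t, ρ y * W s r t = W s r t * ρ y := fun h r t ↦ by
    rw [← hρ r t, ← map_mul, ← map_mul]; exact congrArg ρ (h r t)
  obtain ⟨n, m, hn, hm, -, hmp, hl⟩ := exists_hasLead_of_weights s (p := 0) (p' := 1) hb0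
    (hW (datumD s).b_w) (map_weight s hc' hψ (weight_zero s (datumD s).b_psi))
    (map_weight s hc hφ (datumD s).b_phi)
  obtain ⟨n₁, m₁, hn₁, hm₁, -, -, hl₁⟩ := exists_hasLead_of_weights s (p := 0) (p' := -1) hf0
    (hW (datumD s).f_w) (map_weight s hc' hψ (weight_zero s (datumD s).f_psi))
    (map_weight s hc hφ (by exact (datumD s).f_phi))
  obtain ⟨n', m', hn', hm', hnp', -, hl'⟩ := exists_hasLead_of_weights s (p := -1) (p' := 0) hc0
    (hW (datumD s).c_w) (map_weight s hc' hψ (by exact (datumD s).c_psi))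
    (map_weight s hc hφ (weight_zero s (datumD s).c_phi))
  obtain ⟨n₂, m₂, hn₂, hm₂, -, -, hl₂⟩ := exists_hasLead_of_weights s (p := 1) (p' := 0) he0
    (hW (datumD s).e_w) (map_weight s hc' hψ (datumD s).e_psi)
    (map_weight s hc hφ (weight_zero s (datumD s).e_phi))
  have hsum := (map_mul (emb s) (ρ (bD s)) (ρ (fD s)) ▸ hlead).unique (hl.mul hl₁)
  have hsum' := (map_mul (emb s) (ρ (cD s)) (ρ (eD s)) ▸ hlead').unique (hl'.mul hl₂)
  rw [vec_add] at hsum hsum'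
  obtain ⟨e1, e2, -⟩ := vec_inj hsum
  obtain ⟨e1', e2', -⟩ := vec_inj hsum'
  obtain rfl : n = 0 := by omega
  obtain rfl : m = 1 := by omega
  obtain rfl : n' = 1 := by omega
  obtain rfl : m' = 0 := by omega
  have hbc : ρ (bD s) * ρ (cD s) = (s : k) ^ (4 : ℤ) • (ρ (cD s) * ρ (bD s)) := by
    rw [← map_mul, ← map_mul, ← map_smul]
    exact congrArg ρ (datumD s).b_c
  -- A swap would give the images of `b` and `c` the leading exponents of `ψ c⁻¹` and `φ b⁻¹`. These
  -- monomials commute with the factor `s ^ (-4)`, whereas `b` and `c` require `s ^ 4`.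
  have h1 := congrArg (coeff (vec 0 1 0 (-1) 0 0 + vec 1 0 (-1) (-0) 0 0)) (congrArg (emb s) hbc)
  rw [map_mul, hl.coeff_mul hl', map_smul, map_mul, map_smul, add_comm, hl'.coeff_mul hl,
    smul_eq_mul, omega_vec, omega_vec, mul_assoc, mul_assoc, mul_comm (coeff _ (emb s (ρ (cD s)))),
    ← mul_assoc ((s : k) ^ (4 : ℤ)), ← zpow_add₀ s.ne_zero] at h1
  have h2 := Generic.zpow_inj s (mul_right_cancel₀ (mul_ne_zero hl.1 hl'.1) h1)
  omega

/-- An automorphism that fixes the torus is diagonal. -/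
lemma exists_eq_diagAut {ρ : 𝔻 ≃ₐ[k] 𝔻} (hρ : ∀ r t, ρ (W s r t) = W s r t) :
    ∃ u, ρ = diagAut s u := by
  obtain ⟨i, c, c', hc, hc', hφ, hψ⟩ := map_theta s hρ
  cases i with
  | true => exact (not_swap s hρ hc hc' hφ hψ).elim
  | false =>
    obtain ⟨x, hb, hf⟩ := exists_map_bD_eq_smul s hρ hc hc' hφ hψ
    obtain ⟨y, hc, he⟩ := exists_map_cD_eq_smul s hρ hc hc' hφ hψ
    refine ⟨(1, 1, x⁻¹, y⁻¹), algEquiv_ext' s (fun r t ↦ ?_) ?_ ?_ ?_ ?_⟩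
    · rw [hρ, diagAut_W]; simp
    · rw [hb, diagAut_bD]; simp
    · rw [hf, diagAut_fD]; simp
    · rw [hc, diagAut_cD]; simp
    · rw [he, diagAut_eD]; simp

/-- Every automorphism of `D_q` is a product of one from `SL₂(ℤ)` and a diagonal one. -/
theorem exists_eq_slAut_mul_diagAut (ρ : 𝔻 ≃ₐ[k] 𝔻) : ∃ g u, ρ = slAut s g * diagAut s u := by
  have hunit : ∀ r t, ∃ (c : k) (r' t' : ℤ), c ≠ 0 ∧ ρ (W s r t) = c • W s r' t' := fun r t ↦
    exists_eq_smul_W s (v := ρ (W s (-r) (-t))) (by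
      rw [← map_mul]
      exact (congrArg ρ ((datumD s).w_mul_w_neg r t)).trans (map_one ρ))
  obtain ⟨a, i, j, ha, hK⟩ := hunit 1 0
  obtain ⟨b, m, n, hb, hA⟩ := hunit 0 1
  have hdet : i * n - m * j = 1 := by
    have h1 : W s 0 1 * W s 1 0 = (s : k) ^ (2 : ℤ) • (W s 1 0 * W s 0 1) := by
      rw [W_mul, W_mul, smul_smul, ← zpow_add₀ s.ne_zero]
      norm_num
    have h2 := congrArg ρ h1
    rw [map_mul, map_smul, map_mul, hK, hA, smul_mul_smul_comm, smul_mul_smul_comm, mul_comm b a,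
      smul_comm] at h2
    have h3 := smul_right_injective 𝔻 (mul_ne_zero ha hb) h2
    simp only [W_mul, smul_smul, ← zpow_add₀ s.ne_zero, add_comm m i, add_comm n j] at h3
    have h4 := Generic.zpow_inj s (smul_W_inj s (zpow_ne_zero _ s.ne_zero) h3).1
    linarith [mul_comm n i, mul_comm j m]
  -- The exponents of the images of `K` and `a` are the columns of `g`, since `slDatum` acts on
  -- column vectors; `IsRho` has them as rows.
  let g : SL(2, ℤ) := ⟨!![i, m; j, n], by rw [Matrix.det_fin_two_of]; exact hdet⟩
  let u : Torus k := (Units.mk0 a ha, Units.mk0 b hb, 1, 1)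
  set τ := slAut s g * diagAut s u with hτ
  have h1 : τ (W s 1 0) = ρ (W s 1 0) := by
    rw [hK, hτ, AlgEquiv.mul_apply, diagAut_W, map_smul, slAut_W]
    simp [g, u]
  have h2 : τ (W s 0 1) = ρ (W s 0 1) := by
    rw [hA, hτ, AlgEquiv.mul_apply, diagAut_W, map_smul, slAut_W]
    simp [g, u]
  have h3 : ∀ r t, (τ⁻¹ * ρ) (W s r t) = W s r t := by
    refine map_W (datumD s) ((τ⁻¹ * ρ : 𝔻 ≃ₐ[k] 𝔻) : 𝔻 →ₐ[k] 𝔻) ?_ ?_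
    · change τ.symm (ρ (W s 1 0)) = W s 1 0
      rw [← h1, AlgEquiv.symm_apply_apply]
    · change τ.symm (ρ (W s 0 1)) = W s 0 1
      rw [← h2, AlgEquiv.symm_apply_apply]
  obtain ⟨v, hv⟩ := exists_eq_diagAut s h3
  refine ⟨g, u * v, ?_⟩
  rw [map_mul, ← mul_assoc, ← hτ, ← hv, mul_inv_cancel_left]

/-- The values at `K` and `a` determine the matrix and the first two coordinates; those at `bD` and
`cD` then determine the other two. -/
lemma slAut_mul_diagAut_inj {g g' : SL(2, ℤ)} {u u' : Torus k}
    (h : slAut s g * diagAut s u = slAut s g' * diagAut s u') : g = g' ∧ u = u' := by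
  have hW : ∀ r t, _ := fun r t ↦ DFunLike.congr_fun h (W s r t)
  have hb := DFunLike.congr_fun h (bD s)
  have hc := DFunLike.congr_fun h (cD s)
  simp only [AlgEquiv.mul_apply, diagAut_W, map_smul, slAut_W, diagAut_bD, slAut_bD, diagAut_cD,
    slAut_cD] at hW hb hc
  obtain ⟨h1, h2, h3⟩ := smul_W_inj s (Units.ne_zero _) (hW 1 0)
  obtain ⟨h4, h5, h6⟩ := smul_W_inj s (Units.ne_zero _) (hW 0 1)
  have h7 := smul_left_injective k (bD_ne_zero s) hb
  have h8 := smul_left_injective k (cD_ne_zero s) hc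
  obtain ⟨u₁, u₂, u₃, u₄⟩ := u
  obtain ⟨u₁', u₂', u₃', u₄'⟩ := u'
  simp only [zpow_one, zpow_zero, mul_one, one_mul, mul_zero, add_zero, zero_add, Units.val_inj]
    at h1 h2 h3 h4 h5 h6 h7 h8
  subst h1 h4
  have h9 : u₃ = u₃' := by simpa using h7
  have h10 : u₄ = u₄' := by simpa using h8
  subst h9 h10
  refine ⟨?_, rfl⟩
  ext a b
  fin_cases a <;> fin_cases b <;> assumption

end

/-! ### The parameters of `IsRho` and the semidirect product -/

section

/-- If `N` embeds in `H` and `G → H` normalizes its image, then `G` acts on `N` by conjugation. -/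
lemma exists_conj_action {N G H : Type*} [Group N] [Group G] [Group H] {f : N →* H}
    (hf : Function.Injective f) (φ : G →* H) (h : ∀ g n, ∃ n', φ g * f n = f n' * φ g) :
    ∃ θ : G →* MulAut N, ∀ g, f.comp (θ g).toMonoidHom =
      (MulAut.conj (φ g)).toMonoidHom.comp f := by
  choose v hv using h
  have hv' : ∀ g n, f (v g n) = φ g * f n * (φ g)⁻¹ := fun g n ↦ by
    rw [hv, mul_inv_cancel_right]
  have hmul : ∀ g g' n, v g (v g' n) = v (g * g') n := fun g g' n ↦ hf <| by
    simp only [hv', map_mul]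
    group
  have hone : ∀ n, v 1 n = n := fun n ↦ hf <| by simp [hv']
  let θ : G →* MulAut N := MonoidHom.mk' (fun g ↦
    { toFun := v g
      invFun := v g⁻¹
      left_inv := fun n ↦ by rw [hmul, inv_mul_cancel, hone]
      right_inv := fun n ↦ by rw [hmul, mul_inv_cancel, hone]
      map_mul' := fun n n' ↦ hf <| by
        simp only [hv', map_mul]
        group })
    fun g g' ↦ MulEquiv.ext fun n ↦ (hmul g g' n).symm
  exact ⟨θ, fun g ↦ MonoidHom.ext fun n ↦ hv' g n⟩

variable {k : Type*} [Field k]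

/-- The element of the torus by which the parameters of an automorphism from `SL₂(ℤ)` are shifted,
as monomials in `K` and `a` are not symmetrized. -/
def shift (s : kˣ) (g : SL(2, ℤ)) : Torus k :=
  let i := g.1 0 0
  let j := g.1 1 0
  let m := g.1 0 1
  let n := g.1 1 1
  -- The powers of `s` left over when the images of `K`, `a`, `F`, `E` are rewritten in ordered
  -- monomials `KA`. For `F` the exponents are those of `g` applied to `(-1, 2)`.
  (s ^ (i * j), s ^ (m * n), s ^ ((2 * m - i) * (2 * n - j) + 2 * (2 * n - j) - 2),
    s ^ (4 * m * n))

lemma shift_one (s : kˣ) : shift s 1 = 1 := by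
  simp [shift]

variable (s : kˣ)

local notation "𝔻" => D k (s ^ 2)
local notation "X" => x k (s ^ 2)

lemma KA_eq_smul_W (r t : ℤ) : KA k (s ^ 2) r t = (s : k) ^ (-(r * t)) • W s r t := by
  rw [W, smul_smul, ← zpow_add₀ s.ne_zero, neg_add_cancel, zpow_zero, one_smul]

lemma KA_mul_W_mul (r t r' t' : ℤ) (y : 𝔻) : KA k (s ^ 2) r t * (W s r' t' * y) =
    (s : k) ^ (-(r * t) + (t * r' - r * t')) • (W s (r + r') (t + t') * y) := by
  rw [KA_eq_smul_W, smul_mul_assoc, ← mul_assoc, W_mul, smul_mul_assoc, smul_smul,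
    ← zpow_add₀ s.ne_zero]

variable {s} in
-- `IsRho` does not prescribe the images of `a⁻¹` and `K⁻¹`; they follow because automorphisms
-- preserve inverses.
lemma IsRho.unique {ρ τ : 𝔻 ≃ₐ[k] 𝔻} {t : Torus k} {M : SL(2, ℤ)} (hρ : IsRho ρ t M)
    (hτ : IsRho τ t M) : ρ = τ := by
  obtain ⟨h1, h2, h3, h4, h5, h6⟩ := hρ
  obtain ⟨h1', h2', h3', h4', h5', h6'⟩ := hτ
  have hinv : ∀ u : 𝔻ˣ, ρ u = τ u → ρ (u⁻¹ : 𝔻ˣ) = τ (u⁻¹ : 𝔻ˣ) := fun u hu ↦ by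
    have h : Units.map (ρ : 𝔻 →* 𝔻) u = Units.map (τ : 𝔻 →* 𝔻) u := Units.ext hu
    exact congrArg Units.val (congrArg (·⁻¹) h)
  have key : AlgHom.equalizer (ρ : 𝔻 →ₐ[k] 𝔻) (τ : 𝔻 →ₐ[k] 𝔻) = ⊤ := by
    rw [eq_top_iff, ← adjoin_range_x, Algebra.adjoin_le_iff]
    rintro _ ⟨g, rfl⟩
    change ρ (X g) = τ (X g)
    cases g
    · exact h2.trans h2'.symm
    · exact hinv (aUnit k (s ^ 2)) (h2.trans h2'.symm)
    · exact h4.trans h4'.symm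
    · exact h6.trans h6'.symm
    · exact h1.trans h1'.symm
    · exact hinv (KUnit k (s ^ 2)) (h1.trans h1'.symm)
    · exact h5.trans h5'.symm
    · exact h3.trans h3'.symm
  exact AlgEquiv.ext fun z ↦
    (key ▸ Algebra.mem_top : z ∈ AlgHom.equalizer (ρ : 𝔻 →ₐ[k] 𝔻) (τ : 𝔻 →ₐ[k] 𝔻))

variable [Generic s]

lemma isRho_slAut_mul_diagAut (g : SL(2, ℤ)) (u : Torus k) :
    IsRho (slAut s g * diagAut s u) (u * shift s g) g.transpose := by
  have hs := s.ne_zero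
  have hdet := g.2
  rw [Matrix.det_fin_two] at hdet
  obtain ⟨a, b, c, d⟩ := u
  simp only [IsRho, shift, AlgEquiv.mul_apply, x_K, x_a, x_F, x_b, x_E, x_c, map_smul, map_mul,
    diagAut_W, diagAut_bD, diagAut_fD, diagAut_cD, diagAut_eD, slAut_W, slAut_bD, slAut_fD,
    slAut_cD, slAut_eD, Matrix.SpecialLinearGroup.coe_transpose, Matrix.transpose_apply,
    mul_smul_comm, KA_mul_W_mul, smul_mul_assoc, Prod.mk_mul_mk]
  rw [KA_eq_smul_W, KA_eq_smul_W]
  generalize g.1 0 0 = i at *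
  generalize g.1 0 1 = m at *
  generalize g.1 1 0 = j at *
  generalize g.1 1 1 = n at *
  have hsq : ∀ e : ℤ, (s ^ 2) ^ e = s ^ (2 * e) := fun e ↦ by
    rw [zpow_mul]
    rfl
  have hmul : ∀ (v v' : kˣ) (e f : ℤ), v * s ^ e * (v' * s ^ f) = v * v' * s ^ (e + f) :=
    fun v v' e f ↦ by rw [mul_mul_mul_comm, zpow_add]
  have hmul' : ∀ (v : kˣ) (e f : ℤ), v * s ^ e * s ^ f = v * s ^ (e + f) :=
    fun v e f ↦ by rw [mul_assoc, zpow_add]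
  have hinv : ∀ (v : kˣ) (e : ℤ), (v * s ^ e)⁻¹ = v⁻¹ * s ^ (-e) :=
    fun v e ↦ by rw [mul_inv, zpow_neg]
  have hzero : ∀ {v v' : kˣ} {e : ℤ}, v = v' → e = 0 → v = v' * s ^ e := fun hv he ↦ by
    rw [hv, he, zpow_zero, mul_one]
  simp only [smul_comm (Datum.kF s), smul_comm (Datum.kE s), ← Units.val_zpow_eq_zpow_val,
    ← Units.val_inv_eq_inv_val, smul_smul, ← Units.val_mul, hsq, hinv, hmul, hmul']
  have key : ∀ {r t r' t' : ℤ} {v v' : kˣ}, r = r' → t = t' → v = v' →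
      (v : k) • W s r t = (v' : k) • W s r' t' := by
    rintro _ _ _ _ _ _ rfl rfl rfl
    rfl
  have key' : ∀ {r t r' t' : ℤ} {v v' : kˣ} (y : 𝔻), r = r' → t = t' → v = v' →
      (v : k) • (W s r t * y) = (v' : k) • (W s r' t' * y) := by
    rintro _ _ _ _ _ _ y rfl rfl rfl
    rfl
  refine ⟨key (by ring) (by ring) (hzero ?_ ?_), key (by ring) (by ring) (hzero ?_ ?_), ?_,
    key' _ (by ring) (by ring) (hzero ?_ ?_), ?_, key' _ (by ring) (by ring) (hzero ?_ ?_)⟩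
  · simp
  · ring
  · simp
  · ring
  · rw [← mul_assoc (Units.val _) (Units.val _) (Datum.kF s), ← Units.val_mul, hmul', mul_comm,
      mul_comm _ (Datum.kF s), mul_smul, mul_smul]
    refine congrArg _ (key' _ (by ring) (by ring) (hzero ?_ (by ring)))
    ext
    push_cast
    field_simp
  · ext
    push_cast
    field_simp
  · linear_combination (-3) * hdet
  · rw [← mul_assoc (Units.val _) (Units.val _) (Datum.kE s), ← Units.val_mul, hmul', mul_comm,
      mul_comm _ (Datum.kE s), mul_smul, mul_smul]
    refine congrArg _ (key' _ (by ring) (by ring) (hzero ?_ (by ring)))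
    ext
    push_cast
    field_simp
  · ext
    push_cast
    field_simp
  · linear_combination hdet

/-- The conjugation rule for `g⁻¹`, rearranged to move a diagonal factor to the right. -/
lemma exists_slAut_mul_diagAut_eq (g : SL(2, ℤ)) (u : Torus k) :
    ∃ v, diagAut s u * slAut s g = slAut s g * diagAut s v := by
  obtain ⟨v, hv⟩ := exists_slAut_conj s g⁻¹ u
  refine ⟨v, ?_⟩
  rw [map_inv, inv_mul_eq_iff_eq_mul, ← mul_assoc, ← div_eq_mul_inv] at hv
  exact mul_eq_of_eq_div hv

lemma isRho_of_parameters (t : Torus k) (M : SL(2, ℤ)) :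
    IsRho (slAut s M.transpose * diagAut s (t * (shift s M.transpose)⁻¹)) t M := by
  have h := isRho_slAut_mul_diagAut s M.transpose (t * (shift s M.transpose)⁻¹)
  rwa [inv_mul_cancel_right] at h

theorem existsUnique_isRho (t : Torus k) (M : SL(2, ℤ)) : ∃! ρ : 𝔻 ≃ₐ[k] 𝔻, IsRho ρ t M :=
  ⟨_, isRho_of_parameters s t M, fun _ h ↦ h.unique (isRho_of_parameters s t M)⟩

theorem existsUnique_parameters (ρ : 𝔻 ≃ₐ[k] 𝔻) :
    ∃! p : Torus k × SL(2, ℤ), IsRho ρ p.1 p.2 := by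
  obtain ⟨g, u, rfl⟩ := exists_eq_slAut_mul_diagAut s ρ
  refine ⟨(u * shift s g, g.transpose), isRho_slAut_mul_diagAut s g u, ?_⟩
  rintro ⟨t, M⟩ h
  obtain ⟨h1, h2⟩ := slAut_mul_diagAut_inj s (h.unique (isRho_of_parameters s t M))
  subst h1
  rw [h2, inv_mul_cancel_right]
  rfl

lemma diagAut_injective : Function.Injective (diagAut s) := fun u v h ↦
  (slAut_mul_diagAut_inj s (g := 1) (g' := 1) (by rw [h])).2

/-- The automorphism group is a semidirect product. -/
theorem exists_semidirectProduct_mulEquiv :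
    ∃ (θ : SL(2, ℤ) →* MulAut (Torus k)) (e : Torus k ⋊[θ] SL(2, ℤ) ≃* (𝔻 ≃ₐ[k] 𝔻)),
      (∀ t : Torus k, IsRho (e (SemidirectProduct.inl t)) t 1) ∧
      ∀ y, ∃ t : Torus k, IsRho (e y) t y.right.transpose := by
  obtain ⟨θ, hθ⟩ := exists_conj_action (diagAut_injective s) (slAut s) (exists_slAut_conj s)
  let f := SemidirectProduct.lift (diagAut s) (slAut s) hθ
  have hf : ∀ y, f y = diagAut s y.left * slAut s y.right := fun _ ↦ rfl
  have hbij : Function.Bijective f := by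
    refine ⟨(injective_iff_map_eq_one f).2 fun y hy ↦ ?_, fun ρ ↦ ?_⟩
    · obtain ⟨v, hv⟩ := exists_slAut_mul_diagAut_eq s y.right y.left
      have h1 : slAut s y.right * diagAut s v = slAut s 1 * diagAut s 1 := by
        rw [← hv, ← hf, hy, map_one, map_one, mul_one]
      have h2 := (slAut_mul_diagAut_inj s h1).1
      rw [hf, h2, map_one, mul_one] at hy
      exact SemidirectProduct.ext (diagAut_injective s (hy.trans (map_one _).symm)) h2
    · obtain ⟨g, u, rfl⟩ := exists_eq_slAut_mul_diagAut s ρ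
      obtain ⟨v, hv⟩ := exists_slAut_conj s g u
      exact ⟨⟨v, g⟩, (hf _).trans hv.symm⟩
  refine ⟨θ, MulEquiv.ofBijective f hbij, fun t ↦ ?_, fun y ↦ ?_⟩
  · have h := isRho_slAut_mul_diagAut s 1 t
    rw [shift_one, mul_one, map_one, one_mul,
      show Matrix.SpecialLinearGroup.transpose (1 : SL(2, ℤ)) = 1 from
        Subtype.ext Matrix.transpose_one] at h
    simpa [f] using h
  · obtain ⟨v, hv⟩ := exists_slAut_mul_diagAut_eq s y.right y.left
    have h := isRho_slAut_mul_diagAut s y.right v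
    rw [← hv] at h
    exact ⟨_, h⟩

/-- No automorphism maps `(φ)` to `(ψ)`. -/
theorem map_span_phi_ne (ρ : 𝔻 ≃ₐ[k] 𝔻) :
    (TwoSidedIdeal.span {phi k (s ^ 2)}).map ρ ≠ TwoSidedIdeal.span {psi k (s ^ 2)} := by
  rw [span_phi, span_psi]
  intro h
  obtain ⟨g, u, rfl⟩ := exists_eq_slAut_mul_diagAut s ρ
  -- The image of `(φ)` contains the fixed element `φ`, which does not lie in `(ψ)`.
  refine phiD_notMem s (h ▸ TwoSidedIdeal.subset_span ?_)
  exact ⟨phiD s, TwoSidedIdeal.subset_span rfl, slAut_mul_diagAut_phiD s g u⟩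

end
end HeisenbergDouble

open HeisenbergDouble in
theorem mainTheorem3 (k : Type*) [Field k] [IsAlgClosed k] [CharZero k] (q : kˣ)
    (hq : ∀ n : ℕ, 0 < n → q ^ n ≠ 1) :
    -- each family of parameters defines an automorphism
    (∀ (t : Torus k) (M : SL(2, ℤ)), ∃! ρ : D k q ≃ₐ[k] D k q, IsRho ρ t M) ∧
    -- each automorphism is of this form, for exactly one family of parameters
    (∀ ρ : D k q ≃ₐ[k] D k q, ∃! p : Torus k × SL(2, ℤ), IsRho ρ p.1 p.2) ∧
    -- `Aut D_q ≅ (k*)⁴ ⋊ SL₂(ℤ)`, with `(k*)⁴` and `SL₂(ℤ)` placed as the parameters tell;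
    -- the transpose appears because `IsRho` records the images of `K` and `a` as rows
    (∃ (θ : SL(2, ℤ) →* MulAut (Torus k))
      (e : Torus k ⋊[θ] SL(2, ℤ) ≃* (D k q ≃ₐ[k] D k q)),
        (∀ t : Torus k, IsRho (e (SemidirectProduct.inl t)) t 1) ∧
        ∀ y, ∃ t : Torus k, IsRho (e y) t y.right.transpose) ∧
    -- the height one primes are `(φ)` and `(ψ)`, and no automorphism interchanges them
    (∀ P : TwoSidedIdeal (D k q), IsHeightOnePrime P ↔
      P = TwoSidedIdeal.span {phi k q} ∨ P = TwoSidedIdeal.span {psi k q}) ∧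
    (∀ ρ : D k q ≃ₐ[k] D k q,
      ¬ ((TwoSidedIdeal.span {phi k q}).map ρ = TwoSidedIdeal.span {psi k q} ∧
        (TwoSidedIdeal.span {psi k q}).map ρ = TwoSidedIdeal.span {phi k q})) := by
  -- Symmetrized monomials involve half-integral powers of `q`; a square root turns them into
  -- integral powers of `s`.
  obtain ⟨z, hz⟩ := IsAlgClosed.exists_pow_nat_eq (q : k) two_pos
  have hz0 : z ≠ 0 := by
    rintro rfl
    exact q.ne_zero (by rw [← hz, zero_pow two_ne_zero])
  obtain ⟨s, rfl⟩ : ∃ s : kˣ, s ^ 2 = q := ⟨Units.mk0 z hz0, Units.ext hz⟩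
  have : Generic s := ⟨fun n hn ↦ by
    by_contra hne
    have h1 : s ^ n = 1 := Units.ext (by rw [Units.val_zpow_eq_zpow_val, hn, Units.val_one])
    refine hq n.natAbs (Int.natAbs_pos.2 hne) ?_
    rw [← pow_mul, mul_comm, pow_mul, pow_natAbs_eq_one.2 h1, one_pow]⟩
  exact ⟨existsUnique_isRho s, existsUnique_parameters s, exists_semidirectProduct_mulEquiv s,
    isHeightOnePrime_iff_eq_span s, fun ρ h ↦ map_span_phi_ne s ρ h.1⟩
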